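/- Let $W$ be a finite-dimensional real inner product space of dimension $N$ and let $S(W)$ be its unit sphere. A polytope in $S(W)$ is a nonempty finite union of geometric simplices with $N$ linearly independent vertices (a geometric simplex is the radial projection to $S(W)$ of the convex hull of its vertices); if $W=0$ then $\emptyset$ is the unique polytope of $S(0)=\emptyset$. The polytope group $\mathrm{Pt}(W)$ is the free abelian group on the polytopes in $S(W)$ modulo the relations $[P]=\sum_i[P_i]$ whenever the $P_i$ form a finite collection of polytopes with union $P$ and pairwise disjoint interiors; $\mathrm{Pt}(0)=\mathbb Z$. If $V\subseteq W$ is a linear subspace, the suspension map $\mathrm{Pt}(V)\to\mathrm{Pt}(W)$ sends $[P]$ to the class of the join $P*S(V^\perp)$ (for $V=0$, to $[S(W)]$). The Steinberg group $\mathrm{St}(W)$, for $N\ge 1$, is the relative homology in degree $N-1$ of the nerve of the poset of nonzero linear subspaces of $W$ modulo the nerve of the subposet of proper nonzero subspaces; $\mathrm{St}(0)=\mathbb Z$. Fix an orientation of $W$. Then there is a unique homomorphism $\mathrm{Pt}(W)\to\mathrm{St}(W)$, the canonical map, which for all linearly independent $v_1,\dots,v_N\in S(W)$ sends the class of the geometric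 simplex with these vertices to $$\pm\sum_{\sigma\in S_N}\operatorname{sgn}(\sigma)\,\bigl[\langle v_{\sigma(1)}\rangle\subset\langle v_{\sigma(1)},v_{\sigma(2)}\rangle\subset\cdots\subset W\bigr],$$ where the sign is $+$ if $(v_1,\dots,v_N)$ is positively oriented and $-$ otherwise. (For $W=0$ it is the isomorphism $\mathbb Z\to\mathbb Z$ sending $[\emptyset]$ to the generator.) The suspension maps and the canonical map form a split short exact sequence of free abelian groups $$0\longrightarrow \operatorname*{colim}_{0\subseteq V\subsetneq W}\mathrm{Pt}(V)\longrightarrow \mathrm{Pt}(W)\longrightarrow \mathrm{St}(W)\longrightarrow 0,$$ where the colimit is taken over the poset of proper linear subspaces of $W$ along the suspension maps. Moreover, if a polytope $Q\subseteq S(W)$ is the suspension of a polytope in $S(U)$ and also the suspension of a polytope in $S(V)$, for linear subspaces $U,V\subseteq W$, then it is the suspension of a polytope in $S(U\cap V)$. -/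

import Mathlib

open Set

/-! ### Polytopes in the unit sphere of an inner product space -/

section Polytopes

variable {W : Type*} [NormedAddCommGroup W] [InnerProductSpace ℝ W]

/-- The radial projection to the unit sphere of the convex hull of a family of points. It is a
geometric simplex when the points are linearly independent. -/
def sphericalHull {ι : Type*} (v : ι → Metric.sphere (0 : W) 1) : Set (Metric.sphere (0 : W) 1) :=
  {x | ∃ y ∈ convexHull ℝ (range fun i => (v i : W)), (x : W) = ‖y‖⁻¹ • y}

/-- The join of two subsets of the unit sphere: the union of the two sets and of the radial
projections of all segments from a point of the first to a point of the second
(so that the join with the empty set is the other set). -/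
def sphericalJoin (P Q : Set (Metric.sphere (0 : W) 1)) : Set (Metric.sphere (0 : W) 1) :=
  P ∪ Q ∪ {x | ∃ p ∈ P, ∃ q ∈ Q, ∃ t ∈ Icc (0 : ℝ) 1,
    (x : W) = ‖(1 - t) • (p : W) + t • (q : W)‖⁻¹ • ((1 - t) • (p : W) + t • (q : W))}

/-- A (nonempty) polytope: a finite union, over a nonempty family, of top-dimensional geometric
simplices, i.e. of simplices with `dim W` linearly independent vertices. If `W = 0`, the only
simplex is the one without vertices, and `∅` is the unique polytope of the empty sphere. -/
def IsPolytope (P : Set (Metric.sphere (0 : W) 1)) : Prop :=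
  ∃ F : Set (Fin (Module.finrank ℝ W) → Metric.sphere (0 : W) 1), F.Finite ∧ F.Nonempty ∧
    (∀ v ∈ F, LinearIndependent ℝ fun i => (v i : W)) ∧ P = ⋃ v ∈ F, sphericalHull v

variable (W) in
/-- The polytopes of the unit sphere of `W`. -/
def Polytope : Type _ := {P : Set (Metric.sphere (0 : W) 1) // IsPolytope P}

/-- The geometric simplex with linearly independent vertices `v`, as a polytope. -/
def simplexPolytope (v : Fin (Module.finrank ℝ W) → Metric.sphere (0 : W) 1)
    (hv : LinearIndependent ℝ fun i => (v i : W)) : Polytope W :=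
  ⟨sphericalHull v, {v}, finite_singleton v, singleton_nonempty v, by simpa using hv, by simp⟩

/-- A weak subdivision (almost-disjoint cover) of `P`: a finite collection of polytopes with
union `P` whose interiors, in the sphere, are pairwise disjoint. (`S.Nonempty` is automatic
unless `W = 0`.) -/
def IsWeakSubdivision (S : Finset (Polytope W)) (P : Polytope W) : Prop :=
  S.Nonempty ∧ (⋃ Q ∈ S, Q.1) = P.1 ∧
    (S : Set (Polytope W)).Pairwise fun Q R => Disjoint (interior Q.1) (interior R.1)

variable (W) in
/-- The subgroup generated by the relations `[P] = ∑ᵢ [Pᵢ]` for all weak subdivisions. -/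
def subdivisionRelations : AddSubgroup (FreeAbelianGroup (Polytope W)) :=
  AddSubgroup.closure {r | ∃ (P : Polytope W) (S : Finset (Polytope W)), IsWeakSubdivision S P ∧
    r = FreeAbelianGroup.of P - ∑ Q ∈ S, FreeAbelianGroup.of Q}

variable (W) in
/-- The polytope group `Pt(W)` of the unit sphere of `W`. It is `ℤ` if `W = 0`. -/
abbrev PolytopeGroup : Type _ := FreeAbelianGroup (Polytope W) ⧸ subdivisionRelations W

/-- The class of a polytope in the polytope group. -/
def polytopeClass (P : Polytope W) : PolytopeGroup W :=
  QuotientAddGroup.mk (FreeAbelianGroup.of P)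

end Polytopes

/-! ### Suspension -/

section Suspension

variable {U V W : Type*} [NormedAddCommGroup U] [InnerProductSpace ℝ U]
  [NormedAddCommGroup V] [InnerProductSpace ℝ V] [NormedAddCommGroup W] [InnerProductSpace ℝ W]

/-- The suspension, along a linear isometric embedding `i : V → W`, of a subset `P` of the unit
sphere of `V`: the join of (the image of) `P` with the unit sphere of the orthogonal complement
of `V`. -/
def suspensionSet (i : V →ₗᵢ[ℝ] W) (P : Set (Metric.sphere (0 : V) 1)) :
    Set (Metric.sphere (0 : W) 1) :=
  sphericalJoin {x | ∃ p ∈ P, (x : W) = i (p : V)} {x | ∀ v : V, inner ℝ (i v) (x : W) = 0}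

theorem mem_sphericalHull_iff {ι : Type*} [Fintype ι] (v : ι → Metric.sphere (0 : W) 1)
    (x : Metric.sphere (0 : W) 1) :
    x ∈ sphericalHull v ↔ ∃ c : ι → ℝ, (∀ j, 0 ≤ c j) ∧ (x : W) = ∑ j, c j • (v j : W) := by
  have hx1 : ‖(x : W)‖ = 1 := by simp
  have hx0 : (x : W) ≠ 0 := by intro h; rw [h] at hx1; simp at hx1
  constructor
  · rintro ⟨y, hy, hxy⟩
    rw [mem_convexHull_iff_exists_fintype] at hy
    obtain ⟨κ, _, w, z, hw, -, hz, rfl⟩ := hy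
    choose g hg using hz
    classical
    refine ⟨fun j => ‖∑ k, w k • z k‖⁻¹ * ∑ k with g k = j, w k, fun j => ?_, ?_⟩
    · exact mul_nonneg (by positivity) (Finset.sum_nonneg fun k _ => hw k)
    · rw [hxy]
      simp only [mul_smul, ← Finset.smul_sum]
      congr 1
      rw [← Finset.sum_fiberwise (s := Finset.univ) (g := g)]
      refine Finset.sum_congr rfl fun j _ => ?_
      rw [Finset.sum_smul]
      refine Finset.sum_congr rfl fun k hk => ?_
      rw [← hg k]
      simp only [Finset.mem_filter] at hk
      rw [hk.2]
  · rintro ⟨c, hc, hxc⟩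
    have hs : 0 < ∑ j, c j := by
      refine lt_of_le_of_ne (Finset.sum_nonneg fun j _ => hc j) fun h => hx0 ?_
      have h0 := (Finset.sum_eq_zero_iff_of_nonneg fun j _ => hc j).1 h.symm
      rw [hxc]
      exact Finset.sum_eq_zero fun j hj => by rw [h0 j hj, zero_smul]
    refine ⟨(∑ j, c j)⁻¹ • (x : W), ?_, ?_⟩
    · have := Finset.centerMass_mem_convexHull (R := ℝ) (s := range fun j => (v j : W))
        Finset.univ (w := c) (z := fun j => (v j : W)) (fun j _ => hc j) hs
        (fun j _ => mem_range_self j)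
      rwa [Finset.centerMass, ← hxc] at this
    · rw [norm_smul, hx1, norm_inv, Real.norm_of_nonneg hs.le, mul_one, inv_inv, smul_smul,
        mul_inv_cancel₀ hs.ne', one_smul]

theorem eq_of_smul_eq_smul_sphere {p q : Metric.sphere (0 : V) 1} {r s : ℝ} (hr : 0 < r)
    (hs : 0 < s) (h : r • (p : V) = s • (q : V)) : p = q := by
  have h1 := congrArg norm h
  simp only [norm_smul, Real.norm_of_nonneg hr.le, Real.norm_of_nonneg hs.le,
    norm_eq_of_mem_sphere, mul_one] at h1
  subst h1
  exact Subtype.ext (smul_right_injective V hr.ne' h)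

theorem normalize_mem_sphere {x : V} (hx : x ≠ 0) : ‖x‖⁻¹ • x ∈ Metric.sphere (0 : V) 1 := by
  rw [mem_sphere_zero_iff_norm, norm_smul, norm_inv, norm_norm,
    inv_mul_cancel₀ (norm_ne_zero_iff.2 hx)]

variable [FiniteDimensional ℝ U] [FiniteDimensional ℝ V] [FiniteDimensional ℝ W]

theorem adjoint_isometry_apply (i : V →ₗᵢ[ℝ] W) (v : V) :
    LinearMap.adjoint i.toLinearMap (i v) = v :=
  congrArg (fun f : V →ₗ[ℝ] V => f v) i.adjoint_comp_self'

theorem adjoint_eq_zero_iff (i : V →ₗᵢ[ℝ] W) (x : W) :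
    LinearMap.adjoint i.toLinearMap x = 0 ↔ ∀ v : V, inner ℝ (i v) x = 0 := by
  constructor
  · intro h v
    rw [← LinearIsometry.coe_toLinearMap, ← LinearMap.adjoint_inner_right, h, inner_zero_right]
  · intro h
    rw [← inner_self_eq_zero (𝕜 := ℝ), LinearMap.adjoint_inner_right]
    exact h _

theorem mem_suspensionSet_iff (i : V →ₗᵢ[ℝ] W) (P : Set (Metric.sphere (0 : V) 1))
    (x : Metric.sphere (0 : W) 1) :
    x ∈ suspensionSet i P ↔ LinearMap.adjoint i.toLinearMap (x : W) = 0 ∨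
      ∃ p ∈ P, ∃ r : ℝ, 0 < r ∧ LinearMap.adjoint i.toLinearMap (x : W) = r • (p : V) := by
  have hx1 : ‖(x : W)‖ = 1 := by simp
  constructor
  · rintro ((⟨p, hp, hx⟩ | hx) | ⟨p, ⟨p', hp', hp⟩, q, hq, t, ht, hx⟩)
    · exact Or.inr ⟨p, hp, 1, one_pos, by rw [hx, adjoint_isometry_apply, one_smul]⟩
    · exact Or.inl ((adjoint_eq_zero_iff i _).2 hx)
    · have hq0 := (adjoint_eq_zero_iff i _).2 hq
      have key : LinearMap.adjoint i.toLinearMap (x : W) =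
          (‖(1 - t) • (p : W) + t • (q : W)‖⁻¹ * (1 - t)) • (p' : V) := by
        rw [hx, map_smul, map_add, map_smul, map_smul, hq0, hp, adjoint_isometry_apply,
          smul_zero, add_zero, smul_smul]
      rcases eq_or_lt_of_le
        (mul_nonneg (inv_nonneg.2 (norm_nonneg ((1 - t) • (p : W) + t • (q : W))))
          (sub_nonneg.2 ht.2)) with h0 | h0
      · left; rw [key, ← h0, zero_smul]
      · exact Or.inr ⟨p', hp', _, h0, key⟩
  · rintro (h | ⟨p, hp, r, hr, h⟩)
    · exact Or.inl (Or.inr ((adjoint_eq_zero_iff i _).1 h))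
    · set w : W := (x : W) - r • i p with hw
      have hwp : ∀ v : V, inner ℝ (i v) w = 0 := by
        rw [← adjoint_eq_zero_iff, hw, map_sub, map_smul, adjoint_isometry_apply, h, sub_self]
      have hxw : (x : W) = r • i p + w := by rw [hw]; abel
      have hip : ‖i (p : V)‖ = 1 := by simp
      by_cases h0 : w = 0
      · left; left
        refine ⟨p, hp, ?_⟩
        rw [h0, add_zero] at hxw
        rw [hxw, norm_smul, hip, mul_one, Real.norm_of_nonneg hr.le] at hx1
        rw [hxw, hx1, one_smul]
      · right
        have hwn : 0 < ‖w‖ := norm_pos_iff.2 h0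
        have hs : 0 < r + ‖w‖ := by positivity
        have e : (1 - ‖w‖ / (r + ‖w‖)) • i (p : V) + (‖w‖ / (r + ‖w‖)) • (‖w‖⁻¹ • w) =
            (r + ‖w‖)⁻¹ • (x : W) := by
          rw [hxw, smul_add, smul_smul, smul_smul]
          congr 2 <;> field_simp
          ring
        refine ⟨⟨i p, by simp⟩, ⟨p, hp, rfl⟩, ⟨‖w‖⁻¹ • w, by simp [norm_smul, hwn.ne']⟩, ?_,
          ‖w‖ / (r + ‖w‖), ⟨by positivity, (div_le_one hs).2 (by linarith)⟩, ?_⟩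
        · intro v
          change inner ℝ (i v) (‖w‖⁻¹ • w) = 0
          rw [inner_smul_right, hwp, mul_zero]
        · change (x : W) = ‖(1 - ‖w‖ / (r + ‖w‖)) • i (p : V) +
            (‖w‖ / (r + ‖w‖)) • (‖w‖⁻¹ • w)‖⁻¹ • ((1 - ‖w‖ / (r + ‖w‖)) • i (p : V) +
              (‖w‖ / (r + ‖w‖)) • (‖w‖⁻¹ • w))
          rw [e, norm_smul, hx1, mul_one, norm_inv, Real.norm_of_nonneg hs.le, inv_inv, smul_smul,
            mul_inv_cancel₀ hs.ne', one_smul]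

theorem suspensionSet_injective (i : V →ₗᵢ[ℝ] W) : Function.Injective (suspensionSet i) := by
  have key : ∀ (P : Set (Metric.sphere (0 : V) 1)) (p : Metric.sphere (0 : V) 1),
      p ∈ P ↔ (⟨i p, by simp⟩ : Metric.sphere (0 : W) 1) ∈ suspensionSet i P := by
    intro P p
    rw [mem_suspensionSet_iff]
    simp only [adjoint_isometry_apply]
    constructor
    · exact fun hp => Or.inr ⟨p, hp, 1, one_pos, (one_smul _ _).symm⟩
    · rintro (h | ⟨q, hq, r, hr, h⟩)
      · have := norm_eq_of_mem_sphere p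
        rw [h] at this
        simp at this
      · rw [eq_of_smul_eq_smul_sphere one_pos hr ((one_smul ℝ (p : V)).trans h)]
        exact hq
  intro P Q h
  ext p
  rw [key P, key Q, h]

theorem suspensionSet_comp (j : V →ₗᵢ[ℝ] W) (i : U →ₗᵢ[ℝ] V)
    (P : Set (Metric.sphere (0 : U) 1)) :
    suspensionSet (j.comp i) P = suspensionSet j (suspensionSet i P) := by
  have hadj : ∀ x : W, LinearMap.adjoint (j.comp i).toLinearMap x =
      LinearMap.adjoint i.toLinearMap (LinearMap.adjoint j.toLinearMap x) := fun x => by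
    rw [show (j.comp i).toLinearMap = j.toLinearMap ∘ₗ i.toLinearMap from rfl,
      LinearMap.adjoint_comp, LinearMap.comp_apply]
  ext x
  simp only [mem_suspensionSet_iff, hadj]
  set y := LinearMap.adjoint j.toLinearMap (x : W)
  constructor
  · intro h
    by_cases hy : y = 0
    · exact Or.inl hy
    · right
      have hn : 0 < ‖y‖ := norm_pos_iff.2 hy
      refine ⟨⟨‖y‖⁻¹ • y, by simp [norm_smul, hn.ne']⟩, ?_, ‖y‖, hn, ?_⟩
      · rcases h with h | ⟨p, hp, r, hr, h⟩
        · left; rw [map_smul, h, smul_zero]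
        · exact Or.inr ⟨p, hp, ‖y‖⁻¹ * r, by positivity, by rw [map_smul, h, smul_smul]⟩
      · change y = ‖y‖ • ‖y‖⁻¹ • y
        rw [smul_smul, mul_inv_cancel₀ hn.ne', one_smul]
  · rintro (h | ⟨q, h', s, hs, h⟩)
    · left; rw [h, map_zero]
    · rw [h, map_smul]
      rcases h' with h' | ⟨p, hp, r, hr, h'⟩
      · left; rw [h', smul_zero]
      · exact Or.inr ⟨p, hp, s * r, by positivity, by rw [h', smul_smul]⟩

theorem isPolytope_suspensionSet (i : V →ₗᵢ[ℝ] W) {P : Set (Metric.sphere (0 : V) 1)}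
    (hP : IsPolytope P) : IsPolytope (suspensionSet i P) := by
  obtain ⟨F, hF, hFn, hFl, rfl⟩ := hP
  set K : Submodule ℝ W := (LinearMap.range i.toLinearMap)ᗮ with hK
  have hmemK : ∀ w : W, w ∈ K ↔ LinearMap.adjoint i.toLinearMap w = 0 := fun w => by
    rw [hK, Submodule.mem_orthogonal, adjoint_eq_zero_iff]
    simp
  let b := stdOrthonormalBasis ℝ K
  have hdim : Module.finrank ℝ V + Module.finrank ℝ K = Module.finrank ℝ W := by
    have h1 := Submodule.finrank_add_finrank_orthogonal (LinearMap.range i.toLinearMap)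
    rwa [LinearMap.finrank_range_of_inj i.injective] at h1
  let f : Fin (Module.finrank ℝ V) ⊕ Fin (Module.finrank ℝ K) ≃ Fin (Module.finrank ℝ W) :=
    finSumFinEquiv.trans (finCongr hdim)
  let bs : Bool → Fin (Module.finrank ℝ K) → Metric.sphere (0 : W) 1 := fun s k =>
    ⟨(if s then (1 : ℝ) else -1) • (b k : W), by
      have : ‖(b k : W)‖ = 1 := b.orthonormal.1 k
      cases s <;> simp [this]⟩
  let g : (Fin (Module.finrank ℝ V) → Metric.sphere (0 : V) 1) ×
      (Fin (Module.finrank ℝ K) → Bool) → Fin (Module.finrank ℝ W) → Metric.sphere (0 : W) 1 :=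
    fun a m => Sum.elim (fun k => (⟨i (a.1 k), by simp⟩ : Metric.sphere (0 : W) 1))
      (fun k => bs (a.2 k) k) (f.symm m)
  refine ⟨g '' (F ×ˢ univ), (hF.prod finite_univ).image g,
    (hFn.prod univ_nonempty).image g, ?_, ?_⟩
  · rintro _ ⟨⟨v, ε⟩, ⟨hv, -⟩, rfl⟩
    have h1 : LinearIndependent ℝ fun k => i (v k : V) :=
      (hFl v hv).map' i.toLinearMap (LinearMap.ker_eq_bot.2 i.injective)
    have h3 : LinearIndependent ℝ fun k => (b k : W) := by
      have := b.toBasis.linearIndependent.map' K.subtype K.ker_subtype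
      simpa [Function.comp_def] using this
    have h2 : LinearIndependent ℝ fun k => ((bs (ε k) k : Metric.sphere (0 : W) 1) : W) := by
      convert h3.units_smul fun k => if ε k then (1 : ℝˣ) else -1 using 1
      ext k
      simp only [bs, Pi.smul_apply']
      split_ifs <;> simp
    have h4 := h1.sum_type h2 ((Submodule.orthogonal_disjoint _).mono
      (Submodule.span_le.2 (by
        rintro _ ⟨k, rfl⟩
        exact LinearMap.mem_range_self i.toLinearMap (v k : V)))
      (Submodule.span_le.2 (by
        rintro _ ⟨k, rfl⟩
        exact K.smul_mem _ (b k).2)))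
    have h5 := h4.comp f.symm f.symm.injective
    have h6 : (fun m => ((g (v, ε) m : Metric.sphere (0 : W) 1) : W)) =
        (Sum.elim (fun k => i (v k : V)) fun k => (bs (ε k) k : W)) ∘ f.symm := by
      ext m
      simp only [g, Function.comp_apply]
      rcases f.symm m with k | k <;> rfl
    rw [h6]
    exact h5
  · have hg : ∀ (v : Fin (Module.finrank ℝ V) → Metric.sphere (0 : V) 1)
        (ε : Fin (Module.finrank ℝ K) → Bool) (c : Fin (Module.finrank ℝ W) → ℝ),
        ∑ m, c m • ((g (v, ε) m : Metric.sphere (0 : W) 1) : W) =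
          i (∑ k, c (f (Sum.inl k)) • (v k : V)) +
            ∑ k, c (f (Sum.inr k)) • (if ε k then (1 : ℝ) else -1) • (b k : W) := by
      intro v ε c
      rw [← f.sum_comp, Fintype.sum_sum_type, map_sum]
      simp [g, bs]
    have hsum : ∀ d : Fin (Module.finrank ℝ K) → ℝ, ∑ k, d k • (b k : W) ∈ K := fun d =>
      Submodule.sum_mem _ fun k _ => K.smul_mem _ (b k).2
    ext x
    simp only [mem_iUnion, exists_prop]
    rw [mem_suspensionSet_iff]
    constructor
    · intro h
      obtain ⟨v, hv, c, hc, hxc⟩ : ∃ v ∈ F, ∃ c : Fin (Module.finrank ℝ V) → ℝ, (∀ k, 0 ≤ c k) ∧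
          LinearMap.adjoint i.toLinearMap (x : W) = ∑ k, c k • (v k : V) := by
        rcases h with h | ⟨p, hp, r, hr, h⟩
        · obtain ⟨v, hv⟩ := hFn
          exact ⟨v, hv, 0, fun _ => le_rfl, by simp [h]⟩
        · simp only [mem_iUnion, exists_prop] at hp
          obtain ⟨v, hv, hp⟩ := hp
          obtain ⟨c, hc, hpc⟩ := (mem_sphericalHull_iff v p).1 hp
          exact ⟨v, hv, fun k => r * c k, fun k => mul_nonneg hr.le (hc k), by
            rw [h, hpc, Finset.smul_sum]; simp only [smul_smul]⟩
      have hw : (x : W) - i (LinearMap.adjoint i.toLinearMap (x : W)) ∈ K := by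
        rw [hmemK, map_sub, adjoint_isometry_apply, sub_self]
      let d : Fin (Module.finrank ℝ K) → ℝ := fun k => b.repr ⟨_, hw⟩ k
      have hd : (x : W) - i (LinearMap.adjoint i.toLinearMap (x : W)) = ∑ k, d k • (b k : W) := by
        have := congrArg (Subtype.val) (b.sum_repr ⟨_, hw⟩)
        simpa using this.symm
      refine ⟨g (v, fun k => decide (0 ≤ d k)), ⟨_, ⟨hv, mem_univ _⟩, rfl⟩,
        (mem_sphericalHull_iff _ _).2 ⟨fun m => Sum.elim c (fun k => |d k|) (f.symm m), ?_, ?_⟩⟩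
      · intro m
        change 0 ≤ Sum.elim c (fun k => |d k|) (f.symm m)
        rcases f.symm m with k | k
        · exact hc k
        · exact abs_nonneg _
      · rw [hg]
        simp only [Equiv.symm_apply_apply, Sum.elim_inl, Sum.elim_inr, ← hxc]
        rw [← sub_eq_iff_eq_add', hd]
        refine Finset.sum_congr rfl fun k _ => ?_
        rw [smul_smul]
        congr 1
        by_cases h0 : 0 ≤ d k
        · simp [h0, abs_of_nonneg h0]
        · simp [h0, abs_of_neg (not_le.1 h0)]
    · rintro ⟨_, ⟨⟨v, ε⟩, ⟨hv, -⟩, rfl⟩, hx⟩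
      obtain ⟨c, hc, hxc⟩ := (mem_sphericalHull_iff _ _).1 hx
      rw [hg] at hxc
      simp only [smul_smul] at hxc
      have hax : LinearMap.adjoint i.toLinearMap (x : W) =
          ∑ k, c (f (Sum.inl k)) • (v k : V) := by
        rw [hxc, map_add, adjoint_isometry_apply, (hmemK _).1 (hsum _), add_zero]
      by_cases h0 : LinearMap.adjoint i.toLinearMap (x : W) = 0
      · exact Or.inl h0
      · right
        set y := LinearMap.adjoint i.toLinearMap (x : W)
        have hn : 0 < ‖y‖ := norm_pos_iff.2 h0
        refine ⟨⟨‖y‖⁻¹ • y, by simp [norm_smul, hn.ne']⟩, ?_, ‖y‖, hn, ?_⟩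
        · simp only [mem_iUnion, exists_prop]
          refine ⟨v, hv, (mem_sphericalHull_iff _ _).2
            ⟨fun k => ‖y‖⁻¹ * c (f (Sum.inl k)), fun k => mul_nonneg (by positivity) (hc _), ?_⟩⟩
          change ‖y‖⁻¹ • y = _
          simp only [mul_smul, ← Finset.smul_sum, hax]
        · change y = ‖y‖ • ‖y‖⁻¹ • y
          rw [smul_smul, mul_inv_cancel₀ hn.ne', one_smul]

/-- The suspension of a polytope of the sphere of `V` is a polytope of the sphere of `W`. If
`V = 0`, the suspension of the empty polytope is the whole sphere of `W`. -/
def suspensionPolytope (i : V →ₗᵢ[ℝ] W) (P : Polytope V) : Polytope W :=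
  ⟨suspensionSet i P.1, isPolytope_suspensionSet i P.2⟩

/-- A polytope of the sphere of `W` is a suspension from the subspace `V` if it is the suspension
of some polytope of the sphere of `V`. -/
def IsSuspensionFrom (V : Submodule ℝ W) (Q : Polytope W) : Prop :=
  ∃ P : Polytope V, suspensionPolytope V.subtypeₗᵢ P = Q

theorem suspensionPolytope_injective (i : V →ₗᵢ[ℝ] W) :
    Function.Injective (suspensionPolytope i) := fun _ _ h =>
  Subtype.ext (suspensionSet_injective i (congrArg Subtype.val h))

theorem disjoint_interior_suspensionSet (i : V →ₗᵢ[ℝ] W) {P Q : Set (Metric.sphere (0 : V) 1)}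
    (hne : P ≠ Q) (h : Disjoint (interior P) (interior Q)) :
    Disjoint (interior (suspensionSet i P)) (interior (suspensionSet i Q)) := by
  obtain ⟨p₀⟩ : Nonempty (Metric.sphere (0 : V) 1) := by
    by_contra hV
    rw [not_nonempty_iff] at hV
    exact hne (Subsingleton.elim _ _)
  rw [Set.disjoint_iff]
  rintro x ⟨hxP, hxQ⟩
  -- every point `r • i p + w` near `x` yields a common interior point of `P` and `Q`
  have main : ∀ (p : Metric.sphere (0 : V) 1) (r : ℝ) (w : W), 0 < r →
      LinearMap.adjoint i.toLinearMap w = 0 → ∀ z : Metric.sphere (0 : W) 1,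
      (∃ s : ℝ, 0 < s ∧ (z : W) = s • (r • i (p : V) + w)) →
      z ∈ interior (suspensionSet i P) → z ∈ interior (suspensionSet i Q) → False := by
    rintro p r w hr hw z ⟨s, hs, hz⟩ hzP hzQ
    have hne0 : ∀ p' : Metric.sphere (0 : V) 1, r • i (p' : V) + w ≠ 0 := fun p' h0 => by
      have h1 := congrArg (LinearMap.adjoint i.toLinearMap) h0
      rw [map_add, map_smul, adjoint_isometry_apply, hw, add_zero, map_zero] at h1
      have h2 := congrArg norm h1
      simp [norm_smul, hr.ne'] at h2
    let φ : Metric.sphere (0 : V) 1 → Metric.sphere (0 : W) 1 := fun p' =>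
      ⟨‖r • i (p' : V) + w‖⁻¹ • (r • i (p' : V) + w), normalize_mem_sphere (hne0 p')⟩
    have hφ : Continuous φ := by
      refine Continuous.subtype_mk ?_ _
      have hc : Continuous fun p' : Metric.sphere (0 : V) 1 => r • i (p' : V) + w :=
        ((i.continuous.comp continuous_subtype_val).const_smul r).add continuous_const
      exact (hc.norm.inv₀ fun p' => norm_ne_zero_iff.2 (hne0 p')).smul hc
    have hφp : φ p = z := by
      have hn := norm_pos_iff.2 (hne0 p)
      exact eq_of_smul_eq_smul_sphere (r := ‖r • i (p : V) + w‖) (s := s⁻¹) hn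
        (inv_pos.2 hs) (by
          rw [hz, smul_smul s⁻¹, inv_mul_cancel₀ hs.ne', one_smul]
          change _ • _ • _ = _
          rw [smul_smul, mul_inv_cancel₀ hn.ne', one_smul])
    have hsub : ∀ R : Set (Metric.sphere (0 : V) 1), φ ⁻¹' (suspensionSet i R) ⊆ R := by
      intro R p' hp'
      have hn := norm_pos_iff.2 (hne0 p')
      have ha : LinearMap.adjoint i.toLinearMap (φ p' : W) =
          (‖r • i (p' : V) + w‖⁻¹ * r) • (p' : V) := by
        change LinearMap.adjoint i.toLinearMap (_ • (_ + _)) = _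
        rw [map_smul, map_add, map_smul, adjoint_isometry_apply, hw, add_zero, smul_smul]
      have hpos : 0 < ‖r • i (p' : V) + w‖⁻¹ * r := by positivity
      rcases (mem_suspensionSet_iff i R (φ p')).1 hp' with h0 | ⟨q, hq, t, ht, h0⟩
      · rw [ha] at h0
        have := congrArg norm h0
        rw [norm_smul, Real.norm_of_nonneg hpos.le, norm_eq_of_mem_sphere, mul_one,
          norm_zero] at this
        exact absurd this hpos.ne'
      · rw [ha] at h0
        rw [eq_of_smul_eq_smul_sphere hpos ht h0]
        exact hq
    have hint : ∀ R : Set (Metric.sphere (0 : V) 1), z ∈ interior (suspensionSet i R) →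
        p ∈ interior R := fun R hzR =>
      interior_maximal ((preimage_mono interior_subset).trans (hsub R))
        (isOpen_interior.preimage hφ) (by rw [mem_preimage, hφp]; exact hzR)
    exact (Set.disjoint_iff.1 h) ⟨hint P hzP, hint Q hzQ⟩
  set y := LinearMap.adjoint i.toLinearMap (x : W) with hy
  by_cases h0 : y = 0
  · have hne0 : ∀ t : ℝ, (x : W) + t • i (p₀ : V) ≠ 0 := fun t ht => by
      have h1 := congrArg (LinearMap.adjoint i.toLinearMap) ht
      rw [map_add, map_smul, adjoint_isometry_apply, ← hy, h0, zero_add, map_zero] at h1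
      have h2 := congrArg norm h1
      rw [norm_smul, norm_eq_of_mem_sphere, mul_one, norm_zero, norm_eq_zero] at h2
      rw [h2, zero_smul, add_zero] at ht
      have := norm_eq_of_mem_sphere x
      rw [ht] at this
      simp at this
    let γ : ℝ → Metric.sphere (0 : W) 1 := fun t =>
      ⟨‖(x : W) + t • i (p₀ : V)‖⁻¹ • ((x : W) + t • i (p₀ : V)),
        normalize_mem_sphere (hne0 t)⟩
    have hγ : Continuous γ := by
      refine Continuous.subtype_mk ?_ _
      have hc : Continuous fun t : ℝ => (x : W) + t • i (p₀ : V) := by fun_prop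
      exact (hc.norm.inv₀ fun t => norm_ne_zero_iff.2 (hne0 t)).smul hc
    have hγ0 : γ 0 = x := Subtype.ext (by simp [γ])
    have hO : IsOpen (γ ⁻¹' (interior (suspensionSet i P) ∩ interior (suspensionSet i Q))) :=
      (isOpen_interior.inter isOpen_interior).preimage hγ
    obtain ⟨δ, hδ, hball⟩ := Metric.isOpen_iff.1 hO 0 (by
      rw [mem_preimage, hγ0]; exact ⟨hxP, hxQ⟩)
    have hmem := hball (show δ / 2 ∈ Metric.ball (0 : ℝ) δ by
      rw [Metric.mem_ball, dist_zero_right, Real.norm_of_nonneg (by positivity)]; linarith)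
    refine main p₀ (δ / 2) x (by positivity) h0 (γ (δ / 2))
      ⟨‖(x : W) + (δ / 2) • i (p₀ : V)‖⁻¹, inv_pos.2 (norm_pos_iff.2 (hne0 _)), ?_⟩ hmem.1 hmem.2
    rw [add_comm ((δ / 2) • i (p₀ : V))]
  · have hn : 0 < ‖y‖ := norm_pos_iff.2 h0
    refine main ⟨‖y‖⁻¹ • y, by simp [norm_smul, hn.ne']⟩ ‖y‖ ((x : W) - i y) hn
      (by rw [map_sub, adjoint_isometry_apply, ← hy, sub_self]) x ⟨1, one_pos, ?_⟩ hxP hxQ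
    rw [one_smul]
    change (x : W) = ‖y‖ • i (‖y‖⁻¹ • y) + ((x : W) - i y)
    rw [map_smul, smul_smul, mul_inv_cancel₀ hn.ne', one_smul, add_sub_cancel]

theorem IsWeakSubdivision.suspension [DecidableEq (Polytope W)] (i : V →ₗᵢ[ℝ] W)
    {S : Finset (Polytope V)} {P : Polytope V} (h : IsWeakSubdivision S P) :
    IsWeakSubdivision (S.image (suspensionPolytope i)) (suspensionPolytope i P) := by
  obtain ⟨hS, hU, hD⟩ := h
  refine ⟨hS.image _, ?_, ?_⟩
  · ext x
    rw [Finset.set_biUnion_finset_image]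
    simp only [mem_iUnion, exists_prop, suspensionPolytope, mem_suspensionSet_iff, ← hU]
    constructor
    · rintro ⟨Q, hQ, h | ⟨p, hp, h⟩⟩
      · exact Or.inl h
      · exact Or.inr ⟨p, ⟨Q, hQ, hp⟩, h⟩
    · rintro (h | ⟨p, ⟨Q, hQ, hp⟩, h⟩)
      · obtain ⟨Q, hQ⟩ := hS
        exact ⟨Q, hQ, Or.inl h⟩
      · exact ⟨Q, hQ, Or.inr ⟨p, hp, h⟩⟩
  · intro Q' hQ' R' hR' hne
    simp only [Finset.coe_image, mem_image, Finset.mem_coe] at hQ' hR'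
    obtain ⟨Q, hQ, rfl⟩ := hQ'
    obtain ⟨R, hR, rfl⟩ := hR'
    have hQR : Q ≠ R := fun h => hne (by rw [h])
    exact disjoint_interior_suspensionSet i (fun h => hQR (Subtype.ext h)) (hD hQ hR hQR)

/-- The suspension homomorphism `Pt(V) → Pt(W)`, `[P] ↦ [P * S(Vᗮ)]`. -/
def suspensionHom (i : V →ₗᵢ[ℝ] W) : PolytopeGroup V →+ PolytopeGroup W :=
  QuotientAddGroup.map (subdivisionRelations V) (subdivisionRelations W)
    (FreeAbelianGroup.map (suspensionPolytope i)) (by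
      classical
      rw [subdivisionRelations, AddSubgroup.closure_le]
      rintro _ ⟨P, S, h, rfl⟩
      refine AddSubgroup.subset_closure ⟨suspensionPolytope i P,
        S.image (suspensionPolytope i), h.suspension i, ?_⟩
      rw [Finset.sum_image fun Q _ R _ hQR => suspensionPolytope_injective i hQR]
      simp)

theorem suspensionHom_comp (j : V →ₗᵢ[ℝ] W) (i : U →ₗᵢ[ℝ] V) (x : PolytopeGroup U) :
    suspensionHom (j.comp i) x = suspensionHom j (suspensionHom i x) := by
  obtain ⟨a, rfl⟩ := QuotientAddGroup.mk_surjective x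
  simp only [suspensionHom, QuotientAddGroup.map_mk]
  congr 1
  have h : suspensionPolytope (j.comp i) = suspensionPolytope j ∘ suspensionPolytope i :=
    funext fun P => Subtype.ext (suspensionSet_comp j i P.1)
  rw [h, FreeAbelianGroup.map_comp_apply]

end Suspension

/-! ### The colimit of the polytope groups of the proper subspaces -/

section Colimit

variable (W : Type*) [NormedAddCommGroup W] [InnerProductSpace ℝ W] [FiniteDimensional ℝ W]

/-- The inclusion of a subspace in a larger one, as a linear isometric embedding. -/
def inclusionIsometry {W : Type*} [NormedAddCommGroup W] [InnerProductSpace ℝ W]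
    {U V : Submodule ℝ W} (h : U ≤ V) : U →ₗᵢ[ℝ] V :=
  ⟨Submodule.inclusion h, fun _ => rfl⟩

open Classical in
/-- The colimit of the groups `Pt(V)` over the poset of all proper subspaces `0 ⊆ V ⊊ W` along
the suspension maps, i.e. the quotient of `⨁ V, Pt(V)` by the identification of each `x ∈ Pt(U)`
with its suspension in `Pt(V)`, for `U ⊆ V`. (The poset need not be directed.) -/
abbrev SuspensionColimit : Type _ :=
  AddCommGroup.DirectLimit (fun V : {V : Submodule ℝ W // V < ⊤} => PolytopeGroup V.1)
    fun _ _ h => suspensionHom (inclusionIsometry h)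

open Classical in
/-- The map from the colimit to `Pt(W)` given by the suspension maps `Pt(V) → Pt(W)`. -/
noncomputable def suspensionColimitHom : SuspensionColimit W →+ PolytopeGroup W :=
  AddCommGroup.DirectLimit.lift _ _ _ (fun V => suspensionHom V.1.subtypeₗᵢ) fun _ V h x =>
    (suspensionHom_comp V.1.subtypeₗᵢ (inclusionIsometry h) x).symm

end Colimit

/-! ### The Steinberg group -/

section Steinberg

variable (W : Type*) [NormedAddCommGroup W] [InnerProductSpace ℝ W]

/-- Strictly increasing chains `0 = U₀ < U₁ < ⋯ < U_k = W` of linear subspaces. For `W ≠ 0`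
these are the `(k-1)`-simplices `U₁ < ⋯ < U_k = W` of the nerve of the poset of nonzero subspaces
of `W` that do not lie in the nerve of the poset of proper nonzero subspaces. -/
def SubspaceChain (k : ℕ) : Type _ :=
  {U : Fin (k + 1) → Submodule ℝ W // StrictMono U ∧ U 0 = ⊥ ∧ U (Fin.last k) = ⊤}

/-- The group of simplicial chains, modulo those of the subcomplex of proper subspaces. -/
abbrev ChainGroup (k : ℕ) : Type _ := SubspaceChain W k →₀ ℤ

variable {W}

/-- Omit the `i`-th of the intermediate subspaces `U₁, …, U_k` of a chain. -/
def SubspaceChain.erase {k : ℕ} (U : SubspaceChain W (k + 1)) (i : Fin k) : SubspaceChain W k :=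
  ⟨U.1 ∘ i.succ.castSucc.succAbove, U.2.1.comp (Fin.strictMono_succAbove _), by
    rw [Function.comp_apply, Fin.succAbove_ne_zero_zero (by simp [Fin.ext_iff]), U.2.2.1], by
    rw [Function.comp_apply, Fin.succAbove_ne_last_last (by simp [Fin.ext_iff]; omega),
      U.2.2.2]⟩

variable (W)

/-- The simplicial boundary. The face that omits `W` lies in the subcomplex of proper subspaces,
so it contributes zero. -/
noncomputable def chainBoundary (k : ℕ) : ChainGroup W (k + 1) →+ ChainGroup W k :=
  Finsupp.liftAddHom fun U => ∑ i : Fin k,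
    (-1 : ℤ) ^ (i : ℕ) • Finsupp.singleAddHom (U.erase i)

/-- The cycles. -/
noncomputable def chainCycles : (k : ℕ) → AddSubgroup (ChainGroup W k)
  | 0 => ⊤
  | k + 1 => (chainBoundary W k).ker

/-- The boundaries. -/
noncomputable def chainBoundaries (k : ℕ) : AddSubgroup (ChainGroup W k) :=
  (chainBoundary W k).range

/-- The Steinberg group `St(W)`: for `dim W = n + 1 > 0`, the relative homology in degree `n` of
the nerve of the poset of nonzero subspaces of `W` modulo the nerve of the poset of
proper nonzero subspaces. It is `ℤ` if `W = 0`. -/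
abbrev SteinbergGroup : Type _ :=
  chainCycles W (Module.finrank ℝ W) ⧸
    (chainBoundaries W (Module.finrank ℝ W)).addSubgroupOf (chainCycles W (Module.finrank ℝ W))

variable {W}

/-- The complete flag of the spans of the initial segments of a basis. -/
def basisFlag {n : ℕ} (v : Fin n → W) (hv : LinearIndependent ℝ v)
    (hs : Submodule.span ℝ (range v) = ⊤) : SubspaceChain W n :=
  ⟨fun j => Submodule.span ℝ (v '' {a | a.castSucc < j}), by
    refine Fin.strictMono_iff_lt_succ.2 fun j => lt_of_le_of_ne
      (Submodule.span_mono (image_mono fun a ha => lt_trans ha j.castSucc_lt_succ)) fun h => ?_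
    have h1 : v j ∈ Submodule.span ℝ (v '' {a | a.castSucc < j.succ}) :=
      Submodule.subset_span ⟨j, j.castSucc_lt_succ, rfl⟩
    rw [← h] at h1
    exact hv.notMem_span_image (s := {a | a.castSucc < j.castSucc}) (by simp) h1, by
    simp, by simp [Fin.castSucc_lt_last, hs]⟩

theorem basisFlag_comp_span {n : ℕ} (v : Fin n → W) (hs : Submodule.span ℝ (range v) = ⊤)
    (σ : Equiv.Perm (Fin n)) : Submodule.span ℝ (range (v ∘ σ)) = ⊤ := by
  rw [σ.surjective.range_comp, hs]

/-- The alternating sum of the complete flags of all orderings of a basis. -/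
noncomputable def apartmentChain {n : ℕ} (v : Fin n → W) (hv : LinearIndependent ℝ v)
    (hs : Submodule.span ℝ (range v) = ⊤) : ChainGroup W n :=
  ∑ σ : Equiv.Perm (Fin n), (Equiv.Perm.sign σ : ℤ) •
    Finsupp.single (basisFlag (v ∘ σ) (hv.comp σ σ.injective) (basisFlag_comp_span v hs σ)) 1

theorem erase_basisFlag_swap {k : ℕ} (v : Fin (k + 1) → W) (hv : LinearIndependent ℝ v)
    (hs : Submodule.span ℝ (range v) = ⊤) (σ : Equiv.Perm (Fin (k + 1))) (i : Fin k) :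
    (basisFlag (v ∘ (σ * Equiv.swap i.castSucc i.succ : Equiv.Perm (Fin (k + 1))))
      (hv.comp _ (Equiv.injective _)) (basisFlag_comp_span v hs _)).erase i =
    (basisFlag (v ∘ σ) (hv.comp σ σ.injective) (basisFlag_comp_span v hs σ)).erase i := by
  refine Subtype.ext (funext fun j => ?_)
  simp only [SubspaceChain.erase, basisFlag, Function.comp_apply]
  generalize hj : i.succ.castSucc.succAbove j = m
  have hm : m ≠ i.succ.castSucc := by rw [← hj]; exact Fin.succAbove_ne _ _
  have hiff : ∀ a : Fin (k + 1), (Equiv.swap i.castSucc i.succ a).castSucc < m ↔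
      a.castSucc < m := by
    intro a
    have h1 : (m : ℕ) ≠ i + 1 := fun h => hm (Fin.ext (by simpa using h))
    rw [Equiv.swap_apply_def]
    split_ifs with ha ha
    · subst ha; simp only [Fin.lt_def, Fin.val_castSucc, Fin.val_succ]; omega
    · subst ha; simp only [Fin.lt_def, Fin.val_castSucc, Fin.val_succ]; omega
    · rfl
  congr 1
  ext x
  constructor
  · rintro ⟨a, ha, rfl⟩
    exact ⟨Equiv.swap i.castSucc i.succ a, (hiff a).2 ha, rfl⟩
  · rintro ⟨a, ha, rfl⟩
    exact ⟨Equiv.swap i.castSucc i.succ a, (hiff a).2 ha, by simp⟩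

theorem apartmentChain_mem_cycles {n : ℕ} (v : Fin n → W) (hv : LinearIndependent ℝ v)
    (hs : Submodule.span ℝ (range v) = ⊤) : apartmentChain v hv hs ∈ chainCycles W n := by
  cases n with
  | zero => exact AddSubgroup.mem_top _
  | succ k =>
    change chainBoundary W k (apartmentChain v hv hs) = 0
    simp only [apartmentChain, map_sum, map_zsmul, chainBoundary, Finsupp.liftAddHom_apply_single,
      AddMonoidHom.finsetSum_apply, Finset.smul_sum]
    rw [Finset.sum_comm]
    refine Finset.sum_eq_zero fun i _ => ?_
    refine Finset.sum_involution (fun σ _ => σ * Equiv.swap i.castSucc i.succ) ?_ ?_ ?_ ?_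
    · intro σ _
      have h := erase_basisFlag_swap v hv hs σ i
      have hsg : ((Equiv.Perm.sign (σ * Equiv.swap i.castSucc i.succ) : ℤˣ) : ℤ) =
          -(Equiv.Perm.sign σ : ℤ) := by
        rw [Equiv.Perm.sign_mul, Equiv.Perm.sign_swap (by simp [Fin.ext_iff])]
        simp
      rw [hsg, AddMonoidHom.smul_apply, AddMonoidHom.smul_apply, Finsupp.singleAddHom_apply,
        Finsupp.singleAddHom_apply, h, neg_smul, add_neg_cancel]
    · intro σ _ _ h
      have := congrFun (congrArg DFunLike.coe (mul_eq_left.1 h)) i.castSucc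
      simp [Fin.ext_iff] at this
    · simp
    · intro σ _
      simp [mul_assoc]

/-- The class in `St(W)` of the apartment of a basis `v` of `W`: the alternating sum, over all
permutations `σ`, of the flags `⟨v_{σ 0}⟩ < ⟨v_{σ 0}, v_{σ 1}⟩ < ⋯ < W`. -/
noncomputable def apartmentClass [FiniteDimensional ℝ W] (v : Fin (Module.finrank ℝ W) → W)
    (hv : LinearIndependent ℝ v) : SteinbergGroup W :=
  QuotientAddGroup.mk ⟨apartmentChain v hv (hv.span_eq_top_of_card_eq_finrank' (by simp)),
    apartmentChain_mem_cycles v hv _⟩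

/-- `π` is the canonical map `Pt(W) → St(W)`, with respect to the orientation of `W` given by the
basis `e`: it sends the simplex with vertices `v` to the apartment of `v`, with the sign `+1` or
`-1` according to whether `v` is positively oriented or not. -/
def IsCanonicalMap [FiniteDimensional ℝ W]
    (e : Module.Basis (Fin (Module.finrank ℝ W)) ℝ W)
    (π : PolytopeGroup W →+ SteinbergGroup W) : Prop :=
  ∀ (v : Fin (Module.finrank ℝ W) → Metric.sphere (0 : W) 1)
    (hv : LinearIndependent ℝ fun i => (v i : W)),
    π (polytopeClass (simplexPolytope v hv)) =
      (SignType.sign (e.det fun i => (v i : W)) : ℤ) • apartmentClass (fun i => (v i : W)) hv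

end Steinberg

/-! The proof replaces polytopes by functions on germs of curves `x₀ + ε x₁ + ε² x₂ + ⋯`. If the
vectors of the list span `W`, every nonzero functional has a strict sign along the curve for small
`ε > 0`, so the curve eventually stays in a given polytope or eventually stays outside it, and
boundaries play no role. Counting membership therefore respects subdivisions and defines `germFun`.
It sends a simplex to the product of the indicators of its facet half spaces, and it is injective
because elements of the polytope group can be written on a triangulation whose simplices are told
apart by germs. The image of the suspensions from `V` is exactly the ring `halfRing b V` generated
by the half spaces with normal vector in `V`.

The coefficient of the canonical map on the flag of a basis `e` is, up to the orientation sign of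
`e`, the alternating sum of the function over the germs `(± e₁, ± e₂, …)`; this is
`sign_det_mul_altSum`, an identity about triangular matrices, and it gives the existence of the map.
For a function coming from a proper subspace some sign change is invisible, so the sum vanishes
(`le_of_altSum_ne_zero`). The converse, which is exactness in the middle, is
`mem_iSup_of_altSum_eq_zero`: relative to a vector `l` a function can be written with at most one
half space transverse to `l` in each term, alternating sums ending in `± l` isolate the coefficient
of each such half space, and induction on the dimension applies to that coefficient.

There are no chains longer than the dimension, so the Steinberg group is a group of cycles. As in
the Solomon–Tits theorem, a cycle is determined by its values on the flags opposite to a fixed flag,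
and suitable apartments form the dual basis. Hence the Steinberg group is free and generated by
apartments, and the canonical map is onto and splits.

Sections of the canonical maps of the proper subspaces identify the colimit with the direct sum of
their Steinberg groups. It is generated by them by induction on the dimension; independence already
holds in `Pt(W)`, since alternating sums over germs that start with vectors spanning `Vᗮ` detect a
component of maximal dimension. So the colimit is free and embeds. The last assertion is separate:
the cone over `Q` is invariant under `Uᗮ + Vᗮ = (U ⊓ V)ᗮ`. -/

set_option linter.unusedSectionVars false

/-! ### Lexicographic signs, half space rings and alternating sums. -/

section Germs

variable {W : Type*} [NormedAddCommGroup W] [InnerProductSpace ℝ W]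

/-- The linear functional `⟪u, ·⟫` is lexicographically positive on a list of vectors: the first
nonzero value is positive. -/
def LexPos (u : W) : List W → Prop
  | [] => False
  | a :: t => 0 < inner ℝ u a ∨ (inner ℝ u a = 0 ∧ LexPos u t)

theorem lexPos_append_of_orthogonal {u : W} {c : List W} (h : ∀ a ∈ c, inner ℝ u a = 0)
    (x : List W) : LexPos u (c ++ x) ↔ LexPos u x := by
  induction c with
  | nil => rfl
  | cons a c ih =>
    have h0 := h a (by simp)
    simp only [List.cons_append, LexPos, h0, lt_irrefl, false_or, true_and]
    exact ih fun a ha => h a (by simp [ha])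

theorem lexPos_append_of_exists {u : W} {c : List W} (h : ∃ a ∈ c, inner ℝ u a ≠ 0)
    (x : List W) : LexPos u (c ++ x) ↔ LexPos u c := by
  induction c with
  | nil => simp at h
  | cons a c ih =>
    simp only [List.cons_append, LexPos]
    by_cases h0 : inner ℝ u a = 0
    · obtain ⟨a', ha', h'⟩ := h
      rcases List.mem_cons.1 ha' with rfl | ha'
      · exact absurd h0 h'
      · rw [ih ⟨a', ha', h'⟩]
    · simp [h0]

theorem not_lexPos_of_orthogonal {u : W} {c : List W} (h : ∀ a ∈ c, inner ℝ u a = 0) :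
    ¬ LexPos u c := by
  induction c with
  | nil => exact id
  | cons a c ih =>
    have h0 := h a (by simp)
    simp only [LexPos, h0, lt_irrefl, false_or, true_and]
    exact ih fun a ha => h a (by simp [ha])

theorem lexPos_add {u v : W} {x : List W} (hu : LexPos u x) (hv : LexPos v x) :
    LexPos (u + v) x := by
  induction x with
  | nil => exact hu
  | cons a x ih =>
    simp only [LexPos, inner_add_left] at *
    rcases hu with hu | ⟨hu, hu'⟩ <;> rcases hv with hv | ⟨hv, hv'⟩
    · left; linarith
    · left; linarith
    · left; linarith
    · right; exact ⟨by linarith, ih hu' hv'⟩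

theorem lexPos_smul {u : W} {r : ℝ} (hr : 0 < r) {x : List W} :
    LexPos (r • u) x ↔ LexPos u x := by
  induction x with
  | nil => rfl
  | cons a x ih =>
    simp only [LexPos, inner_smul_left, ih]
    simp [hr, hr.ne', mul_pos_iff_of_pos_left]

theorem not_lexPos_zero (x : List W) : ¬ LexPos (0 : W) x :=
  not_lexPos_of_orthogonal (by simp)

theorem not_lexPos_neg {u : W} {x : List W} (h : LexPos u x) : ¬ LexPos (-u) x := fun h' =>
  not_lexPos_zero x (by simpa using lexPos_add h h')

theorem lexPos_neg_of_not {u : W} {x : List W} (h : ∃ a ∈ x, inner ℝ u a ≠ 0)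
    (hn : ¬ LexPos u x) : LexPos (-u) x := by
  induction x with
  | nil => simp at h
  | cons a x ih =>
    simp only [LexPos, inner_neg_left, neg_eq_zero, Left.neg_pos_iff, not_or, not_and] at *
    rcases lt_trichotomy (inner ℝ u a) 0 with h0 | h0 | h0
    · exact Or.inl h0
    · refine Or.inr ⟨h0, ih ?_ (hn.2 h0)⟩
      obtain ⟨a', ha', h'⟩ := h
      rcases List.mem_cons.1 ha' with rfl | ha'
      · exact absurd h0 h'
      · exact ⟨a', ha', h'⟩
    · exact absurd h0 hn.1

theorem exists_inner_ne_zero {u : W} (hu : u ≠ 0) {x : List W} {V : Submodule ℝ W}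
    (hx : Submodule.span ℝ {a | a ∈ x} = V) (hV : u ∈ V) : ∃ a ∈ x, inner ℝ u a ≠ 0 := by
  by_contra! h
  apply hu
  rw [← inner_self_eq_zero (𝕜 := ℝ)]
  have : V ≤ (ℝ ∙ u)ᗮ := by
    rw [← hx, Submodule.span_le]
    intro a ha
    exact Submodule.mem_orthogonal_singleton_iff_inner_right.2 (h a ha)
  exact Submodule.mem_orthogonal_singleton_iff_inner_right.1 (this hV)

open Classical in
/-- The indicator function, on germs, of an open half space. The germs are completed by a fixed
list `b`, so that they are generic if `b` spans `W`. -/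
noncomputable def halfInd (b : List W) (u : W) (x : List W) : ℤ :=
  if LexPos u (x ++ b) then 1 else 0

theorem halfInd_congr {b : List W} {u v : W} {x y : List W}
    (h : LexPos u (x ++ b) ↔ LexPos v (y ++ b)) : halfInd b u x = halfInd b v y := by
  unfold halfInd
  split_ifs <;> tauto

/-- The ring of functions on germs generated by the indicator functions of the half spaces whose
boundary contains the orthogonal complement of `U`. -/
noncomputable def halfRing (b : List W) (U : Submodule ℝ W) : Subring (List W → ℤ) :=
  Subring.closure (halfInd b '' U)

/-- The alternating sum of the values of a function at all lists `(± e₁, ± e₂, …)`. -/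
def altSum : (List W → ℤ) → List W → ℤ
  | f, [] => f []
  | f, a :: e => altSum (fun x => f (a :: x)) e - altSum (fun x => f (-a :: x)) e

/-- The lists obtained by changing the signs of some entries. -/
def IsSigning (x e : List W) : Prop := List.Forall₂ (fun y a => y = a ∨ y = -a) x e

theorem altSum_congr {f g : List W → ℤ} {e : List W} (h : ∀ x, IsSigning x e → f x = g x) :
    altSum f e = altSum g e := by
  induction e generalizing f g with
  | nil => exact h [] List.Forall₂.nil
  | cons a e ih =>
    simp only [altSum]
    rw [ih fun x hx => h (a :: x) (.cons (Or.inl rfl) hx),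
      ih fun x hx => h (-a :: x) (.cons (Or.inr rfl) hx)]

theorem altSum_zero (e : List W) : altSum (fun _ => 0) e = 0 := by
  induction e with
  | nil => rfl
  | cons a e ih => simp only [altSum, ih, sub_self]

theorem altSum_add (f g : List W → ℤ) (e : List W) :
    altSum (fun x => f x + g x) e = altSum f e + altSum g e := by
  induction e generalizing f g with
  | nil => rfl
  | cons a e ih => simp only [altSum, ih]; ring

theorem altSum_mul_left (n : ℤ) (f : List W → ℤ) (e : List W) :
    altSum (fun x => n * f x) e = n * altSum f e := by
  induction e generalizing f with
  | nil => rfl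
  | cons a e ih => simp only [altSum, ih]; ring

theorem altSum_append_singleton (f : List W → ℤ) (e : List W) (a : W) :
    altSum f (e ++ [a]) = altSum (fun x => f (x ++ [a]) - f (x ++ [-a])) e := by
  induction e generalizing f with
  | nil => rfl
  | cons a' e ih => simp only [List.cons_append, altSum, ih]

theorem altSum_map {W' : Type*} [NormedAddCommGroup W'] [InnerProductSpace ℝ W']
    (φ : W' →ₗ[ℝ] W) (f : List W → ℤ) (e : List W') :
    altSum f (e.map φ) = altSum (fun x => f (x.map φ)) e := by
  induction e generalizing f with
  | nil => rfl
  | cons a e ih => simp only [List.map_cons, altSum, ih, map_neg]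

theorem IsSigning.inner_eq_zero {x e : List W} (h : IsSigning x e) {u : W} :
    (∀ a ∈ x, inner ℝ u a = 0) ↔ ∀ a ∈ e, inner ℝ u a = 0 := by
  induction h with
  | nil => rfl
  | cons h _ ih =>
    simp only [List.forall_mem_cons, ih]
    rcases h with rfl | rfl <;> simp

theorem IsSigning.span_eq {x e : List W} (h : IsSigning x e) :
    Submodule.span ℝ {a | a ∈ x} = Submodule.span ℝ {a | a ∈ e} := by
  induction h with
  | nil => rfl
  | @cons y a x e h _ ih =>
    have : ∀ (y : W) (x : List W), {a | a ∈ y :: x} = insert y {a | a ∈ x} := by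
      intro y x; ext; simp
    rw [this, this, Submodule.span_insert, Submodule.span_insert, ih]
    rcases h with rfl | rfl
    · rfl
    · rw [← Set.neg_singleton, Submodule.span_neg]

variable {b : List W} {U V : Submodule ℝ W}

theorem halfInd_mem_halfRing {u : W} (hu : u ∈ U) : halfInd b u ∈ halfRing b U :=
  Subring.subset_closure ⟨u, hu, rfl⟩

theorem halfRing_mono (h : U ≤ V) : halfRing b U ≤ halfRing b V :=
  Subring.closure_mono (image_mono h)

/-- A function of the ring only depends on the signs of the functionals in `U`. -/
theorem eq_of_mem_halfRing {f : List W → ℤ} (hf : f ∈ halfRing b U) {x y : List W}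
    (h : ∀ u ∈ U, LexPos u (x ++ b) ↔ LexPos u (y ++ b)) : f x = f y := by
  induction hf using Subring.closure_induction with
  | mem f hf =>
    obtain ⟨u, hu, rfl⟩ := hf
    exact halfInd_congr (h u hu)
  | zero => rfl
  | one => rfl
  | add f g _ _ hf hg => simp [hf, hg]
  | neg f _ hf => simp [hf]
  | mul f g _ _ hf hg => simp [hf, hg]

/-- Each functional in `U` is either decided by `c` already, or vanishes on `c` and hence on `a`; in
both cases the sign of `a` does not matter. -/
theorem halfRing_flip {f : List W → ℤ} (hf : f ∈ halfRing b U) {c : List W} {a : W}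
    (h : ∀ u ∈ U, (∀ p ∈ c, inner ℝ u p = 0) → inner ℝ u a = 0) (x : List W) :
    f (c ++ a :: x) = f (c ++ -a :: x) := by
  refine eq_of_mem_halfRing hf fun u hu => ?_
  simp only [List.append_assoc]
  by_cases hc : ∀ p ∈ c, inner ℝ u p = 0
  · rw [lexPos_append_of_orthogonal hc, lexPos_append_of_orthogonal hc]
    simp [LexPos, h u hu hc]
  · push Not at hc
    rw [lexPos_append_of_exists hc, lexPos_append_of_exists hc]

theorem altSum_eq_zero_of_flip {f : List W → ℤ} {a : W} {e : List W}
    (h : ∀ x, f (a :: x) = f (-a :: x)) : altSum f (a :: e) = 0 := by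
  simp only [altSum, funext h, sub_self]

/-- The subspace of vectors orthogonal to all vectors in a list. -/
noncomputable def listOrthogonal (c : List W) : Submodule ℝ W := (Submodule.span ℝ {a | a ∈ c})ᗮ

theorem mem_listOrthogonal {c : List W} {u : W} :
    u ∈ listOrthogonal c ↔ ∀ a ∈ c, inner ℝ u a = 0 := by
  rw [listOrthogonal, Submodule.mem_orthogonal']
  constructor
  · exact fun h a ha => h a (Submodule.subset_span ha)
  · intro h a ha
    induction ha using Submodule.span_induction with
    | mem a ha => exact h a ha
    | zero => simp
    | add a b _ _ ha hb => simp [inner_add_right, ha, hb]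
    | smul r a _ ha => simp [inner_smul_right, ha]

/-- If no functional in `U` orthogonal to the earlier entries detects the next entry,
`halfRing_flip` cancels the two halves of the sum. So in a nonzero sum every entry lowers the
dimension of the space of functionals that are still undecided. -/
theorem length_le_of_altSum_ne_zero [FiniteDimensional ℝ W] {f : List W → ℤ}
    (hf : f ∈ halfRing b U) (c e : List W) (h : altSum (fun x => f (c ++ x)) e ≠ 0) :
    e.length ≤ Module.finrank ℝ (U ⊓ listOrthogonal c : Submodule ℝ W) := by
  induction e generalizing c with
  | nil => simp
  | cons a e ih =>
    have hex : ∃ u ∈ U, (∀ p ∈ c, inner ℝ u p = 0) ∧ inner ℝ u a ≠ 0 := by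
      by_contra! h'
      exact h (altSum_eq_zero_of_flip fun x => halfRing_flip hf h' x)
    have hlt : ∀ a', (a' = a ∨ a' = -a) → U ⊓ listOrthogonal (c ++ [a']) < U ⊓ listOrthogonal c := by
      intro a' ha'
      refine lt_of_le_of_ne (fun u hu => ?_) fun heq => ?_
      · rw [Submodule.mem_inf, mem_listOrthogonal] at *
        exact ⟨hu.1, fun p hp => hu.2 p (by simp [hp])⟩
      · obtain ⟨u, hu, hc, ha⟩ := hex
        have : u ∈ U ⊓ listOrthogonal (c ++ [a']) := by
          rw [heq]; exact ⟨hu, mem_listOrthogonal.2 hc⟩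
        have := mem_listOrthogonal.1 this.2 a' (by simp)
        rcases ha' with rfl | rfl
        · exact ha this
        · exact ha (by simpa using this)
    have key : ∀ a', (a' = a ∨ a' = -a) → altSum (fun x => f (c ++ a' :: x)) e ≠ 0 →
        (a :: e).length ≤ Module.finrank ℝ (U ⊓ listOrthogonal c : Submodule ℝ W) := by
      intro a' ha' hne
      have h1 := ih (c ++ [a']) (by simpa using hne)
      exact Nat.succ_le_of_lt (lt_of_le_of_lt h1 (Submodule.finrank_lt_finrank_of_lt (hlt a' ha')))
    by_cases h1 : altSum (fun x => f (c ++ a :: x)) e = 0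
    · refine key (-a) (Or.inr rfl) fun h2 => h ?_
      simp only [altSum, h1, h2, sub_self]
    · exact key a (Or.inl rfl) h1

/-- The alternating sum over a basis of `V`, preceded by vectors spanning the complement of `V`,
vanishes on the functions that come from `U`, unless `V ≤ U`. -/
theorem le_of_altSum_ne_zero [FiniteDimensional ℝ W] {f : List W → ℤ}
    (hf : f ∈ halfRing b U) {c e : List W} (hc : Submodule.span ℝ {a | a ∈ c} = Vᗮ)
    (he : e.length = Module.finrank ℝ V) (h : altSum (fun x => f (c ++ x)) e ≠ 0) : V ≤ U := by
  have h1 := length_le_of_altSum_ne_zero hf c e h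
  -- The undecided functionals are those in `U ⊓ Vᗮᗮ = U ⊓ V`, so the bound reads `dim V ≤ dim (U ⊓
  -- V)`.
  rw [he, listOrthogonal, hc, Submodule.orthogonal_orthogonal] at h1
  exact inf_eq_right.1 (Submodule.eq_of_le_of_finrank_le inf_le_right h1)

theorem halfInd_smul {r : ℝ} (hr : 0 < r) (u : W) : halfInd b (r • u) = halfInd b u :=
  funext fun _ => halfInd_congr (lexPos_smul hr)

theorem halfInd_neg (hb : Submodule.span ℝ {a | a ∈ b} = ⊤) {u : W} (hu : u ≠ 0) :
    halfInd b (-u) = 1 - halfInd b u := by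
  funext x
  have hex : ∃ a ∈ x ++ b, inner ℝ u a ≠ 0 := by
    obtain ⟨a, ha, h⟩ := exists_inner_ne_zero hu hb trivial
    exact ⟨a, by simp [ha], h⟩
  by_cases h : LexPos u (x ++ b)
  · simp [halfInd, h, not_lexPos_neg h]
  · simp [halfInd, h, lexPos_neg_of_not hex h]

/-- Where `q` is positive, `r > 0` implies `q + r > 0`; where `q` is negative, `q + r > 0` implies
`r > 0`. The relation serves to lower degree: if `q + r` and `r` have the same value on `l`, the
right side has at most one factor in each term that is not orthogonal to `l`. -/
theorem halfInd_mul_add (hb : Submodule.span ℝ {a | a ∈ b} = ⊤) (q r : W) :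
    halfInd b (q + r) * halfInd b r =
      halfInd b q * halfInd b r + halfInd b (q + r) - halfInd b q * halfInd b (q + r) := by
  by_cases hq : q = 0
  · subst hq
    have : halfInd b (0 : W) = 0 := funext fun x => by simp [halfInd, not_lexPos_zero]
    rw [this, zero_add]
    simp only [zero_mul, zero_add, sub_zero]
    funext x
    by_cases h : LexPos r (x ++ b) <;> simp [halfInd, h]
  funext x
  have hex : ∃ a ∈ x ++ b, inner ℝ q a ≠ 0 := by
    obtain ⟨a, ha, h⟩ := exists_inner_ne_zero hq hb trivial
    exact ⟨a, by simp [ha], h⟩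
  by_cases h1 : LexPos q (x ++ b)
  · by_cases h2 : LexPos r (x ++ b)
    · simp [halfInd, h1, h2, lexPos_add h1 h2]
    · simp [halfInd, h1, h2]
  · by_cases h3 : LexPos (q + r) (x ++ b)
    · have h2 : LexPos r (x ++ b) := by
        have := lexPos_add (lexPos_neg_of_not hex h1) h3
        simpa using this
      simp [halfInd, h1, h2, h3]
    · simp [halfInd, h1, h3]

/-- The normal form of the elements of `halfRing b U`, with respect to a vector `l`. -/
theorem exists_normalForm (hb : Submodule.span ℝ {a | a ∈ b} = ⊤) (l : W)
    {f : List W → ℤ} (hf : f ∈ halfRing b U) :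
    ∃ g₀ ∈ halfRing b (U ⊓ (ℝ ∙ l)ᗮ), ∃ G : W →₀ (List W → ℤ),
      (∀ μ ∈ G.support, μ ∈ U ∧ inner ℝ μ l = 1) ∧
      (∀ μ, G μ ∈ halfRing b (U ⊓ (ℝ ∙ l)ᗮ)) ∧
      f = g₀ + G.sum fun μ g => halfInd b μ * g := by
  classical
  set U' := U ⊓ (ℝ ∙ l)ᗮ with hU'
  have memU' : ∀ u, u ∈ U' ↔ u ∈ U ∧ inner ℝ u l = 0 := fun u => by
    rw [hU', Submodule.mem_inf, Submodule.mem_orthogonal_singleton_iff_inner_left]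
  -- `K` is generated by the terms allowed in a normal form. It contains `1` and will be shown to be
  -- stable under multiplication by `halfRing b U`, so it contains that ring.
  set K : AddSubgroup (List W → ℤ) := AddSubgroup.closure
    ((halfRing b U' : Set (List W → ℤ)) ∪
      {k | ∃ μ g, μ ∈ U ∧ inner ℝ μ l = 1 ∧ g ∈ halfRing b U' ∧ k = halfInd b μ * g}) with hK
  have hK0 : ∀ g ∈ halfRing b U', g ∈ K := fun g hg => AddSubgroup.subset_closure (Or.inl hg)
  have hK1 : ∀ μ ∈ U, inner ℝ μ l = 1 → ∀ g ∈ halfRing b U', halfInd b μ * g ∈ K :=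
    fun μ h1 h2 g hg => AddSubgroup.subset_closure (Or.inr ⟨μ, g, h1, h2, hg, rfl⟩)
  have mul0 : ∀ u ∈ U', ∀ k ∈ K, halfInd b u * k ∈ K := by
    intro u hu k hk
    induction hk using AddSubgroup.closure_induction with
    | mem k hk =>
      rcases hk with hk | ⟨μ, g, h1, h2, hg, rfl⟩
      · exact hK0 _ (mul_mem (halfInd_mem_halfRing hu) hk)
      · rw [mul_left_comm]
        exact hK1 μ h1 h2 _ (mul_mem (halfInd_mem_halfRing hu) hg)
    | zero => simp [K.zero_mem]
    | add k k' _ _ h h' => rw [mul_add]; exact K.add_mem h h'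
    | neg k _ h => rw [mul_neg]; exact K.neg_mem h
  have mul1 : ∀ ν ∈ U, inner ℝ ν l = 1 → ∀ k ∈ K, halfInd b ν * k ∈ K := by
    intro ν hν hν1 k hk
    induction hk using AddSubgroup.closure_induction with
    | mem k hk =>
      rcases hk with hk | ⟨μ, g, h1, h2, hg, rfl⟩
      · exact hK1 ν hν hν1 k hk
      · have hq : ν - μ ∈ U' := (memU' _).2 ⟨U.sub_mem hν h1, by rw [inner_sub_left, hν1, h2, sub_self]⟩
        -- Both `ν` and `μ` take the value `1` on `l`, so `ν - μ` lies in `U'` and the product of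
        -- two transverse half spaces becomes linear in them.
        have h := halfInd_mul_add hb (ν - μ) μ
        rw [sub_add_cancel] at h
        rw [← mul_assoc, h, sub_mul, add_mul, mul_assoc, mul_assoc]
        exact K.sub_mem (K.add_mem (mul0 _ hq _ (hK1 μ h1 h2 g hg)) (hK1 ν hν hν1 g hg))
          (mul0 _ hq _ (hK1 ν hν hν1 g hg))
    | zero => simp [K.zero_mem]
    | add k k' _ _ h h' => rw [mul_add]; exact K.add_mem h h'
    | neg k _ h => rw [mul_neg]; exact K.neg_mem h
  have mulU : ∀ u ∈ U, ∀ k ∈ K, halfInd b u * k ∈ K := by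
    intro u hu k hk
    rcases lt_trichotomy (inner ℝ u l) 0 with h | h | h
    · have h1 : halfInd b u = 1 - halfInd b ((inner ℝ u l)⁻¹ • u) := by
        rw [← halfInd_smul (b := b) (neg_pos.2 (inv_lt_zero.2 h)) u, neg_smul,
          halfInd_neg hb]
        intro h0
        rw [smul_eq_zero, inv_eq_zero] at h0
        rcases h0 with h0 | h0
        · exact h.ne h0
        · rw [h0, inner_zero_left] at h; exact lt_irrefl _ h
      rw [h1, sub_mul, one_mul]
      refine K.sub_mem hk (mul1 _ (U.smul_mem _ hu) ?_ k hk)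
      rw [inner_smul_left]
      simp [h.ne]
    · exact mul0 u ((memU' u).2 ⟨hu, h⟩) k hk
    · rw [← halfInd_smul (b := b) (inv_pos.2 h) u]
      refine mul1 _ (U.smul_mem _ hu) ?_ k hk
      rw [inner_smul_left]
      simp [h.ne']
  have mulR : ∀ f ∈ halfRing b U, ∀ k ∈ K, f * k ∈ K := by
    intro f hf
    induction hf using Subring.closure_induction with
    | mem f hf => obtain ⟨u, hu, rfl⟩ := hf; exact mulU u hu
    | zero => intro k _; rw [zero_mul]; exact K.zero_mem
    | one => intro k hk; rwa [one_mul]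
    | add f g _ _ hf hg => intro k hk; rw [add_mul]; exact K.add_mem (hf k hk) (hg k hk)
    | neg f _ hf => intro k hk; rw [neg_mul]; exact K.neg_mem (hf k hk)
    | mul f g _ _ hf hg => intro k hk; rw [mul_assoc]; exact hf _ (hg k hk)
  have hfK : f ∈ K := by simpa using mulR f hf 1 (hK0 1 (one_mem _))
  clear hf
  induction hfK using AddSubgroup.closure_induction with
  | mem k hk =>
    rcases hk with hk | ⟨μ, g, h1, h2, hg, rfl⟩
    · exact ⟨k, hk, 0, by simp, fun μ => zero_mem _, by simp⟩
    · refine ⟨0, zero_mem _, Finsupp.single μ g, fun ν hν => ?_, fun ν => ?_, by simp⟩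
      · rw [Finset.mem_singleton.1 (Finsupp.support_single_subset hν)]
        exact ⟨h1, h2⟩
      · rw [Finsupp.single_apply]
        split_ifs
        exacts [hg, zero_mem _]
  | zero => exact ⟨0, zero_mem _, 0, by simp, fun μ => zero_mem _, by simp⟩
  | add k k' _ _ h h' =>
    obtain ⟨g, hg, G, h1, h2, rfl⟩ := h
    obtain ⟨g', hg', G', h1', h2', rfl⟩ := h'
    refine ⟨g + g', add_mem hg hg', G + G', fun μ hμ => ?_, fun μ => add_mem (h2 μ) (h2' μ), ?_⟩
    · rcases Finset.mem_union.1 (Finsupp.support_add hμ) with hμ | hμ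
      exacts [h1 μ hμ, h1' μ hμ]
    · rw [Finsupp.sum_add_index' (fun _ => mul_zero _) (fun _ _ _ => mul_add _ _ _)]
      abel
  | neg k _ h =>
    obtain ⟨g, hg, G, h1, h2, rfl⟩ := h
    refine ⟨-g, neg_mem hg, -G, fun μ hμ => h1 μ (by simpa using hμ), fun μ => neg_mem (h2 μ), ?_⟩
    rw [Finsupp.sum_neg_index (fun _ => mul_zero _)]
    simp only [Finsupp.sum, mul_neg, Finset.sum_neg_distrib]
    abel

end Germs

/-! ### Functions whose alternating sums vanish come from proper subspaces. -/

section Germs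

variable {W : Type*} [NormedAddCommGroup W] [InnerProductSpace ℝ W]
variable {b : List W} {U V : Submodule ℝ W}

/-- The sum of the half space rings of the proper subspaces of `U`. -/
noncomputable def properHalfSum (b : List W) (U : Submodule ℝ W) : AddSubgroup (List W → ℤ) :=
  ⨆ V : {V : Submodule ℝ W // V < U}, (halfRing b V.1).toAddSubgroup

theorem mem_properHalfSum_of_lt (h : V < U) {f : List W → ℤ} (hf : f ∈ halfRing b V) :
    f ∈ properHalfSum b U :=
  (le_iSup (fun V : {V : Submodule ℝ W // V < U} => (halfRing b V.1).toAddSubgroup) ⟨V, h⟩)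
    (show f ∈ (halfRing b V).toAddSubgroup from hf)

theorem properHalfSum_induction {C : (List W → ℤ) → Prop}
    (mem : ∀ V < U, ∀ f ∈ halfRing b V, C f) (zero : C 0) (add : ∀ f g, C f → C g → C (f + g))
    {f : List W → ℤ} (hf : f ∈ properHalfSum b U) : C f :=
  AddSubgroup.iSup_induction _ (C := C) hf (fun V f hf => mem V.1 V.2 f hf) zero add

/-- A function of the half space ring of `U` whose alternating sums over all bases of `U` vanish
comes from proper subspaces of `U`. -/
theorem mem_iSup_of_altSum_eq_zero [FiniteDimensional ℝ W]
    (hb : Submodule.span ℝ {a | a ∈ b} = ⊤) (U : Submodule ℝ W) {f : List W → ℤ}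
    (hf : f ∈ halfRing b U)
    (h : ∀ e : List W, e.length = Module.finrank ℝ U → Submodule.span ℝ {a | a ∈ e} = U →
      altSum f e = 0) :
    f ∈ properHalfSum b U := by
  classical
  induction hn : Module.finrank ℝ U generalizing U f with
  | zero =>
    have hU : U = ⊥ := Submodule.finrank_eq_zero.1 hn
    subst hU
    have h0 : altSum f [] = 0 := h [] (by simp) (by simp)
    have : f = 0 := by
      funext x
      -- For `U = ⊥` the function is constant, and the empty alternating sum is its value at the
      -- empty list.
      rw [eq_of_mem_halfRing hf (y := []) fun u hu => ?_]
      · exact h0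
      · rw [(Submodule.mem_bot ℝ).1 hu]
        simp [not_lexPos_zero]
    rw [this]
    exact AddSubgroup.zero_mem _
  | succ n ih =>
    obtain ⟨l, hl, hl0⟩ : ∃ l ∈ U, l ≠ 0 := by
      refine (Submodule.ne_bot_iff U).1 fun h0 => ?_
      rw [h0, finrank_bot] at hn
      omega
    obtain ⟨g₀, hg₀, G, hG, hGm, rfl⟩ := exists_normalForm hb l hf
    set U' := U ⊓ (ℝ ∙ l)ᗮ with hU'
    have memU' : ∀ u, u ∈ U' ↔ u ∈ U ∧ inner ℝ u l = 0 := fun u => by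
      rw [hU', Submodule.mem_inf, Submodule.mem_orthogonal_singleton_iff_inner_left]
    have hll : inner ℝ l l ≠ 0 := fun h => hl0 (inner_self_eq_zero.1 h)
    have hlt : U' < U := by
      refine lt_of_le_of_ne inf_le_left fun heq => hll ?_
      exact ((memU' l).1 (heq ▸ hl)).2
    have hsup : U ≤ U' ⊔ ℝ ∙ l := by
      intro u hu
      rw [Submodule.mem_sup]
      refine ⟨u - (inner ℝ u l / inner ℝ l l) • l, (memU' _).2 ⟨U.sub_mem hu (U.smul_mem _ hl), ?_⟩,
        (inner ℝ u l / inner ℝ l l) • l, Submodule.mem_span_singleton.2 ⟨_, rfl⟩, by simp⟩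
      rw [inner_sub_left, inner_smul_left]
      simp only [conj_trivial]
      field_simp
      simp
    have hU'n : Module.finrank ℝ U' = n := by
      have h1 := Submodule.finrank_lt_finrank_of_lt hlt
      have h2 := (Submodule.finrank_mono hsup).trans (Submodule.finrank_add_le_finrank_add_finrank _ _)
      rw [finrank_span_singleton hl0] at h2
      omega
    -- The term `g₀` already comes from `U' < U`, so only the terms with a transverse half space
    -- remain, and they are treated one at a time.
    suffices key : ∀ μ₀ ∈ G.support, halfInd b μ₀ * G μ₀ ∈ properHalfSum b U from
      AddSubgroup.add_mem _ (mem_properHalfSum_of_lt hlt hg₀)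
        (AddSubgroup.sum_mem _ key)
    intro μ₀ hμ₀
    obtain ⟨hμU, hμl⟩ := hG μ₀ hμ₀
    have main : G μ₀ ∈ properHalfSum b U' := by
      refine ih U' (hGm μ₀) (fun e' he' hs' => ?_) hU'n
      -- Since `⟪μ₀, l⟫ = 1`, the map `φ` slides vectors along `l` into the hyperplane orthogonal to
      -- `μ₀`. On the list `e'.map φ ++ [l]` the functional `μ₀` is then decided only by the last
      -- entry.
      let φ : W →ₗ[ℝ] W := LinearMap.id - (LinearMap.toSpanSingleton ℝ W l).comp (innerₛₗ ℝ μ₀)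
      have hφ : ∀ a, φ a = a - (inner ℝ μ₀ a : ℝ) • l := fun a => rfl
      have heU' : ∀ a ∈ e', a ∈ U' := fun a ha => hs' ▸ Submodule.subset_span ha
      have hspan : Submodule.span ℝ {a | a ∈ e'.map φ ++ [l]} = U := by
        apply le_antisymm
        · rw [Submodule.span_le]
          intro a ha
          simp only [List.mem_append, List.mem_map, List.mem_singleton, mem_ofPred_eq] at ha
          rcases ha with ⟨a, ha, rfl⟩ | rfl
          · exact U.sub_mem (hlt.le (heU' a ha)) (U.smul_mem _ hl)
          · exact hl
        · have hl' : l ∈ Submodule.span ℝ {a | a ∈ e'.map φ ++ [l]} :=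
            Submodule.subset_span (by simp)
          refine hsup.trans (sup_le ?_ ((Submodule.span_singleton_le_iff_mem _ _).2 hl'))
          rw [← hs', Submodule.span_le]
          intro a ha
          have h1 : φ a ∈ Submodule.span ℝ {a | a ∈ e'.map φ ++ [l]} :=
            Submodule.subset_span (by
              simp only [List.mem_append, List.mem_map, mem_ofPred_eq]
              exact Or.inl ⟨a, ha, rfl⟩)
          have h2 := Submodule.add_mem _ h1 (Submodule.smul_mem _ (inner ℝ μ₀ a : ℝ) hl')
          rwa [hφ, sub_add_cancel] at h2
      have h0 := h (e'.map φ ++ [l]) (by simp [he', hU'n]; omega) hspan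
      rw [altSum_append_singleton] at h0
      have hD : altSum (fun x => G μ₀ (x ++ [l])) (e'.map φ) = 0 := by
        rw [← h0]
        refine altSum_congr fun x hx => ?_
        have hflip : ∀ g ∈ halfRing b U', g (x ++ [l]) = g (x ++ [-l]) := fun g hg =>
          halfRing_flip hg (fun u hu _ => ((memU' u).1 hu).2) []
        have horth : ∀ μ, (∀ a ∈ x, inner ℝ μ a = 0) ↔ ∀ a ∈ e', inner ℝ μ (φ a) = 0 := by
          intro μ
          rw [hx.inner_eq_zero]
          simp
        have hx0 : ∀ a ∈ x, inner ℝ μ₀ a = 0 := by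
          rw [horth]
          intro a _
          rw [hφ, inner_sub_right, inner_smul_right, hμl, mul_one, sub_self]
        -- The difference `μ - μ₀` vanishes on `l` but is a nonzero element of `U`, so it is nonzero
        -- on some `φ a`, where `μ₀` vanishes. Thus `μ` is decided before the last entry is reached,
        -- and only the term of `μ₀` survives in the difference.
        have hne : ∀ μ ∈ G.support, μ ≠ μ₀ →
            halfInd b μ (x ++ [l]) = halfInd b μ (x ++ [-l]) := by
          intro μ hμ hμne
          have hex : ∃ a ∈ x, inner ℝ μ a ≠ 0 := by
            by_contra! hcon
            rw [horth] at hcon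
            apply hμne
            rw [← sub_eq_zero]
            by_contra hd
            obtain ⟨a, ha, hda⟩ := exists_inner_ne_zero hd hspan (U.sub_mem (hG μ hμ).1 hμU)
            simp only [List.mem_append, List.mem_map, List.mem_singleton] at ha
            rcases ha with ⟨a, ha, rfl⟩ | rfl
            · apply hda
              rw [inner_sub_left, hcon a ha, hφ, inner_sub_right, inner_smul_right, hμl,
                mul_one, sub_self, sub_self]
            · apply hda
              rw [inner_sub_left, (hG μ hμ).2, hμl, sub_self]
          refine halfInd_congr ?_
          rw [List.append_assoc, List.append_assoc, lexPos_append_of_exists hex,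
            lexPos_append_of_exists hex]
        have hp : halfInd b μ₀ (x ++ [l]) = 1 := by
          unfold halfInd
          rw [if_pos]
          rw [List.append_assoc, lexPos_append_of_orthogonal hx0]
          simp [LexPos, hμl]
        have hm : halfInd b μ₀ (x ++ [-l]) = 0 := by
          unfold halfInd
          rw [if_neg]
          rw [List.append_assoc, lexPos_append_of_orthogonal hx0]
          simp [LexPos, hμl]
        simp only [Finsupp.sum, Pi.add_apply, Finset.sum_apply, Pi.mul_apply]
        rw [← hflip g₀ hg₀, ← Finset.add_sum_erase _ _ hμ₀, ← Finset.add_sum_erase _ _ hμ₀,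
          hp, hm, Finset.sum_congr rfl fun μ hμ => by
            rw [hne μ (Finset.mem_of_mem_erase hμ) (Finset.ne_of_mem_erase hμ), hflip _ (hGm μ)]]
        ring
      rw [altSum_map] at hD
      rw [← hD]
      -- Functionals in `U'` are orthogonal to `l`, so they do not see the slide `φ`; a nonzero one
      -- is decided within `x`, so the trailing `l` is harmless.
      refine altSum_congr fun x hx => eq_of_mem_halfRing (hGm μ₀) fun u hu => ?_
      have hul := ((memU' u).1 hu).2
      by_cases hu0 : u = 0
      · simp [hu0, not_lexPos_zero]
      obtain ⟨a, ha, hua⟩ := exists_inner_ne_zero hu0 (hx.span_eq.trans hs') hu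
      have hin : ∀ a, inner ℝ u (φ a) = inner ℝ u a := fun a => by
        rw [hφ, inner_sub_right, inner_smul_right, hul, mul_zero, sub_zero]
      rw [List.append_assoc, lexPos_append_of_exists ⟨a, ha, hua⟩,
        lexPos_append_of_exists ⟨φ a, List.mem_map_of_mem ha, by rwa [hin]⟩]
      clear hx hua ha
      induction x with
      | nil => rfl
      | cons a x ih => simp only [List.map_cons, LexPos, hin, ih]
    -- Multiplication by the half space of `μ₀` enlarges `V < U'` to `V ⊔ ℝ ∙ μ₀`, whose dimension
    -- is at most `dim U' < dim U`.
    refine properHalfSum_induction (C := fun g => halfInd b μ₀ * g ∈ properHalfSum b U)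
      (fun V hV g hg => ?_) ?_ (fun g g' h h' => ?_) main
    · refine mem_properHalfSum_of_lt (V := V ⊔ ℝ ∙ μ₀) (lt_of_le_of_ne ?_ fun heq => ?_) ?_
      · exact sup_le (hV.le.trans hlt.le) ((Submodule.span_singleton_le_iff_mem _ _).2 hμU)
      · have h1 := Submodule.finrank_add_le_finrank_add_finrank V (ℝ ∙ μ₀)
        have h2 := Submodule.finrank_lt_finrank_of_lt hV
        have h3 := finrank_span_le_card (R := ℝ) ({μ₀} : Set W)
        simp only [Set.toFinset_singleton, Finset.card_singleton] at h3
        rw [heq] at h1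
        omega
      · exact mul_mem (halfInd_mem_halfRing (Submodule.mem_sup_right
          (Submodule.mem_span_singleton_self μ₀))) (halfRing_mono le_sup_left hg)
    · rw [mul_zero]; exact AddSubgroup.zero_mem _
    · rw [mul_add]; exact AddSubgroup.add_mem _ h h'

end Germs

/-! ### Cones over subsets of the sphere, and simplices as intersections of half spaces. -/

section SimplicialCones

open Filter Topology

variable {W : Type*} [NormedAddCommGroup W] [InnerProductSpace ℝ W]

/-- The cone over a subset of the unit sphere. It always contains the origin. -/
def coneOf (P : Set (Metric.sphere (0 : W) 1)) : Set W :=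
  {w | w = 0 ∨ ∃ p ∈ P, ∃ r : ℝ, 0 < r ∧ w = r • (p : W)}

theorem coneOf_mono {P Q : Set (Metric.sphere (0 : W) 1)} (h : P ⊆ Q) : coneOf P ⊆ coneOf Q := by
  rintro w (hw | ⟨p, hp, r, hr, hw⟩)
  exacts [Or.inl hw, Or.inr ⟨p, h hp, r, hr, hw⟩]

theorem coe_mem_coneOf {P : Set (Metric.sphere (0 : W) 1)} {p : Metric.sphere (0 : W) 1} :
    (p : W) ∈ coneOf P ↔ p ∈ P := by
  constructor
  · rintro (h | ⟨q, hq, r, hr, h⟩)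
    · have := norm_eq_of_mem_sphere p
      rw [h, norm_zero] at this
      norm_num at this
    · rwa [eq_of_smul_eq_smul_sphere one_pos hr ((one_smul ℝ (p : W)).trans h)]
  · exact fun h => Or.inr ⟨p, h, 1, one_pos, (one_smul _ _).symm⟩

theorem smul_mem_coneOf {P : Set (Metric.sphere (0 : W) 1)} {w : W} (hw : w ∈ coneOf P) {r : ℝ}
    (hr : 0 < r) : r • w ∈ coneOf P := by
  rcases hw with rfl | ⟨p, hp, s, hs, rfl⟩
  · left; rw [smul_zero]
  · exact Or.inr ⟨p, hp, r * s, mul_pos hr hs, by rw [smul_smul]⟩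

theorem coneOf_biUnion {ι : Type*} {F : Set ι} (hF : F.Nonempty)
    (P : ι → Set (Metric.sphere (0 : W) 1)) : coneOf (⋃ i ∈ F, P i) = ⋃ i ∈ F, coneOf (P i) := by
  ext w
  simp only [mem_iUnion, exists_prop, coneOf, mem_ofPred_eq]
  constructor
  · rintro (h | ⟨p, ⟨i, hi, hp⟩, r, hr, h⟩)
    · obtain ⟨i, hi⟩ := hF
      exact ⟨i, hi, Or.inl h⟩
    · exact ⟨i, hi, Or.inr ⟨p, hp, r, hr, h⟩⟩
  · rintro ⟨i, hi, h | ⟨p, hp, r, hr, h⟩⟩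
    · exact Or.inl h
    · exact Or.inr ⟨p, ⟨i, hi, hp⟩, r, hr, h⟩

/-- The normalization of a nonzero vector. -/
noncomputable def toSphere (w : W) (hw : w ≠ 0) : Metric.sphere (0 : W) 1 :=
  ⟨‖w‖⁻¹ • w, normalize_mem_sphere hw⟩

theorem norm_smul_toSphere (w : W) (hw : w ≠ 0) : ‖w‖ • (toSphere w hw : W) = w := by
  change ‖w‖ • ‖w‖⁻¹ • w = w
  rw [smul_smul, mul_inv_cancel₀ (norm_ne_zero_iff.2 hw), one_smul]

theorem toSphere_mem_iff {P : Set (Metric.sphere (0 : W) 1)} {w : W} (hw : w ≠ 0) :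
    toSphere w hw ∈ P ↔ w ∈ coneOf P := by
  rw [← coe_mem_coneOf]
  constructor
  · intro h
    rw [← norm_smul_toSphere w hw]
    exact smul_mem_coneOf h (norm_pos_iff.2 hw)
  · exact fun h => smul_mem_coneOf h (inv_pos.2 (norm_pos_iff.2 hw))

variable [FiniteDimensional ℝ W]

/-- The basis of `W` formed by `dim W` linearly independent vectors. -/
noncomputable def basisOf (v : Fin (Module.finrank ℝ W) → W) (hv : LinearIndependent ℝ v) :
    Module.Basis (Fin (Module.finrank ℝ W)) ℝ W :=
  Module.Basis.mk hv (hv.span_eq_top_of_card_eq_finrank' (by simp)).ge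

theorem basisOf_apply (v : Fin (Module.finrank ℝ W) → W) (hv : LinearIndependent ℝ v)
    (k : Fin (Module.finrank ℝ W)) : basisOf v hv k = v k := Module.Basis.mk_apply _ _ _

/-- The dual basis of a basis, with respect to the inner product. -/
noncomputable def dualVector (v : Fin (Module.finrank ℝ W) → W) (hv : LinearIndependent ℝ v)
    (k : Fin (Module.finrank ℝ W)) : W :=
  (InnerProductSpace.toDual ℝ W).symm (LinearMap.toContinuousLinearMap ((basisOf v hv).coord k))

variable {v : Fin (Module.finrank ℝ W) → W} {hv : LinearIndependent ℝ v}

theorem inner_dualVector (k : Fin (Module.finrank ℝ W)) (x : W) :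
    inner ℝ (dualVector v hv k) x = (basisOf v hv).repr x k := by
  rw [dualVector, InnerProductSpace.toDual_symm_apply]
  rfl

theorem inner_dualVector_apply (k j : Fin (Module.finrank ℝ W)) :
    inner ℝ (dualVector v hv k) (v j) = if j = k then (1 : ℝ) else 0 := by
  rw [inner_dualVector]
  conv_lhs => rw [← basisOf_apply v hv j]
  rw [Module.Basis.repr_self, Finsupp.single_apply]

theorem sum_inner_dualVector (x : W) : ∑ k, (inner ℝ (dualVector v hv k) x : ℝ) • v k = x := by
  conv_rhs => rw [← (basisOf v hv).sum_repr x]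
  simp only [inner_dualVector, basisOf_apply]

theorem dualVector_ne_zero (k : Fin (Module.finrank ℝ W)) : dualVector v hv k ≠ 0 := by
  intro h
  have := inner_dualVector_apply (hv := hv) k k
  rw [h, inner_zero_left, if_pos rfl] at this
  exact zero_ne_one this

theorem inner_dualVector_sum (c : Fin (Module.finrank ℝ W) → ℝ) (k : Fin (Module.finrank ℝ W)) :
    inner ℝ (dualVector v hv k) (∑ j, c j • v j) = c k := by
  simp [inner_sum, inner_smul_right, inner_dualVector_apply]

/-- The dual vectors read off the coordinates in the basis `v`; they are the inner normals of the
facets. -/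
theorem mem_sphericalHull_iff_dualVector {v : Fin (Module.finrank ℝ W) → Metric.sphere (0 : W) 1}
    {hv : LinearIndependent ℝ fun i => (v i : W)} {x : Metric.sphere (0 : W) 1} :
    x ∈ sphericalHull v ↔ ∀ k, 0 ≤ (inner ℝ (dualVector (fun i => (v i : W)) hv k) (x : W) : ℝ) := by
  rw [mem_sphericalHull_iff]
  constructor
  · rintro ⟨c, hc, hx⟩ k
    rw [hx, inner_dualVector_sum]
    exact hc k
  · exact fun h => ⟨_, h, (sum_inner_dualVector _).symm⟩

theorem mem_coneOf_sphericalHull_iff {v : Fin (Module.finrank ℝ W) → Metric.sphere (0 : W) 1}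
    {hv : LinearIndependent ℝ fun i => (v i : W)} {w : W} :
    w ∈ coneOf (sphericalHull v) ↔
      ∀ k, 0 ≤ (inner ℝ (dualVector (fun i => (v i : W)) hv k) w : ℝ) := by
  constructor
  · rintro (rfl | ⟨p, hp, r, hr, rfl⟩) k
    · simp
    · rw [inner_smul_right]
      exact mul_nonneg hr.le (mem_sphericalHull_iff_dualVector.1 hp k)
  · intro h
    by_cases hw : w = 0
    · exact Or.inl hw
    · rw [← toSphere_mem_iff hw, mem_sphericalHull_iff_dualVector (hv := hv)]
      intro k
      change 0 ≤ (inner ℝ _ (‖w‖⁻¹ • w) : ℝ)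
      rw [inner_smul_right]
      exact mul_nonneg (by positivity) (h k)

theorem mem_interior_sphericalHull {v : Fin (Module.finrank ℝ W) → Metric.sphere (0 : W) 1}
    {hv : LinearIndependent ℝ fun i => (v i : W)} {x : Metric.sphere (0 : W) 1}
    (h : ∀ k, 0 < (inner ℝ (dualVector (fun i => (v i : W)) hv k) (x : W) : ℝ)) :
    x ∈ interior (sphericalHull v) := by
  have ho : IsOpen {y : Metric.sphere (0 : W) 1 |
      ∀ k, 0 < (inner ℝ (dualVector (fun i => (v i : W)) hv k) (y : W) : ℝ)} := by
    have : {y : Metric.sphere (0 : W) 1 |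
      ∀ k, 0 < (inner ℝ (dualVector (fun i => (v i : W)) hv k) (y : W) : ℝ)} =
      ⋂ k, {y : Metric.sphere (0 : W) 1 |
        0 < (inner ℝ (dualVector (fun i => (v i : W)) hv k) (y : W) : ℝ)} := by ext; simp
    rw [this]
    exact isOpen_iInter_of_finite fun k => isOpen_lt continuous_const
      (continuous_const.inner continuous_subtype_val)
  exact interior_maximal (fun y hy => mem_sphericalHull_iff_dualVector.2 fun k => (hy k).le) ho h

end SimplicialCones

/-! ### Evaluation of polytopes at generic germs. -/

section GermEvaluation

open Filter Topology

variable {W : Type*} [NormedAddCommGroup W] [InnerProductSpace ℝ W]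

/-- The curve `x₀ + ε x₁ + ε² x₂ + ⋯`. -/
def germCurve : List W → ℝ → W
  | [], _ => 0
  | a :: t, ε => a + ε • germCurve t ε

theorem continuous_germCurve (x : List W) : Continuous (germCurve x) := by
  induction x with
  | nil => exact continuous_const
  | cons a t ih => exact continuous_const.add (continuous_id.smul ih)

theorem germCurve_map {V : Type*} [NormedAddCommGroup V] [InnerProductSpace ℝ V]
    (φ : W →ₗ[ℝ] V) (x : List W) (ε : ℝ) : germCurve (x.map φ) ε = φ (germCurve x ε) := by
  induction x with
  | nil => simp [germCurve]
  | cons a t ih => simp [germCurve, ih]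

theorem LexPos.eventually {u : W} {x : List W} (h : LexPos u x) :
    ∀ᶠ ε in 𝓝[>] (0 : ℝ), 0 < (inner ℝ u (germCurve x ε) : ℝ) := by
  induction x with
  | nil => exact h.elim
  | cons a t ih =>
    rcases h with h | ⟨h0, h⟩
    · have hc : Continuous fun ε => (inner ℝ u (germCurve (a :: t) ε) : ℝ) :=
        continuous_const.inner (continuous_germCurve _)
      have h0 : 0 < (inner ℝ u (germCurve (a :: t) 0) : ℝ) := by simpa [germCurve] using h
      exact nhdsWithin_le_nhds (hc.continuousAt.eventually (lt_mem_nhds h0))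
    · filter_upwards [ih h, self_mem_nhdsWithin] with ε h1 h2
      rw [germCurve, inner_add_right, h0, zero_add, inner_smul_right]
      exact mul_pos h2 h1

theorem eventually_neg_of_not_lexPos {u : W} {x : List W} (hu : u ≠ 0)
    (hx : Submodule.span ℝ {a | a ∈ x} = ⊤) (h : ¬ LexPos u x) :
    ∀ᶠ ε in 𝓝[>] (0 : ℝ), (inner ℝ u (germCurve x ε) : ℝ) < 0 := by
  filter_upwards [(lexPos_neg_of_not (exists_inner_ne_zero hu hx trivial) h).eventually] with ε h
  rw [inner_neg_left] at h
  linarith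

/-- The germ of a curve lies in (the cone over) a subset of the sphere. -/
def InGerm (x : List W) (P : Set (Metric.sphere (0 : W) 1)) : Prop :=
  ∀ᶠ ε in 𝓝[>] (0 : ℝ), germCurve x ε ∈ coneOf P

variable [FiniteDimensional ℝ W] {x : List W}

theorem eventually_mem_of_lexPos {v : Fin (Module.finrank ℝ W) → Metric.sphere (0 : W) 1}
    {hv : LinearIndependent ℝ fun i => (v i : W)}
    (h : ∀ k, LexPos (dualVector (fun i => (v i : W)) hv k) x) : InGerm x (sphericalHull v) := by
  filter_upwards [eventually_all.2 fun k => (h k).eventually] with ε hε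
  exact mem_coneOf_sphericalHull_iff.2 fun k => (hε k).le

theorem eventually_notMem_of_not_lexPos (hx : Submodule.span ℝ {a | a ∈ x} = ⊤)
    {v : Fin (Module.finrank ℝ W) → Metric.sphere (0 : W) 1}
    {hv : LinearIndependent ℝ fun i => (v i : W)}
    (h : ¬ ∀ k, LexPos (dualVector (fun i => (v i : W)) hv k) x) :
    ∀ᶠ ε in 𝓝[>] (0 : ℝ), germCurve x ε ∉ coneOf (sphericalHull v) := by
  push Not at h
  obtain ⟨k, hk⟩ := h
  filter_upwards [eventually_neg_of_not_lexPos (dualVector_ne_zero k) hx hk] with ε hε hmem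
  exact absurd ((mem_coneOf_sphericalHull_iff (hv := hv)).1 hmem k) (not_le.2 hε)

theorem inGerm_sphericalHull_iff (hx : Submodule.span ℝ {a | a ∈ x} = ⊤)
    {v : Fin (Module.finrank ℝ W) → Metric.sphere (0 : W) 1}
    {hv : LinearIndependent ℝ fun i => (v i : W)} :
    InGerm x (sphericalHull v) ↔ ∀ k, LexPos (dualVector (fun i => (v i : W)) hv k) x := by
  refine ⟨fun h => ?_, eventually_mem_of_lexPos⟩
  by_contra hn
  obtain ⟨ε, h1, h2⟩ := (h.and (eventually_notMem_of_not_lexPos hx hn)).exists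
  exact h2 h1

/-- A dichotomy for generic germs: every dual vector of each of the finitely many simplices is
eventually strictly positive or eventually strictly negative along the curve. It upgrades "not
eventually inside" to "eventually outside". -/
theorem IsPolytope.eventually_or (hx : Submodule.span ℝ {a | a ∈ x} = ⊤)
    {P : Set (Metric.sphere (0 : W) 1)} (hP : IsPolytope P) :
    (∃ (v : Fin (Module.finrank ℝ W) → Metric.sphere (0 : W) 1)
      (hv : LinearIndependent ℝ fun i => (v i : W)), sphericalHull v ⊆ P ∧
      ∀ k, LexPos (dualVector (fun i => (v i : W)) hv k) x) ∨
    ∀ᶠ ε in 𝓝[>] (0 : ℝ), germCurve x ε ∉ coneOf P := by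
  obtain ⟨F, hF, hFn, hFl, rfl⟩ := hP
  by_cases h : ∃ (v : Fin (Module.finrank ℝ W) → Metric.sphere (0 : W) 1) (hv : v ∈ F),
      ∀ k, LexPos (dualVector (fun i => (v i : W)) (hFl v hv) k) x
  · obtain ⟨v, hv, h⟩ := h
    exact Or.inl ⟨v, hFl v hv, subset_biUnion_of_mem hv, h⟩
  · right
    push Not at h
    have h1 : ∀ᶠ ε in 𝓝[>] (0 : ℝ), ∀ v ∈ F, germCurve x ε ∉ coneOf (sphericalHull v) := by
      rw [eventually_all_finite hF]
      intro v hv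
      exact eventually_notMem_of_not_lexPos hx (hv := hFl v hv) (by
        push Not; exact h v hv)
    filter_upwards [h1] with ε hε
    rw [coneOf_biUnion hFn]
    simpa using hε

theorem IsPolytope.exists_of_inGerm (hx : Submodule.span ℝ {a | a ∈ x} = ⊤)
    {P : Set (Metric.sphere (0 : W) 1)} (hP : IsPolytope P) (h : InGerm x P) :
    ∃ (v : Fin (Module.finrank ℝ W) → Metric.sphere (0 : W) 1)
      (hv : LinearIndependent ℝ fun i => (v i : W)), sphericalHull v ⊆ P ∧
      ∀ k, LexPos (dualVector (fun i => (v i : W)) hv k) x := by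
  refine (hP.eventually_or hx).resolve_right fun hn => ?_
  obtain ⟨ε, h1, h2⟩ := (Filter.Eventually.and h hn).exists
  exact h2 h1

theorem InGerm.mono {P Q : Set (Metric.sphere (0 : W) 1)} (h : InGerm x P) (hPQ : P ⊆ Q) :
    InGerm x Q :=
  Eventually.mono h fun _ hε => coneOf_mono hPQ hε

/-- A generic germ in a polytope is eventually in the open part of one of its simplices, where all
dual coordinates are strictly positive, hence in the interior of the polytope. -/
theorem eq_of_inGerm (hx : Submodule.span ℝ {a | a ∈ x} = ⊤) {P Q : Polytope W}
    (hd : P ≠ Q → Disjoint (interior P.1) (interior Q.1)) (hP : InGerm x P.1)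
    (hQ : InGerm x Q.1) : P = Q := by
  by_contra hne
  obtain ⟨v, hv, hvP, h1⟩ := P.2.exists_of_inGerm hx hP
  obtain ⟨v', hv', hvQ, h2⟩ := Q.2.exists_of_inGerm hx hQ
  obtain ⟨ε, h3, h4⟩ := ((eventually_all.2 fun k => (h1 k).eventually).and
    (eventually_all.2 fun k => (h2 k).eventually)).exists
  -- A zero of the curve at a point where all dual coordinates are positive means that there are no
  -- dual vectors. Then `W = 0`, and there is only one polytope.
  by_cases hw : germCurve x ε = 0
  · have hN : IsEmpty (Fin (Module.finrank ℝ W)) := ⟨fun k => by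
      have := h3 k
      rw [hw, inner_zero_right] at this
      exact lt_irrefl _ this⟩
    have h0 : Module.finrank ℝ W = 0 := by
      by_contra h0
      exact hN.false ⟨0, Nat.pos_of_ne_zero h0⟩
    have := Module.finrank_zero_iff.1 h0
    exact hne (Subtype.ext (Set.ext fun p => by
      have := norm_eq_of_mem_sphere p
      rw [Subsingleton.elim (p : W) 0, norm_zero] at this
      norm_num at this))
  · have key : ∀ (v : Fin (Module.finrank ℝ W) → Metric.sphere (0 : W) 1)
        (hv : LinearIndependent ℝ fun i => (v i : W)),
        (∀ k, 0 < (inner ℝ (dualVector (fun i => (v i : W)) hv k) (germCurve x ε) : ℝ)) →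
        toSphere _ hw ∈ interior (sphericalHull v) := by
      intro v hv h
      refine mem_interior_sphericalHull (hv := hv) fun k => ?_
      change 0 < (inner ℝ _ (‖germCurve x ε‖⁻¹ • germCurve x ε) : ℝ)
      rw [inner_smul_right]
      exact mul_pos (inv_pos.2 (norm_pos_iff.2 hw)) (h k)
    exact Set.disjoint_iff.1 (hd hne)
      ⟨interior_mono hvP (key v hv h3), interior_mono hvQ (key v' hv' h4)⟩

/-- By the dichotomy a germ in none of the finitely many pieces is eventually outside all of them at
once, so it cannot stay in their union. -/
theorem IsWeakSubdivision.inGerm_iff (hx : Submodule.span ℝ {a | a ∈ x} = ⊤)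
    {S : Finset (Polytope W)} {P : Polytope W} (h : IsWeakSubdivision S P) :
    InGerm x P.1 ↔ ∃ Q ∈ S, InGerm x Q.1 := by
  obtain ⟨hS, hU, -⟩ := h
  constructor
  · intro hP
    by_contra! hn
    have h1 : ∀ᶠ ε in 𝓝[>] (0 : ℝ), ∀ Q ∈ S, germCurve x ε ∉ coneOf Q.1 := by
      rw [eventually_all_finset]
      intro Q hQ
      refine (Q.2.eventually_or hx).resolve_left ?_
      rintro ⟨v, hv, hvQ, h⟩
      exact hn Q hQ ((eventually_mem_of_lexPos h).mono hvQ)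
    obtain ⟨ε, h2, h3⟩ := (Filter.Eventually.and hP h1).exists
    rw [← hU] at h2
    have h4 := coneOf_biUnion (F := (S : Set (Polytope W))) hS fun Q => Q.1
    simp only [Finset.mem_coe] at h4
    rw [h4] at h2
    simp only [mem_iUnion, exists_prop] at h2
    obtain ⟨Q, hQ, h2⟩ := h2
    exact h3 Q hQ h2
  · rintro ⟨Q, hQ, h⟩
    refine h.mono ?_
    rw [← hU]
    exact subset_biUnion_of_mem (u := fun Q : Polytope W => Q.1) hQ

open Classical in
/-- The evaluation of (the classes of) polytopes at a generic germ. -/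
noncomputable def germEval (x : List W) (hx : Submodule.span ℝ {a | a ∈ x} = ⊤) :
    PolytopeGroup W →+ ℤ :=
  QuotientAddGroup.lift _ (FreeAbelianGroup.lift fun P : Polytope W => if InGerm x P.1 then 1 else 0)
    (by
      rw [subdivisionRelations, AddSubgroup.closure_le]
      rintro _ ⟨P, S, h, rfl⟩
      change FreeAbelianGroup.lift (fun P : Polytope W => if InGerm x P.1 then (1 : ℤ) else 0) _ = 0
      rw [map_sub, map_sum, sub_eq_zero]
      simp only [FreeAbelianGroup.lift_apply_of]
      have h2 := h.2.2
      by_cases hP : InGerm x P.1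
      · rw [if_pos hP]
        obtain ⟨Q, hQ, hxQ⟩ := (h.inGerm_iff hx).1 hP
        rw [Finset.sum_eq_single Q, if_pos hxQ]
        · intro R hR hne
          exact if_neg fun hxR => hne (eq_of_inGerm hx (fun hne => h2 hR hQ hne) hxR hxQ)
        · exact fun hn => absurd hQ hn
      · rw [if_neg hP, Finset.sum_eq_zero]
        exact fun Q hQ => if_neg fun hxQ => hP ((h.inGerm_iff hx).2 ⟨Q, hQ, hxQ⟩))

open Classical in
theorem germEval_polytopeClass (hx : Submodule.span ℝ {a | a ∈ x} = ⊤) (P : Polytope W) :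
    germEval x hx (polytopeClass P) = if InGerm x P.1 then 1 else 0 := by
  change FreeAbelianGroup.lift (fun P : Polytope W => if InGerm x P.1 then (1 : ℤ) else 0)
    (FreeAbelianGroup.of P) = _
  rw [FreeAbelianGroup.lift_apply_of]

theorem polytopeGroup_induction {C : PolytopeGroup W → Prop} (of : ∀ P, C (polytopeClass P))
    (zero : C 0) (neg : ∀ y, C y → C (-y)) (add : ∀ y z, C y → C z → C (y + z))
    (y : PolytopeGroup W) : C y := by
  obtain ⟨a, rfl⟩ := QuotientAddGroup.mk_surjective y
  induction a using FreeAbelianGroup.induction_on with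
  | zero => exact zero
  | of P => exact of P
  | neg P h => exact neg _ h
  | add a b ha hb => exact add _ _ ha hb

theorem polytopeGroup_hom_ext {A : Type*} [AddCommGroup A] {f g : PolytopeGroup W →+ A}
    (h : ∀ P, f (polytopeClass P) = g (polytopeClass P)) : f = g := by
  ext P
  exact h P

/-- On cones, suspension is the preimage under the orthogonal projection. Projecting the germ
therefore corresponds to suspending the polytope. -/
theorem coneOf_suspensionSet {V : Type*} [NormedAddCommGroup V] [InnerProductSpace ℝ V]
    [FiniteDimensional ℝ V] (i : V →ₗᵢ[ℝ] W) (P : Set (Metric.sphere (0 : V) 1)) :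
    coneOf (suspensionSet i P) = LinearMap.adjoint i.toLinearMap ⁻¹' coneOf P := by
  ext w
  by_cases hw : w = 0
  · subst hw
    simp [coneOf]
  have hn : 0 < ‖w‖ := norm_pos_iff.2 hw
  rw [← toSphere_mem_iff hw, mem_suspensionSet_iff]
  change LinearMap.adjoint i.toLinearMap (‖w‖⁻¹ • w) ∈ coneOf P ↔ _
  rw [map_smul, mem_preimage]
  constructor
  · intro h
    have := smul_mem_coneOf h hn
    rwa [smul_smul, mul_inv_cancel₀ hn.ne', one_smul] at this
  · exact fun h => smul_mem_coneOf h (inv_pos.2 hn)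

theorem inGerm_suspensionSet {V : Type*} [NormedAddCommGroup V] [InnerProductSpace ℝ V]
    [FiniteDimensional ℝ V] (i : V →ₗᵢ[ℝ] W) (P : Set (Metric.sphere (0 : V) 1)) :
    InGerm x (suspensionSet i P) ↔ InGerm (x.map (LinearMap.adjoint i.toLinearMap)) P := by
  simp only [InGerm, coneOf_suspensionSet, germCurve_map, mem_preimage]

theorem span_map_adjoint {V : Type*} [NormedAddCommGroup V] [InnerProductSpace ℝ V]
    [FiniteDimensional ℝ V] (i : V →ₗᵢ[ℝ] W) (hx : Submodule.span ℝ {a | a ∈ x} = ⊤) :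
    Submodule.span ℝ {a | a ∈ x.map (LinearMap.adjoint i.toLinearMap)} = ⊤ := by
  have h1 : {a | a ∈ x.map (LinearMap.adjoint i.toLinearMap)} =
      LinearMap.adjoint i.toLinearMap '' {a | a ∈ x} := by
    ext; simp
  rw [h1, Submodule.span_image, hx, Submodule.map_top, LinearMap.range_eq_top]
  exact fun v => ⟨i v, adjoint_isometry_apply i v⟩

theorem germEval_suspensionHom {V : Type*} [NormedAddCommGroup V] [InnerProductSpace ℝ V]
    [FiniteDimensional ℝ V] (i : V →ₗᵢ[ℝ] W) (hx : Submodule.span ℝ {a | a ∈ x} = ⊤)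
    (y : PolytopeGroup V) :
    germEval x hx (suspensionHom i y) =
      germEval (x.map (LinearMap.adjoint i.toLinearMap)) (span_map_adjoint i hx) y := by
  classical
  suffices (germEval x hx).comp (suspensionHom i) =
      germEval (x.map (LinearMap.adjoint i.toLinearMap)) (span_map_adjoint i hx) from
    DFunLike.congr_fun this y
  refine polytopeGroup_hom_ext fun P => ?_
  rw [AddMonoidHom.comp_apply, germEval_polytopeClass]
  have : suspensionHom i (polytopeClass P) = polytopeClass (suspensionPolytope i P) := by
    simp [suspensionHom, polytopeClass]
  rw [this, germEval_polytopeClass]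
  exact if_congr (inGerm_suspensionSet i P.1) rfl rfl

/-- Membership of a generic germ in a simplex depends only on the signs of the dual vectors, so
germs with the same signs are interchangeable. -/
theorem germEval_congr {y : List W} (hx : Submodule.span ℝ {a | a ∈ x} = ⊤)
    (hy : Submodule.span ℝ {a | a ∈ y} = ⊤) (h : ∀ u, LexPos u x ↔ LexPos u y) :
    germEval x hx = germEval y hy := by
  classical
  refine polytopeGroup_hom_ext fun P => ?_
  rw [germEval_polytopeClass, germEval_polytopeClass]
  refine if_congr ⟨fun h1 => ?_, fun h1 => ?_⟩ rfl rfl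
  · obtain ⟨v, hv, hvP, h2⟩ := P.2.exists_of_inGerm hx h1
    exact (eventually_mem_of_lexPos fun k => (h _).1 (h2 k)).mono hvP
  · obtain ⟨v, hv, hvP, h2⟩ := P.2.exists_of_inGerm hy h1
    exact (eventually_mem_of_lexPos fun k => (h _).2 (h2 k)).mono hvP

theorem span_append_right {b : List W} (hb : Submodule.span ℝ {a | a ∈ b} = ⊤) (x : List W) :
    Submodule.span ℝ {a | a ∈ x ++ b} = ⊤ :=
  top_le_iff.1 (hb.ge.trans (Submodule.span_mono fun a ha => by
    simp only [mem_ofPred_eq, List.mem_append] at *; exact Or.inr ha))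

/-- The function on germs given by an element of the polytope group. -/
noncomputable def germFun (b : List W) (hb : Submodule.span ℝ {a | a ∈ b} = ⊤) :
    PolytopeGroup W →+ (List W → ℤ) where
  toFun y x := germEval (x ++ b) (span_append_right hb x) y
  map_zero' := funext fun _ => map_zero _
  map_add' _ _ := funext fun _ => map_add _ _ _

theorem germFun_apply {b : List W} (hb : Submodule.span ℝ {a | a ∈ b} = ⊤) (y : PolytopeGroup W)
    (x : List W) : germFun b hb y x = germEval (x ++ b) (span_append_right hb x) y := rfl

theorem germFun_simplexPolytope {b : List W} (hb : Submodule.span ℝ {a | a ∈ b} = ⊤)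
    (v : Fin (Module.finrank ℝ W) → Metric.sphere (0 : W) 1)
    (hv : LinearIndependent ℝ fun i => (v i : W)) :
    germFun b hb (polytopeClass (simplexPolytope v hv)) =
      ∏ k, halfInd b (dualVector (fun i => (v i : W)) hv k) := by
  classical
  funext x
  rw [germFun_apply, germEval_polytopeClass, Finset.prod_apply]
  have h0 : InGerm (x ++ b) (simplexPolytope v hv).1 ↔ _ :=
    inGerm_sphericalHull_iff (span_append_right hb x) (hv := hv)
  simp only [h0]
  by_cases h : ∀ k, LexPos (dualVector (fun i => (v i : W)) hv k) (x ++ b)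
  · rw [if_pos h, Finset.prod_eq_one]
    exact fun k _ => by simp [halfInd, h k]
  · rw [if_neg h]
    push Not at h
    obtain ⟨k, hk⟩ := h
    exact (Finset.prod_eq_zero (Finset.mem_univ k) (by simp [halfInd, hk])).symm

end GermEvaluation

/-! ### Cutting simplices by hyperplanes. -/

section Triangulations

open Filter Topology

variable {W : Type*} [NormedAddCommGroup W] [InnerProductSpace ℝ W] [FiniteDimensional ℝ W]

/-- A weak subdivision into geometric simplices. -/
def IsTriangulation (S : Finset (Polytope W)) (P : Polytope W) : Prop :=
  IsWeakSubdivision S P ∧ ∀ t ∈ S, ∃ v hv, t = simplexPolytope v hv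

/-- A functional has constant (weak) sign on a subset of the sphere. -/
def ConstSign (u : W) (P : Set (Metric.sphere (0 : W) 1)) : Prop :=
  (∀ p ∈ P, 0 ≤ (inner ℝ u (p : W) : ℝ)) ∨ ∀ p ∈ P, (inner ℝ u (p : W) : ℝ) ≤ 0

theorem ConstSign.mono {u : W} {P Q : Set (Metric.sphere (0 : W) 1)} (h : ConstSign u Q)
    (hPQ : P ⊆ Q) : ConstSign u P :=
  h.imp (fun h p hp => h p (hPQ hp)) fun h p hp => h p (hPQ hp)

/-- If `x` were on the hyperplane, a small move in the direction `-u` would stay in `P` but make the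
functional negative. -/
theorem inner_ne_zero_of_mem_interior {u : W} (hu : u ≠ 0) {P : Set (Metric.sphere (0 : W) 1)}
    (hP : ∀ p ∈ P, 0 ≤ (inner ℝ u (p : W) : ℝ)) {x : Metric.sphere (0 : W) 1}
    (hx : x ∈ interior P) : 0 < (inner ℝ u (x : W) : ℝ) := by
  refine lt_of_le_of_ne (hP x (interior_subset hx)) fun h0 => ?_
  have hne0 : ∀ t : ℝ, (x : W) - t • u ≠ 0 := fun t ht => by
    have h1 := congrArg (inner ℝ u) (sub_eq_zero.1 ht)
    rw [← h0, inner_smul_right] at h1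
    rcases mul_eq_zero.1 h1.symm with h2 | h2
    · rw [h2, zero_smul, sub_zero] at ht
      have := norm_eq_of_mem_sphere x
      rw [ht] at this
      simp at this
    · exact hu (inner_self_eq_zero.1 h2)
  let γ : ℝ → Metric.sphere (0 : W) 1 := fun t => toSphere _ (hne0 t)
  have hγ : Continuous γ := by
    refine Continuous.subtype_mk ?_ _
    have hc : Continuous fun t : ℝ => (x : W) - t • u := by fun_prop
    exact (hc.norm.inv₀ fun t => norm_ne_zero_iff.2 (hne0 t)).smul hc
  have hγ0 : γ 0 = x := Subtype.ext (by simp [γ, toSphere])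
  have hO : IsOpen (γ ⁻¹' interior P) := isOpen_interior.preimage hγ
  obtain ⟨δ, hδ, hball⟩ := Metric.isOpen_iff.1 hO 0 (by rw [mem_preimage, hγ0]; exact hx)
  have hmem := hball (show δ / 2 ∈ Metric.ball (0 : ℝ) δ by
    rw [Metric.mem_ball, dist_zero_right, Real.norm_of_nonneg (by positivity)]; linarith)
  have h2 := hP _ (interior_subset hmem)
  change 0 ≤ (inner ℝ u (‖(x : W) - (δ / 2) • u‖⁻¹ • ((x : W) - (δ / 2) • u)) : ℝ) at h2
  rw [inner_smul_right, inner_sub_right, ← h0, inner_smul_right, zero_sub] at h2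
  have h3 : 0 < (inner ℝ u u : ℝ) := real_inner_self_pos.2 hu
  have h4 : 0 < ‖(x : W) - (δ / 2) • u‖⁻¹ := inv_pos.2 (norm_pos_iff.2 (hne0 _))
  have h5 := mul_pos h4 (mul_pos (half_pos hδ) h3)
  linarith

theorem disjoint_interior_of_separated {u : W} (hu : u ≠ 0) {P Q : Set (Metric.sphere (0 : W) 1)}
    (hP : ∀ p ∈ P, 0 ≤ (inner ℝ u (p : W) : ℝ)) (hQ : ∀ p ∈ Q, (inner ℝ u (p : W) : ℝ) ≤ 0) :
    Disjoint (interior P) (interior Q) := by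
  rw [Set.disjoint_iff]
  rintro x ⟨h1, h2⟩
  have := inner_ne_zero_of_mem_interior hu hP h1
  have := hQ x (interior_subset h2)
  linarith

open Classical in
theorem IsTriangulation.biUnion {S : Finset (Polytope W)} {P : Polytope W}
    (h : IsWeakSubdivision S P) {T : Polytope W → Finset (Polytope W)}
    (hT : ∀ Q ∈ S, IsTriangulation (T Q) Q) : IsTriangulation (S.biUnion T) P := by
  have hsub : ∀ Q ∈ S, ∀ R ∈ T Q, R.1 ⊆ Q.1 := fun Q hQ R hR => by
    rw [← (hT Q hQ).1.2.1]
    exact subset_biUnion_of_mem (u := fun Q : Polytope W => Q.1) hR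
  refine ⟨⟨?_, ?_, ?_⟩, ?_⟩
  · obtain ⟨Q, hQ⟩ := h.1
    obtain ⟨R, hR⟩ := (hT Q hQ).1.1
    exact ⟨R, Finset.mem_biUnion.2 ⟨Q, hQ, hR⟩⟩
  · rw [← h.2.1, Finset.set_biUnion_biUnion]
    exact iUnion₂_congr fun Q hQ => (hT Q hQ).1.2.1
  · intro R hR R' hR' hne
    simp only [Finset.mem_coe, Finset.mem_biUnion] at hR hR'
    obtain ⟨Q, hQ, hR⟩ := hR
    obtain ⟨Q', hQ', hR'⟩ := hR'
    by_cases hQQ : Q = Q'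
    · subst hQQ
      exact (hT Q hQ).1.2.2 hR hR' hne
    · exact (h.2.2 hQ hQ' hQQ).mono (interior_mono (hsub Q hQ R hR))
        (interior_mono (hsub Q' hQ' R' hR'))
  · intro t ht
    obtain ⟨Q, hQ, ht⟩ := Finset.mem_biUnion.1 ht
    exact (hT Q hQ).2 t ht

theorem isTriangulation_singleton (v : Fin (Module.finrank ℝ W) → Metric.sphere (0 : W) 1)
    (hv : LinearIndependent ℝ fun i => (v i : W)) :
    IsTriangulation {simplexPolytope v hv} (simplexPolytope v hv) :=
  ⟨⟨Finset.singleton_nonempty _, by simp, by simp⟩, fun _ ht => ⟨v, hv, Finset.mem_singleton.1 ht⟩⟩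

theorem inner_nonneg_of_vertices {v : Fin (Module.finrank ℝ W) → Metric.sphere (0 : W) 1} {u : W}
    (h : ∀ k, 0 ≤ (inner ℝ u (v k : W) : ℝ)) {p : Metric.sphere (0 : W) 1}
    (hp : p ∈ sphericalHull v) : 0 ≤ (inner ℝ u (p : W) : ℝ) := by
  obtain ⟨c, hc, hp⟩ := (mem_sphericalHull_iff _ _).1 hp
  rw [hp, inner_sum]
  refine Finset.sum_nonneg fun k _ => ?_
  rw [inner_smul_right]
  exact mul_nonneg (hc k) (h k)

theorem update_linearIndependent {v : Fin (Module.finrank ℝ W) → W}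
    (hv : LinearIndependent ℝ v) {i : Fin (Module.finrank ℝ W)} {w : W}
    (hw : inner ℝ (dualVector v hv i) w ≠ 0) : LinearIndependent ℝ (Function.update v i w) := by
  rw [Fintype.linearIndependent_iff]
  intro g hg
  have hsum : ∑ k, g k • Function.update v i w k = g i • w + ∑ k ∈ Finset.univ.erase i, g k • v k := by
    rw [← Finset.add_sum_erase _ _ (Finset.mem_univ i), Function.update_self]
    congr 1
    exact Finset.sum_congr rfl fun k hk => by
      rw [Function.update_of_ne (Finset.ne_of_mem_erase hk)]
  rw [hsum] at hg
  have hgi : g i = 0 := by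
    have h1 := congrArg (inner ℝ (dualVector v hv i)) hg
    rw [inner_add_right, inner_smul_right, inner_sum, inner_zero_right,
      Finset.sum_eq_zero fun k hk => ?_, add_zero] at h1
    · exact (mul_eq_zero.1 h1).resolve_right hw
    · rw [inner_smul_right, inner_dualVector_apply, if_neg (Finset.ne_of_mem_erase hk), mul_zero]
  rw [hgi, zero_smul, zero_add] at hg
  intro k
  by_cases hk : k = i
  · rw [hk, hgi]
  · have h1 := congrArg (inner ℝ (dualVector v hv k)) hg
    rw [inner_sum, inner_zero_right, Finset.sum_eq_single k] at h1
    · rwa [inner_smul_right, inner_dualVector_apply, if_pos rfl, mul_one] at h1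
    · intro j _ hj
      rw [inner_smul_right, inner_dualVector_apply, if_neg hj, mul_zero]
    · simp [hk]

/-- The functions `c` on a finite type with the value at `i` replaced. -/
theorem sum_update_smul {ι : Type*} [Fintype ι] [DecidableEq ι] (c : ι → ℝ) (v : ι → W) (i : ι)
    (w : W) : ∑ k, c k • Function.update v i w k = (∑ k, c k • v k) - c i • v i + c i • w := by
  rw [← Finset.add_sum_erase _ _ (Finset.mem_univ i),
    ← Finset.add_sum_erase _ (fun k => c k • v k) (Finset.mem_univ i), Function.update_self,
    Finset.sum_congr rfl fun k hk => by rw [Function.update_of_ne (Finset.ne_of_mem_erase hk)]]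
  abel

/-- A simplex is subdivided by the hyperplane through all but two of its vertices and a point on
the edge between these two. -/
theorem exists_isTriangulation_constSign (u : W) (n : ℕ)
    (v : Fin (Module.finrank ℝ W) → Metric.sphere (0 : W) 1)
    (hv : LinearIndependent ℝ fun i => (v i : W))
    (hn : (Finset.univ.filter fun k => (inner ℝ u (v k : W) : ℝ) ≠ 0).card ≤ n) :
    ∃ S, IsTriangulation S (simplexPolytope v hv) ∧ ∀ t ∈ S, ConstSign u t.1 := by
  classical
  -- The induction is on the number of vertices off the hyperplane of `u`. Each cut replaces such a
  -- vertex by a point of the hyperplane, so both halves have fewer of them.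
  induction n generalizing v with
  | zero =>
    refine ⟨_, isTriangulation_singleton v hv, fun t ht => ?_⟩
    rw [Finset.mem_singleton.1 ht]
    left
    intro p hp
    refine inner_nonneg_of_vertices (fun k => ?_) hp
    have h1 := Finset.card_eq_zero.1 (Nat.le_zero.1 hn)
    by_contra hk
    have h2 : k ∈ Finset.univ.filter fun k => (inner ℝ u (v k : W) : ℝ) ≠ 0 := by
      simp; intro h0; rw [h0] at hk; exact hk le_rfl
    rw [h1] at h2
    simp at h2
  | succ n ih =>
    by_cases h1 : ∀ k, 0 ≤ (inner ℝ u (v k : W) : ℝ)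
    · refine ⟨_, isTriangulation_singleton v hv, fun t ht => ?_⟩
      rw [Finset.mem_singleton.1 ht]
      exact Or.inl fun p hp => inner_nonneg_of_vertices h1 hp
    by_cases h2 : ∀ k, (inner ℝ u (v k : W) : ℝ) ≤ 0
    · refine ⟨_, isTriangulation_singleton v hv, fun t ht => ?_⟩
      rw [Finset.mem_singleton.1 ht]
      refine Or.inr fun p hp => ?_
      have := inner_nonneg_of_vertices (u := -u) (fun k => by simpa using h2 k) hp
      simpa using this
    push Not at h1 h2
    obtain ⟨j, hj⟩ := h1
    obtain ⟨i, hi⟩ := h2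
    have hij : i ≠ j := fun h => by rw [h] at hi; linarith
    set α : ℝ := -inner ℝ u (v j : W) with hα
    set β : ℝ := inner ℝ u (v i : W) with hβ
    have hα0 : 0 < α := by rw [hα]; linarith
    -- The functional is positive at `v i` and negative at `v j`; these weights give the direction
    -- of the zero of `u` on the edge between them.
    set w : W := α • (v i : W) + β • (v j : W) with hw
    have huw : inner ℝ u w = 0 := by
      rw [hw, inner_add_right, inner_smul_right, inner_smul_right, ← hβ,
        show (inner ℝ u (v j : W) : ℝ) = -α by rw [hα]; ring]
      ring
    set d := dualVector (fun i => (v i : W)) hv with hd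
    have hdv : ∀ k l, inner ℝ (d k) (v l : W) = if l = k then (1 : ℝ) else 0 :=
      fun k l => inner_dualVector_apply (hv := hv) k l
    have hdi : inner ℝ (d i) w = α := by
      rw [hw, inner_add_right, inner_smul_right, inner_smul_right, hdv, hdv]
      simp [hij.symm]
    have hdj : inner ℝ (d j) w = β := by
      rw [hw, inner_add_right, inner_smul_right, inner_smul_right, hdv, hdv]
      simp [hij]
    have hw0 : w ≠ 0 := fun h => by rw [h, inner_zero_right] at hdi; exact hα0.ne hdi
    set w' := toSphere w hw0 with hw'
    have hw'e : (w' : W) = ‖w‖⁻¹ • w := rfl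
    have hwn : 0 < ‖w‖⁻¹ := inv_pos.2 (norm_pos_iff.2 hw0)
    have hww' : w = ‖w‖ • (w' : W) := (norm_smul_toSphere w hw0).symm
    have huw' : inner ℝ u (w' : W) = 0 := by rw [hw'e, inner_smul_right, huw, mul_zero]
    have hupd : ∀ k, (fun l => (Function.update v k w' l : W)) =
        Function.update (fun l => (v l : W)) k w' := fun k => by
      funext l
      by_cases h : l = k
      · subst h; simp
      · simp [h]
    have hli : ∀ k, inner ℝ (d k) w ≠ 0 →
        LinearIndependent ℝ fun l => (Function.update v k w' l : W) := fun k hk => by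
      rw [hupd]
      refine update_linearIndependent hv ?_
      rw [hw'e, inner_smul_right]
      exact mul_ne_zero hwn.ne' hk
    have hvi := hli i (by rw [hdi]; exact hα0.ne')
    have hvj := hli j (by rw [hdj]; exact hi.ne')
    have hcard : ∀ k, (inner ℝ u (v k : W) : ℝ) ≠ 0 →
        (Finset.univ.filter fun l => (inner ℝ u (Function.update v k w' l : W) : ℝ) ≠ 0).card ≤ n := by
      intro k hk
      refine Nat.le_of_lt_succ (lt_of_lt_of_le (Finset.card_lt_card ?_) hn)
      rw [Finset.ssubset_iff_of_subset]
      · exact ⟨k, by simpa using hk, by simp [huw']⟩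
      · intro l hl
        simp only [Finset.mem_filter, Finset.mem_univ, true_and] at hl ⊢
        by_cases h : l = k
        · subst h; simp [huw'] at hl
        · simpa [h] using hl
    obtain ⟨Si, hSi, hSi'⟩ := ih _ hvi (hcard i hi.ne')
    obtain ⟨Sj, hSj, hSj'⟩ := ih _ hvj (hcard j (by linarith))
    have hcomb : ∀ (k) (c : Fin (Module.finrank ℝ W) → ℝ),
        ∑ l, c l • (Function.update v k w' l : W) =
          (∑ l, c l • (v l : W)) - c k • (v k : W) + c k • (w' : W) := by
      intro k c
      have := sum_update_smul c (fun l => (v l : W)) k (w' : W)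
      rw [← this, ← hupd]
    have hsubI : ∀ k, sphericalHull (Function.update v k w') ⊆ sphericalHull v := by
      intro k p hp
      rw [mem_sphericalHull_iff] at hp
      obtain ⟨c, hc, hp⟩ := hp
      rw [mem_sphericalHull_iff_dualVector (hv := hv)]
      intro l
      rw [hp, inner_sum]
      refine Finset.sum_nonneg fun m _ => ?_
      rw [inner_smul_right]
      refine mul_nonneg (hc m) ?_
      by_cases h : m = k
      · subst h
        rw [Function.update_self, hw'e, inner_smul_right, hw, inner_add_right, inner_smul_right,
          inner_smul_right, ← hd, hdv, hdv]
        split_ifs <;> positivity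
      · rw [Function.update_of_ne h, ← hd, hdv]
        split_ifs <;> norm_num
    have hdj' : inner ℝ (d j) (w' : W) = ‖w‖⁻¹ * β := by rw [hw'e, inner_smul_right, hdj]
    have hdi' : inner ℝ (d i) (w' : W) = ‖w‖⁻¹ * α := by rw [hw'e, inner_smul_right, hdi]
    -- This is a normal vector of the cutting hyperplane: it vanishes at `w` and at all vertices
    -- other than `v i` and `v j`, is positive at `v j` and negative at `v i`. It separates the
    -- interiors of the two halves.
    set μ : W := α • d j - β • d i with hμ
    have hμ0 : μ ≠ 0 := fun h => by
      have h1 : inner ℝ μ (v j : W) = α := by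
        rw [hμ, inner_sub_left, inner_smul_left, inner_smul_left, hdv, hdv]
        simp [hij.symm]
      rw [h, inner_zero_left] at h1
      exact hα0.ne h1
    have hμv : ∀ p, (inner ℝ μ p : ℝ) = α * inner ℝ (d j) p - β * inner ℝ (d i) p := by
      intro p
      rw [hμ, inner_sub_left, inner_smul_left, inner_smul_left]
      simp
    have hposI : ∀ p ∈ sphericalHull (Function.update v i w'), 0 ≤ (inner ℝ μ (p : W) : ℝ) := by
      intro p hp
      refine inner_nonneg_of_vertices (fun k => ?_) hp
      rw [hμv]
      by_cases h : k = i
      · subst h; rw [Function.update_self, hdi', hdj']; apply le_of_eq; ring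
      · rw [Function.update_of_ne h, hdv, hdv, if_neg h]
        split_ifs <;> simp [hα0.le]
    have hnegJ : ∀ p ∈ sphericalHull (Function.update v j w'), (inner ℝ μ (p : W) : ℝ) ≤ 0 := by
      intro p hp
      have := inner_nonneg_of_vertices (u := -μ) (fun k => ?_) hp
      · rw [inner_neg_left] at this; linarith
      rw [inner_neg_left, hμv]
      by_cases h : k = j
      · subst h; rw [Function.update_self, hdi', hdj']; apply le_of_eq; ring
      · rw [Function.update_of_ne h, hdv, hdv, if_neg h]
        split_ifs <;> simp [hi.le]
    have hunion : sphericalHull v ⊆ sphericalHull (Function.update v i w') ∪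
        sphericalHull (Function.update v j w') := by
      intro p hp
      rw [mem_sphericalHull_iff_dualVector (hv := hv), ← hd] at hp
      have hpe : (p : W) = ∑ k, (inner ℝ (d k) (p : W) : ℝ) • (v k : W) :=
        (sum_inner_dualVector (hv := hv) (p : W)).symm
      set c : Fin (Module.finrank ℝ W) → ℝ := fun k => inner ℝ (d k) (p : W) with hc
      have hcp : ∀ k, 0 ≤ c k := hp
      have hαβ : ‖w‖ • (w' : W) = α • (v i : W) + β • (v j : W) := by rw [← hww']
      -- the case distinction is symmetric
      have gen : ∀ (i j : Fin (Module.finrank ℝ W)) (α β : ℝ), i ≠ j → 0 < α → 0 < β →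
          ‖w‖ • (w' : W) = α • (v i : W) + β • (v j : W) → β * c i ≤ α * c j →
          p ∈ sphericalHull (Function.update v i w') := by
        intro i j α β hij hα hβ hαβ hle
        rw [mem_sphericalHull_iff]
        -- Substituting `v i = α⁻¹ (w - β v j)` in the expansion of `p` leaves `v j` with this
        -- coefficient, which is nonnegative precisely in the case considered.
        have hcj : 0 ≤ c j - β * (c i / α) := by
          rw [sub_nonneg, mul_div_assoc', div_le_iff₀ hα]
          linarith
        have hce : ∑ l, (Function.update (Function.update c j (c j - β * (c i / α))) i
            (c i / α * ‖w‖)) l • (Function.update v i w' l : W) = p := by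
          rw [hcomb, Function.update_self, ← Finset.add_sum_erase _ _ (Finset.mem_univ i),
            Function.update_self, mul_smul, mul_smul, hαβ,
            Finset.sum_congr rfl fun l hl => by
              rw [Function.update_of_ne (Finset.ne_of_mem_erase hl)],
            ← Finset.add_sum_erase _ _ (Finset.mem_erase.2 ⟨hij.symm, Finset.mem_univ j⟩),
            Function.update_self, Finset.sum_congr rfl fun l hl => by
              rw [Function.update_of_ne (Finset.ne_of_mem_erase hl)], hpe,
            ← Finset.add_sum_erase _ (fun k => c k • (v k : W)) (Finset.mem_univ i),
            ← Finset.add_sum_erase _ (fun k => c k • (v k : W))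
              (Finset.mem_erase.2 ⟨hij.symm, Finset.mem_univ j⟩), smul_add, smul_smul, smul_smul,
            div_mul_cancel₀ _ hα.ne', sub_smul, mul_smul β, smul_comm (c i / α) β]
          abel
        refine ⟨_, fun l => ?_, hce.symm⟩
        by_cases h : l = i
        · subst h
          rw [Function.update_self]
          exact mul_nonneg (div_nonneg (hcp _) hα.le) (norm_nonneg _)
        · rw [Function.update_of_ne h]
          by_cases h' : l = j
          · subst h'; rw [Function.update_self]; exact hcj
          · rw [Function.update_of_ne h']; exact hcp l
      rcases le_total (β * c i) (α * c j) with hle | hle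
      · exact Or.inl (gen i j α β hij hα0 hi hαβ hle)
      · exact Or.inr (gen j i β α hij.symm hi hα0 (by rw [hαβ, add_comm]) hle)
    have hsubd : IsWeakSubdivision {simplexPolytope _ hvi, simplexPolytope _ hvj}
        (simplexPolytope v hv) := by
      refine ⟨by simp, ?_, ?_⟩
      · simp only [Finset.mem_insert, Finset.mem_singleton, iUnion_iUnion_eq_or_left,
          iUnion_iUnion_eq_left]
        exact Subset.antisymm (union_subset (hsubI i) (hsubI j)) hunion
      · rw [Finset.coe_pair, Set.pairwise_pair]
        intro _
        have := disjoint_interior_of_separated hμ0 hposI hnegJ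
        exact ⟨this, this.symm⟩
    set T : Polytope W → Finset (Polytope W) := fun Q =>
      if Q = simplexPolytope _ hvi then Si else Sj with hTdef
    have hT : ∀ Q ∈ ({simplexPolytope _ hvi, simplexPolytope _ hvj} : Finset (Polytope W)),
        IsTriangulation (T Q) Q ∧ ∀ t ∈ T Q, ConstSign u t.1 := by
      intro Q hQ
      by_cases h : Q = simplexPolytope _ hvi
      · simp only [hTdef, if_pos h]
        rw [h]
        exact ⟨hSi, hSi'⟩
      · simp only [hTdef, if_neg h]
        have hQ' : Q = simplexPolytope _ hvj := by
          simp only [Finset.mem_insert, Finset.mem_singleton] at hQ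
          exact hQ.resolve_left h
        rw [hQ']
        exact ⟨hSj, hSj'⟩
    refine ⟨_, IsTriangulation.biUnion hsubd fun Q hQ => (hT Q hQ).1, fun t ht => ?_⟩
    obtain ⟨Q, hQ, ht⟩ := Finset.mem_biUnion.1 ht
    exact (hT Q hQ).2 t ht

end Triangulations

/-! ### Fine triangulations of the sphere, and the polytope group as a group of functions. -/

section Triangulations

open Filter Topology

variable {W : Type*} [NormedAddCommGroup W] [InnerProductSpace ℝ W] [FiniteDimensional ℝ W]

variable (W) in
/-- The unit sphere is triangulated by the orthants of an orthonormal basis. -/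
theorem exists_isTriangulation_univ :
    ∃ (P : Polytope W) (S : Finset (Polytope W)), P.1 = univ ∧ IsTriangulation S P := by
  classical
  let b := stdOrthonormalBasis ℝ W
  let sg : Bool → ℝ := fun s => if s then 1 else -1
  have hsg : ∀ s, sg s * sg s = 1 := by intro s; cases s <;> simp [sg]
  let g : (Fin (Module.finrank ℝ W) → Bool) → Fin (Module.finrank ℝ W) → Metric.sphere (0 : W) 1 :=
    fun s k => ⟨sg (s k) • b k, by
      have : ‖b k‖ = 1 := b.orthonormal.1 k
      cases h : s k <;> simp [sg, this]⟩
  have hg : ∀ s, LinearIndependent ℝ fun k => (g s k : W) := by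
    intro s
    have h := b.toBasis.linearIndependent
    rw [b.coe_toBasis] at h
    have e : (fun k => (g s k : W)) = (fun k => if s k then (1 : ℝˣ) else -1) • ⇑b := by
      funext k
      simp only [g, sg, Pi.smul_apply']
      split_ifs <;> simp
    rw [e]
    exact h.units_smul _
  have hcov : ∀ x : Metric.sphere (0 : W) 1, ∃ s, x ∈ sphericalHull (g s) := by
    intro x
    refine ⟨fun k => decide (0 ≤ (inner ℝ (b k) (x : W) : ℝ)), (mem_sphericalHull_iff _ _).2
      ⟨fun k => |(inner ℝ (b k) (x : W) : ℝ)|, fun k => abs_nonneg _, ?_⟩⟩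
    rw [← b.sum_repr (x : W)]
    refine Finset.sum_congr rfl fun k _ => ?_
    rw [b.sum_repr, b.repr_apply_apply]
    change _ = _ • (sg _ • b k)
    rw [smul_smul]
    congr 1
    by_cases h : 0 ≤ (inner ℝ (b k) (x : W) : ℝ)
    · simp [sg, h, abs_of_nonneg h]
    · simp [sg, h, abs_of_neg (not_le.1 h)]
  have huniv : (⋃ s, sphericalHull (g s)) = univ := by
    rw [eq_univ_iff_forall]
    exact fun x => mem_iUnion.2 (hcov x)
  let P : Polytope W := ⟨univ, range g, finite_range g, range_nonempty g, by
    rintro _ ⟨s, rfl⟩; exact hg s, by rw [biUnion_range, huniv]⟩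
  refine ⟨P, Finset.univ.image fun s => simplexPolytope (g s) (hg s), rfl,
    ⟨by simp, ?_, ?_⟩, fun t ht => ?_⟩
  · rw [Finset.set_biUnion_finset_image]
    simp only [Finset.mem_univ, iUnion_true]
    exact huniv
  · intro t ht t' ht' hne
    simp only [Finset.coe_image, Finset.coe_univ, image_univ, mem_range] at ht ht'
    obtain ⟨s, rfl⟩ := ht
    obtain ⟨s', rfl⟩ := ht'
    obtain ⟨k, hk⟩ : ∃ k, s k ≠ s' k := by
      by_contra! h
      have : s = s' := funext h
      exact hne (by subst this; rfl)
    have hin : ∀ s l, (inner ℝ (b k) (g s l : W) : ℝ) = if l = k then sg (s k) else 0 := by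
      intro s l
      change (inner ℝ (b k) (sg (s l) • b l) : ℝ) = _
      rw [inner_smul_right, orthonormal_iff_ite.1 b.orthonormal]
      by_cases h : l = k
      · subst h; simp
      · simp [h, Ne.symm h]
    refine disjoint_interior_of_separated (u := sg (s k) • b k) ?_ ?_ ?_
    · intro h0
      have h1 := b.orthonormal.ne_zero k
      rcases smul_eq_zero.1 h0 with h | h
      · have := hsg (s k); rw [h] at this; norm_num at this
      · exact h1 h
    · intro p hp
      refine inner_nonneg_of_vertices (fun l => ?_) hp
      rw [inner_smul_left, hin]
      split_ifs
      · simp [hsg]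
      · simp
    · intro p hp
      have := inner_nonneg_of_vertices (u := -(sg (s k) • b k)) (fun l => ?_) hp
      · rw [inner_neg_left] at this; linarith
      rw [inner_neg_left, inner_smul_left, hin]
      split_ifs
      · cases h1 : s k <;> cases h2 : s' k <;> simp_all [sg]
      · simp
  · obtain ⟨s, -, rfl⟩ := Finset.mem_image.1 ht
    exact ⟨_, _, rfl⟩

/-- The sphere has triangulations whose simplices do not cross any of finitely many given
hyperplanes. -/
theorem exists_isTriangulation_univ_constSign (Λ : Finset W) :
    ∃ (P : Polytope W) (S : Finset (Polytope W)), P.1 = univ ∧ IsTriangulation S P ∧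
      ∀ u ∈ Λ, ∀ t ∈ S, ConstSign u t.1 := by
  classical
  induction Λ using Finset.induction_on with
  | empty =>
    obtain ⟨P, S, h1, h2⟩ := exists_isTriangulation_univ W
    exact ⟨P, S, h1, h2, by simp⟩
  | insert u Λ _ ih =>
    obtain ⟨P, S, h1, h2, h3⟩ := ih
    have key : ∀ t ∈ S, ∃ T, IsTriangulation T t ∧ ∀ t' ∈ T, ConstSign u t'.1 := by
      intro t ht
      obtain ⟨v, hv, rfl⟩ := h2.2 t ht
      exact exists_isTriangulation_constSign u _ v hv le_rfl
    choose! T hT hT' using key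
    refine ⟨P, _, h1, IsTriangulation.biUnion h2.1 hT, fun u' hu' t' ht' => ?_⟩
    obtain ⟨t, ht, ht'⟩ := Finset.mem_biUnion.1 ht'
    rcases Finset.mem_insert.1 hu' with rfl | hu'
    · exact hT' t ht t' ht'
    · refine (h3 u' hu' t ht).mono ?_
      rw [← (hT t ht).1.2.1]
      exact subset_biUnion_of_mem (u := fun Q : Polytope W => Q.1) ht'

/-- A triangulation of the sphere that does not cross the facets of the simplices of a polytope
contains a triangulation of the polytope. -/
theorem IsPolytope.exists_subdivision {P : Set (Metric.sphere (0 : W) 1)} (hP : IsPolytope P) :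
    ∃ Λ : Finset W, ∀ (U : Polytope W) (S : Finset (Polytope W)), U.1 = univ → IsTriangulation S U →
      (∀ u ∈ Λ, ∀ t ∈ S, ConstSign u t.1) →
      ∀ x ∈ P, ∃ t ∈ S, t.1 ⊆ P ∧ x ∈ t.1 := by
  classical
  obtain ⟨F, hF, hFn, hFl, rfl⟩ := hP
  have hfin : (⋃ v ∈ F, {u | ∃ (hv : LinearIndependent ℝ fun i => (v i : W)) (k : _),
      u = dualVector (fun i => (v i : W)) hv k}).Finite := by
    refine hF.biUnion fun v hv => ?_
    refine (finite_range (dualVector (fun i => (v i : W)) (hFl v hv))).subset ?_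
    rintro _ ⟨hv, k, rfl⟩
    exact ⟨k, rfl⟩
  refine ⟨hfin.toFinset, fun U S hU hS hΛ x hx => ?_⟩
  simp only [mem_iUnion, exists_prop] at hx
  obtain ⟨v, hvF, hx⟩ := hx
  have hv := hFl v hvF
  rw [mem_sphericalHull_iff_dualVector (hv := hv)] at hx
  set d := dualVector (fun i => (v i : W)) hv with hd
  have hdΛ : ∀ k, ∀ t ∈ S, ConstSign (d k) t.1 := fun k => hΛ _ (by
    simp only [Finite.mem_toFinset, mem_iUnion, exists_prop]
    exact ⟨v, hvF, hv, k, rfl⟩)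
  -- Adding `ε` to all coordinates pushes `x` into the interior of the simplex. This is needed
  -- because a simplex of `S` that contains the boundary point `x` may lie outside `sphericalHull
  -- v`.
  let γ : ℝ → W := fun ε => (x : W) + ε • ∑ k, (v k : W)
  have hγd : ∀ ε k, inner ℝ (d k) (γ ε) = inner ℝ (d k) (x : W) + ε := by
    intro ε k
    have := inner_dualVector_sum (hv := hv) (fun _ => 1) k
    simp only [one_smul] at this
    rw [inner_add_right, inner_smul_right, this, mul_one]
  have hk : ∃ k : Fin (Module.finrank ℝ W), True := by
    by_contra! hn
    have h1 := sum_inner_dualVector (hv := hv) (x : W)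
    rw [Finset.sum_eq_zero fun k _ => (hn k).elim] at h1
    have := norm_eq_of_mem_sphere x
    rw [← h1] at this
    simp at this
  obtain ⟨k₀, -⟩ := hk
  have hev : ∀ᶠ ε in 𝓝[>] (0 : ℝ), ∃ t ∈ S, t.1 ⊆ sphericalHull v ∧ γ ε ∈ coneOf t.1 := by
    filter_upwards [self_mem_nhdsWithin] with ε hε
    have hpos : ∀ k, 0 < (inner ℝ (d k) (γ ε) : ℝ) := fun k => by
      rw [hγd]; exact add_pos_of_nonneg_of_pos (hx k) hε
    have hne : γ ε ≠ 0 := fun h => by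
      have := hpos k₀
      rw [h, inner_zero_right] at this
      exact lt_irrefl _ this
    have hmem : toSphere _ hne ∈ ⋃ Q ∈ S, Q.1 := by rw [hS.1.2.1, hU]; trivial
    simp only [mem_iUnion, exists_prop] at hmem
    obtain ⟨t, ht, hmem⟩ := hmem
    refine ⟨t, ht, fun p hp => ?_, (toSphere_mem_iff hne).1 hmem⟩
    rw [mem_sphericalHull_iff_dualVector (hv := hv)]
    intro k
    -- The simplex `t` has a point where `d k` is strictly positive and does not cross its
    -- hyperplane, so it lies on the positive side.
    rcases hdΛ k t ht with h | h
    · exact h p hp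
    · have h1 := h _ hmem
      change (inner ℝ (d k) (‖γ ε‖⁻¹ • γ ε) : ℝ) ≤ 0 at h1
      rw [inner_smul_right] at h1
      have := mul_pos (inv_pos.2 (norm_pos_iff.2 hne)) (hpos k)
      linarith
  -- As `S` is finite, one and the same simplex meets the curve for arbitrarily small `ε`; since its
  -- cone is closed, it contains the limit `x`.
  obtain ⟨t, ht, hsub, hfr⟩ : ∃ t ∈ S, t.1 ⊆ sphericalHull v ∧
      ∃ᶠ ε in 𝓝[>] (0 : ℝ), γ ε ∈ coneOf t.1 := by
    by_contra! hcon
    have h1 : ∀ᶠ ε in 𝓝[>] (0 : ℝ), ∀ t ∈ S, t.1 ⊆ sphericalHull v → γ ε ∉ coneOf t.1 := by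
      rw [eventually_all_finset]
      intro t ht
      by_cases hsub : t.1 ⊆ sphericalHull v
      · filter_upwards [hcon t ht hsub] with ε hε _ using hε
      · exact Eventually.of_forall fun ε h => absurd h hsub
    obtain ⟨ε, ⟨t, ht, h2, h3⟩, h4⟩ := (hev.and h1).exists
    exact h4 t ht h2 h3
  refine ⟨t, ht, hsub.trans (subset_biUnion_of_mem hvF), ?_⟩
  obtain ⟨v', hv', rfl⟩ := hS.2 t ht
  change x ∈ sphericalHull v'
  rw [← coe_mem_coneOf]
  have hcl : IsClosed (coneOf (sphericalHull v')) := by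
    have : coneOf (sphericalHull v') = ⋂ k, {w : W |
        0 ≤ (inner ℝ (dualVector (fun i => (v' i : W)) hv' k) w : ℝ)} := by
      ext w
      simp [mem_coneOf_sphericalHull_iff (hv := hv')]
    rw [this]
    exact isClosed_iInter fun k => isClosed_le continuous_const
      (continuous_const.inner continuous_id)
  have hγc : Continuous γ := by fun_prop
  refine hcl.mem_of_frequently_of_tendsto hfr ?_
  have h0 : γ 0 = x := by simp [γ]
  rw [← h0]
  exact hγc.continuousAt.tendsto.mono_left nhdsWithin_le_nhds

theorem polytopeClass_eq_sum {S : Finset (Polytope W)} {P : Polytope W}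
    (h : IsWeakSubdivision S P) : polytopeClass P = ∑ Q ∈ S, polytopeClass Q := by
  have h1 : FreeAbelianGroup.of P - ∑ Q ∈ S, FreeAbelianGroup.of Q ∈ subdivisionRelations W :=
    AddSubgroup.subset_closure ⟨P, S, h, rfl⟩
  rw [← QuotientAddGroup.eq_zero_iff] at h1
  have h2 : ((∑ Q ∈ S, FreeAbelianGroup.of Q : FreeAbelianGroup (Polytope W)) : PolytopeGroup W) =
      ∑ Q ∈ S, polytopeClass Q := map_sum (QuotientAddGroup.mk' (subdivisionRelations W)) _ _
  rw [← h2]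
  exact sub_eq_zero.1 h1

/-- Every element of the polytope group is a combination of the simplices of any sufficiently fine
triangulation of the sphere. -/
theorem exists_eq_sum_triangulation (y : PolytopeGroup W) :
    ∃ Λ : Finset W, ∀ (U : Polytope W) (S : Finset (Polytope W)), U.1 = univ → IsTriangulation S U →
      (∀ u ∈ Λ, ∀ t ∈ S, ConstSign u t.1) →
      ∃ n : Polytope W → ℤ, y = ∑ t ∈ S, n t • polytopeClass t := by
  classical
  induction y using polytopeGroup_induction with
  | of P =>
    obtain ⟨Λ, hΛ⟩ := P.2.exists_subdivision
    refine ⟨Λ, fun U S hU hS hS' => ⟨fun t => if t.1 ⊆ P.1 then 1 else 0, ?_⟩⟩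
    have hcov := hΛ U S hU hS hS'
    have hsub : IsWeakSubdivision (S.filter fun t => t.1 ⊆ P.1) P := by
      refine ⟨?_, ?_, fun t ht t' ht' hne => ?_⟩
      · by_cases hne : P.1.Nonempty
        · obtain ⟨x, hx⟩ := hne
          obtain ⟨t, ht, h1, -⟩ := hcov x hx
          exact ⟨t, Finset.mem_filter.2 ⟨ht, h1⟩⟩
        -- A polytope is empty only if there are no vertices, that is, if `W = 0`. A weak
        -- subdivision must still be nonempty, and then every simplex of `S` is empty and qualifies.
        · obtain ⟨t, ht⟩ := hS.1.1
          refine ⟨t, Finset.mem_filter.2 ⟨ht, ?_⟩⟩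
          obtain ⟨v, hv, rfl⟩ := hS.2 t ht
          by_cases hN : Nonempty (Fin (Module.finrank ℝ W))
          · obtain ⟨k⟩ := hN
            obtain ⟨F, _, ⟨v', hv'⟩, _, hPe⟩ := P.2
            refine absurd ⟨v' k, ?_⟩ hne
            rw [hPe]
            refine mem_biUnion hv' ((mem_sphericalHull_iff _ _).2 ⟨Pi.single k 1, fun j => ?_, ?_⟩)
            · by_cases h : j = k
              · subst h; simp
              · simp [h]
            · simp [Pi.single_apply]
          · intro x _
            have h1 := sum_inner_dualVector (hv := hv) (x : W)
            rw [Finset.sum_eq_zero fun k _ => (hN ⟨k⟩).elim] at h1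
            have := norm_eq_of_mem_sphere x
            rw [← h1] at this
            simp at this
      · ext x
        simp only [mem_iUnion, exists_prop, Finset.mem_filter]
        constructor
        · rintro ⟨t, ⟨_, h1⟩, h2⟩
          exact h1 h2
        · intro hx
          obtain ⟨t, ht, h1, h2⟩ := hcov x hx
          exact ⟨t, ⟨ht, h1⟩, h2⟩
      · exact hS.1.2.2 (Finset.mem_filter.1 ht).1 (Finset.mem_filter.1 ht').1 hne
    rw [polytopeClass_eq_sum hsub, Finset.sum_filter]
    refine Finset.sum_congr rfl fun t _ => ?_
    by_cases h : t.1 ⊆ P.1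
    · simp only [if_pos h, one_smul]
    · simp only [if_neg h, zero_smul]
  | zero => exact ⟨∅, fun _ S _ _ _ => ⟨0, by simp⟩⟩
  | neg y h =>
    obtain ⟨Λ, hΛ⟩ := h
    refine ⟨Λ, fun U S hU hS hS' => ?_⟩
    obtain ⟨n, hn⟩ := hΛ U S hU hS hS'
    exact ⟨-n, by rw [hn]; simp⟩
  | add y z hy hz =>
    obtain ⟨Λ, hΛ⟩ := hy
    obtain ⟨Λ', hΛ'⟩ := hz
    refine ⟨Λ ∪ Λ', fun U S hU hS hS' => ?_⟩
    obtain ⟨n, hn⟩ := hΛ U S hU hS fun u hu => hS' u (Finset.mem_union_left _ hu)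
    obtain ⟨n', hn'⟩ := hΛ' U S hU hS fun u hu => hS' u (Finset.mem_union_right _ hu)
    exact ⟨n + n', by rw [hn, hn']; simp [add_smul, Finset.sum_add_distrib]⟩

theorem exists_eq_sum_simplices (y : PolytopeGroup W) (Λ : Finset W) :
    ∃ S : Finset (Polytope W), (∃ U, IsTriangulation S U) ∧ (∀ u ∈ Λ, ∀ t ∈ S, ConstSign u t.1) ∧
      ∃ n : Polytope W → ℤ, y = ∑ t ∈ S, n t • polytopeClass t := by
  classical
  obtain ⟨Λ', hΛ'⟩ := exists_eq_sum_triangulation y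
  obtain ⟨U, S, hU, hS, hS'⟩ := exists_isTriangulation_univ_constSign (Λ ∪ Λ')
  exact ⟨S, ⟨U, hS⟩, fun u hu => hS' u (Finset.mem_union_left _ hu),
    hΛ' U S hU hS fun u hu => hS' u (Finset.mem_union_right _ hu)⟩

/-- The polytope group is generated by the simplices. -/
theorem mem_of_simplexPolytope_mem {K : AddSubgroup (PolytopeGroup W)}
    (h : ∀ v hv, polytopeClass (simplexPolytope v hv) ∈ K) (y : PolytopeGroup W) : y ∈ K := by
  obtain ⟨S, ⟨U, hS⟩, -, n, rfl⟩ := exists_eq_sum_simplices y ∅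
  refine AddSubgroup.sum_mem _ fun t ht => AddSubgroup.zsmul_mem _ ?_ _
  obtain ⟨v, hv, rfl⟩ := hS.2 t ht
  exact h v hv

variable {b : List W} {hb : Submodule.span ℝ {a | a ∈ b} = ⊤}

theorem germFun_mem_halfRing (y : PolytopeGroup W) : germFun b hb y ∈ halfRing b ⊤ := by
  refine mem_of_simplexPolytope_mem
    (K := (halfRing b ⊤).toAddSubgroup.comap (germFun b hb)) (fun v hv => ?_) y
  change germFun b hb _ ∈ halfRing b ⊤
  rw [germFun_simplexPolytope]
  exact prod_mem fun k _ => halfInd_mem_halfRing trivial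

/-- The germ `v₀ + ε v₁ + ⋯` has positive coordinates in the basis `v`, so it lies in the simplex of
`v`. This provides a test germ for each simplex. -/
theorem lexPos_dualVector_ofFn {v : Fin (Module.finrank ℝ W) → W} (hv : LinearIndependent ℝ v)
    (k : Fin (Module.finrank ℝ W)) (x : List W) : LexPos (dualVector v hv k) (List.ofFn v ++ x) := by
  have h1 : ∀ a ∈ List.ofFn v, 0 ≤ (inner ℝ (dualVector v hv k) a : ℝ) := by
    intro a ha
    obtain ⟨j, rfl⟩ := (List.mem_ofFn' _ _).1 ha
    rw [inner_dualVector_apply]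
    split_ifs <;> norm_num
  have h2 : ∃ a ∈ List.ofFn v, (inner ℝ (dualVector v hv k) a : ℝ) ≠ 0 :=
    ⟨v k, (List.mem_ofFn' _ _).2 ⟨k, rfl⟩, by rw [inner_dualVector_apply]; simp⟩
  rw [lexPos_append_of_exists h2]
  generalize List.ofFn v = l at h1 h2
  induction l with
  | nil => simp at h2
  | cons a l ih =>
    rcases (h1 a (by simp)).lt_or_eq with h | h
    · exact Or.inl h
    · refine Or.inr ⟨h.symm, ih (fun a ha => h1 a (by simp [ha])) ?_⟩
      obtain ⟨a', ha', h'⟩ := h2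
      rcases List.mem_cons.1 ha' with rfl | ha'
      · exact absurd h.symm h'
      · exact ⟨a', ha', h'⟩

/-- The elements of the polytope group are determined by their values on germs. -/
theorem germFun_injective : Function.Injective (germFun (W := W) b hb) := by
  classical
  rw [injective_iff_map_eq_zero]
  intro y hy
  obtain ⟨S, ⟨U, hS⟩, -, n, rfl⟩ := exists_eq_sum_simplices y ∅
  refine Finset.sum_eq_zero fun t ht => ?_
  suffices n t = 0 by rw [this, zero_smul]
  obtain ⟨v, hv, htv⟩ := hS.2 t ht
  -- The germ of the vertices of `t` lies in `t` and in no other simplex of the triangulation, so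
  -- evaluation there returns the coefficient `n t`.
  have hx := span_append_right hb (List.ofFn fun i => (v i : W))
  have h1 : InGerm (List.ofFn (fun i => (v i : W)) ++ b) t.1 := by
    rw [htv]
    exact eventually_mem_of_lexPos (hv := hv) fun k => lexPos_dualVector_ofFn hv k b
  have h2 := congrFun hy (List.ofFn fun i => (v i : W))
  rw [germFun_apply, map_sum, Finset.sum_eq_single t] at h2
  · rw [map_zsmul, germEval_polytopeClass, if_pos h1] at h2
    simpa using h2
  · intro t' ht' hne
    rw [map_zsmul, germEval_polytopeClass, if_neg, smul_zero]
    exact fun h' => hne (eq_of_inGerm hx (fun hne => hS.1.2.2 ht' ht hne) h' h1)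
  · exact fun h => absurd ht h

/-- Write `y` on a triangulation that does not cross the hyperplane of `u` and keep the simplices on
its nonnegative side. So the image of `germFun` is stable under multiplication by half spaces. -/
theorem exists_germFun_eq_halfInd_mul (u : W) (y : PolytopeGroup W) :
    ∃ z, germFun b hb z = halfInd b u * germFun b hb y := by
  classical
  by_cases hu : u = 0
  · refine ⟨0, ?_⟩
    have : halfInd b u = 0 := funext fun x => by simp [halfInd, hu, not_lexPos_zero]
    rw [this, map_zero, zero_mul]
  obtain ⟨S, ⟨U, hS⟩, hΛ, n, rfl⟩ := exists_eq_sum_simplices y {u}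
  refine ⟨∑ t ∈ S, (if ∀ p ∈ t.1, 0 ≤ (inner ℝ u (p : W) : ℝ) then n t else 0) • polytopeClass t, ?_⟩
  rw [map_sum, map_sum, Finset.mul_sum]
  refine Finset.sum_congr rfl fun t ht => ?_
  rw [map_zsmul, map_zsmul, mul_smul_comm]
  obtain ⟨v, hv, htv⟩ := hS.2 t ht
  -- the functional is a combination of the dual vectors
  have hpos : ∀ u : W, u ≠ 0 → (∀ p ∈ t.1, 0 ≤ (inner ℝ u (p : W) : ℝ)) → ∀ x,
      InGerm (x ++ b) t.1 → LexPos u (x ++ b) := by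
    intro u hu h x hx
    have hb' := span_append_right hb x
    by_contra hn
    rw [htv] at hx
    have h1 := (inGerm_sphericalHull_iff hb' (hv := hv)).1 hx
    obtain ⟨ε, h2, h3⟩ := ((Filter.Eventually.and hx
      (eventually_neg_of_not_lexPos hu hb' hn))).exists
    rcases h2 with h2 | ⟨p, hp, r, hr, h2⟩
    · rw [h2, inner_zero_right] at h3; exact lt_irrefl _ h3
    · rw [h2, inner_smul_right] at h3
      have := mul_nonneg hr.le (h p (by rw [htv]; exact hp))
      linarith
  funext x
  have hb' := span_append_right hb x
  simp only [Pi.smul_apply, Pi.mul_apply, germFun_apply, germEval_polytopeClass]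
  by_cases hx : InGerm (x ++ b) t.1
  · rw [if_pos hx]
    by_cases h : ∀ p ∈ t.1, 0 ≤ (inner ℝ u (p : W) : ℝ)
    · rw [if_pos h]
      simp [halfInd, hpos u hu h x hx]
    · have h' := (hΛ u (by simp) t ht).resolve_left h
      have h1 := hpos (-u) (neg_ne_zero.2 hu) (fun p hp => by simpa using h' p hp) x hx
      have h2 : ¬ LexPos u (x ++ b) := fun h2 => not_lexPos_neg h2 h1
      rw [if_neg h]
      simp [halfInd, h2]
  · simp [hx]

end Triangulations

/-! ### Alternating sums of a simplex and coefficients of an apartment. -/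

section Flags

variable {W : Type*} [NormedAddCommGroup W] [InnerProductSpace ℝ W]

open Classical in
theorem halfInd_cons (b : List W) {u a : W} (h : inner ℝ u a ≠ 0) (x : List W) :
    halfInd b u (a :: x) = if 0 < (inner ℝ u a : ℝ) then 1 else 0 := by
  unfold halfInd
  simp only [List.cons_append, LexPos, h, false_and, or_false]

theorem halfInd_append_of_orthogonal (b : List W) {u : W} {c : List W}
    (h : ∀ a ∈ c, inner ℝ u a = 0) (x : List W) : halfInd b u (c ++ x) = halfInd b u x :=
  halfInd_congr (by rw [List.append_assoc, lexPos_append_of_orthogonal h])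

/-- The first vector on which `u k` is nonzero is `e k`, so the `k`-th factor depends only on the
sign chosen for `e k`. The sum factors, and each factor contributes the difference of its two
values. -/
theorem altSum_prod_halfInd (b : List W) {n : ℕ} (u e : Fin n → W)
    (h : ∀ k j, j < k → inner ℝ (u k) (e j) = 0) (h' : ∀ k, inner ℝ (u k) (e k) ≠ 0) :
    altSum (fun x => ∏ k, halfInd b (u k) x) (List.ofFn e) =
      ∏ k, (SignType.sign (inner ℝ (u k) (e k) : ℝ) : ℤ) := by
  induction n with
  | zero => simp [altSum]
  | succ n ih =>
    have h1 : ∀ s : ℝ, s ≠ 0 → (fun x => ∏ k, halfInd b (u k) ((s • e 0) :: x)) =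
        fun x => (if 0 < s * inner ℝ (u 0) (e 0) then 1 else 0) *
          ∏ k : Fin n, halfInd b (u k.succ) x := by
      intro s hs
      funext x
      rw [Fin.prod_univ_succ, halfInd_cons b (by
        rw [inner_smul_right]; exact mul_ne_zero hs (h' 0)), inner_smul_right]
      congr 1
      refine Finset.prod_congr rfl fun k _ => ?_
      refine halfInd_append_of_orthogonal b (c := [s • e 0]) (fun a ha => ?_) x
      rw [List.mem_singleton.1 ha, inner_smul_right, h _ _ (Fin.succ_pos k), mul_zero]
    have h2 := h1 1 one_ne_zero
    have h3 := h1 (-1) (by norm_num)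
    simp only [one_smul, neg_smul, one_mul, neg_mul] at h2 h3
    rw [List.ofFn_succ, altSum, h2, h3, altSum_mul_left, altSum_mul_left,
      ih (fun k => u k.succ) (fun k => e k.succ) (fun k j hkj => h _ _ (Fin.succ_lt_succ_iff.2 hkj))
        (fun k => h' _), Fin.prod_univ_succ, ← sub_mul]
    congr 1
    rcases (h' 0).lt_or_gt with h0 | h0
    · rw [if_neg h0.not_gt, if_pos (by linarith), sign_neg h0]; rfl
    · rw [if_pos h0, if_neg (by linarith), sign_pos h0]; rfl

/-- In a nonzero alternating sum the sign of `e m` must matter to some factor; that functional has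
`e m` as the first vector on which it does not vanish. -/
theorem exists_pivot_of_altSum_ne_zero (b : List W) {ι : Type*} [Fintype ι] (u : ι → W) {n : ℕ}
    (e : Fin n → W) (c : List W)
    (h : altSum (fun x => ∏ k, halfInd b (u k) (c ++ x)) (List.ofFn e) ≠ 0) (m : Fin n) :
    ∃ k, (∀ p ∈ c, inner ℝ (u k) p = 0) ∧ (∀ j < m, inner ℝ (u k) (e j) = 0) ∧
      inner ℝ (u k) (e m) ≠ 0 := by
  induction n generalizing c with
  | zero => exact m.elim0
  | succ n ih =>
    rw [List.ofFn_succ] at h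
    induction m using Fin.cases with
    | zero =>
      by_contra! hcon
      refine h (altSum_eq_zero_of_flip fun x => Finset.prod_congr rfl fun k _ => ?_)
      refine halfInd_congr ?_
      simp only [List.append_assoc]
      by_cases hc : ∀ p ∈ c, inner ℝ (u k) p = 0
      · have := hcon k hc (fun j hj => absurd hj (Fin.not_lt_zero j))
        rw [lexPos_append_of_orthogonal hc, lexPos_append_of_orthogonal hc]
        simp [LexPos, this]
      · push Not at hc
        rw [lexPos_append_of_exists hc, lexPos_append_of_exists hc]
    | succ m =>
      have key : ∀ a, (a = e 0 ∨ a = -e 0) →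
          altSum (fun x => ∏ k, halfInd b (u k) (c ++ a :: x)) (List.ofFn fun i => e i.succ) ≠ 0 →
          ∃ k, (∀ p ∈ c, inner ℝ (u k) p = 0) ∧ (∀ j < m.succ, inner ℝ (u k) (e j) = 0) ∧
            inner ℝ (u k) (e m.succ) ≠ 0 := by
        intro a ha hne
        obtain ⟨k, h1, h2, h3⟩ := ih (fun i => e i.succ) (c ++ [a]) (by simpa using hne) m
        refine ⟨k, fun p hp => h1 p (by simp [hp]), fun j hj => ?_, h3⟩
        induction j using Fin.cases with
        | zero =>
          have := h1 a (by simp)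
          rcases ha with rfl | rfl
          · exact this
          · simpa using this
        | succ j => exact h2 j (Fin.succ_lt_succ_iff.1 hj)
      by_cases h1 : altSum (fun x => ∏ k, halfInd b (u k) (c ++ e 0 :: x))
          (List.ofFn fun i => e i.succ) = 0
      · refine key (-e 0) (Or.inr rfl) fun h2 => h ?_
        simp only [altSum, h1, h2, sub_self]
      · exact key _ (Or.inl rfl) h1

theorem linearIndependent_of_notMem_span {n : ℕ} {e : Fin n → W}
    (h : ∀ j, e j ∉ Submodule.span ℝ (e '' {a | a < j})) : LinearIndependent ℝ e := by
  induction n with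
  | zero => exact linearIndependent_empty_type
  | succ n ih =>
    rw [linearIndependent_finSucc']
    constructor
    · refine ih fun j hj => h j.castSucc (Submodule.span_mono ?_ hj)
      rintro _ ⟨a, ha, rfl⟩
      exact ⟨a.castSucc, by simpa using ha, rfl⟩
    · refine fun hj => h (Fin.last n) (Submodule.span_mono ?_ hj)
      rintro _ ⟨a, rfl⟩
      exact ⟨a.castSucc, by simp [Fin.castSucc_lt_last], rfl⟩

variable [FiniteDimensional ℝ W]

theorem eq_of_strictMono {n : ℕ} {f : Fin (n + 1) → ℕ} (hf : StrictMono f) (hl : f (Fin.last n) ≤ n)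
    (j : Fin (n + 1)) : f j = j := by
  have h1 : ∀ j : Fin (n + 1), (j : ℕ) ≤ f j := fun j => by
    induction j using Fin.induction with
    | zero => simp
    | succ j ih =>
      have := hf j.castSucc_lt_succ
      simp only [Fin.val_castSucc, Fin.val_succ] at *
      omega
  have h2 : ∀ j : Fin (n + 1), f j ≤ j := fun j => by
    induction j using Fin.reverseInduction with
    | last => simpa using hl
    | cast j ih =>
      have := hf j.castSucc_lt_succ
      simp only [Fin.val_castSucc, Fin.val_succ] at *
      omega
  exact le_antisymm (h2 j) (h1 j)

theorem SubspaceChain.finrank_eq (F : SubspaceChain W (Module.finrank ℝ W))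
    (j : Fin (Module.finrank ℝ W + 1)) : Module.finrank ℝ (F.1 j) = j :=
  eq_of_strictMono (f := fun j => Module.finrank ℝ (F.1 j))
    (fun _ _ h => Submodule.finrank_lt_finrank_of_lt (F.2.1 h)) (by rw [F.2.2.2, finrank_top]) j

theorem SubspaceChain.ext_of_le {F G : SubspaceChain W (Module.finrank ℝ W)}
    (h : ∀ j, F.1 j ≤ G.1 j) : F = G :=
  Subtype.ext (funext fun j => Submodule.eq_of_le_of_finrank_eq (h j) (by
    rw [F.finrank_eq, G.finrank_eq]))

/-- Complete flags are given by bases. -/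
theorem exists_basisFlag_eq (F : SubspaceChain W (Module.finrank ℝ W)) :
    ∃ (e : Fin (Module.finrank ℝ W) → W) (he : LinearIndependent ℝ e),
      basisFlag e he (he.span_eq_top_of_card_eq_finrank' (by simp)) = F := by
  have hex : ∀ j : Fin (Module.finrank ℝ W), ∃ a ∈ F.1 j.succ, a ∉ F.1 j.castSucc := fun j =>
    SetLike.exists_of_lt (F.2.1 j.castSucc_lt_succ)
  choose e he1 he2 using hex
  have hsub : ∀ j : Fin (Module.finrank ℝ W + 1),
      Submodule.span ℝ (e '' {a | a.castSucc < j}) ≤ F.1 j := by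
    intro j
    rw [Submodule.span_le]
    rintro _ ⟨a, ha, rfl⟩
    exact F.2.1.monotone (Fin.castSucc_lt_iff_succ_le.1 ha) (he1 a)
  have he : LinearIndependent ℝ e := linearIndependent_of_notMem_span fun j hj =>
    he2 j (hsub j.castSucc (by simpa using hj))
  exact ⟨e, he, SubspaceChain.ext_of_le hsub⟩

section

variable {v e : Fin (Module.finrank ℝ W) → W} {hv : LinearIndependent ℝ v}
  {he : LinearIndependent ℝ e}

/-- The matrix of `e` with respect to `v ∘ σ` is upper triangular. -/
def IsTriangular (v e : Fin (Module.finrank ℝ W) → W) (hv : LinearIndependent ℝ v)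
    (σ : Equiv.Perm (Fin (Module.finrank ℝ W))) : Prop :=
  (∀ k j, j < k → inner ℝ (dualVector v hv (σ k)) (e j) = 0) ∧
    ∀ k, inner ℝ (dualVector v hv (σ k)) (e k) ≠ 0

theorem mem_span_of_inner_dualVector_eq_zero {σ : Equiv.Perm (Fin (Module.finrank ℝ W))}
    {s : Set (Fin (Module.finrank ℝ W))} {a : W}
    (h : ∀ k ∉ s, inner ℝ (dualVector v hv (σ k)) a = 0) :
    a ∈ Submodule.span ℝ ((v ∘ σ) '' s) := by
  rw [← sum_inner_dualVector (hv := hv) a, ← Equiv.sum_comp σ]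
  refine Submodule.sum_mem _ fun k _ => ?_
  by_cases hk : k ∈ s
  · exact Submodule.smul_mem _ _ (Submodule.subset_span ⟨k, hk, rfl⟩)
  · rw [h k hk, zero_smul]
    exact Submodule.zero_mem _

theorem inner_dualVector_eq_zero_of_mem_span {σ : Equiv.Perm (Fin (Module.finrank ℝ W))}
    {s : Set (Fin (Module.finrank ℝ W))} {a : W}
    (ha : a ∈ Submodule.span ℝ ((v ∘ σ) '' s)) {k : Fin (Module.finrank ℝ W)} (hk : k ∉ s) :
    inner ℝ (dualVector v hv (σ k)) a = 0 := by
  induction ha using Submodule.span_induction with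
  | mem a ha =>
    obtain ⟨j, hj, rfl⟩ := ha
    rw [Function.comp_apply, inner_dualVector_apply, if_neg]
    exact fun h => hk (σ.injective h ▸ hj)
  | zero => simp
  | add a b _ _ ha hb => rw [inner_add_right, ha, hb, add_zero]
  | smul r a _ ha => rw [inner_smul_right, ha, mul_zero]

/-- The flags agree when each `e j` lies in the span of the first `j + 1` vectors of `v ∘ σ`, and
the dual vectors read off these coordinates. A zero on the diagonal would put `e k` into the span of
its predecessors. Containment in one direction suffices because the dimensions agree. -/
theorem basisFlag_eq_iff_isTriangular (σ : Equiv.Perm (Fin (Module.finrank ℝ W)))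
    (hs : Submodule.span ℝ (range e) = ⊤) (hs' : Submodule.span ℝ (range (v ∘ σ)) = ⊤) :
    basisFlag e he hs = basisFlag (v ∘ σ) (hv.comp σ σ.injective) hs' ↔ IsTriangular v e hv σ := by
  constructor
  · intro h
    have hmem : ∀ j, e j ∈ Submodule.span ℝ ((v ∘ σ) '' {a | a.castSucc < j.succ}) := by
      intro j
      have h1 : e j ∈ (basisFlag e he hs).1 j.succ :=
        Submodule.subset_span ⟨j, j.castSucc_lt_succ, rfl⟩
      rw [h] at h1
      exact h1
    have h1 : ∀ k j, j < k → inner ℝ (dualVector v hv (σ k)) (e j) = 0 := fun k j hjk =>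
      inner_dualVector_eq_zero_of_mem_span (hmem j) (by
        simp only [mem_ofPred_eq, not_lt]
        exact Fin.succ_le_castSucc_iff.2 hjk)
    refine ⟨h1, fun k hk => ?_⟩
    have h2 : e k ∈ (basisFlag (v ∘ σ) (hv.comp σ σ.injective) hs').1 k.castSucc := by
      refine mem_span_of_inner_dualVector_eq_zero (hv := hv) fun m hm => ?_
      simp only [mem_ofPred_eq, not_lt, Fin.castSucc_le_castSucc_iff] at hm
      rcases hm.eq_or_lt with rfl | hm
      · exact hk
      · exact h1 m k hm
    rw [← h] at h2
    exact he.notMem_span_image (s := {a | a.castSucc < k.castSucc}) (by simp) h2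
  · rintro ⟨h1, -⟩
    refine SubspaceChain.ext_of_le fun j => ?_
    refine Submodule.span_le.2 ?_
    rintro _ ⟨a, ha, rfl⟩
    refine mem_span_of_inner_dualVector_eq_zero (hv := hv) fun k hk => h1 k a ?_
    simp only [mem_ofPred_eq, not_lt] at ha hk
    exact Fin.castSucc_lt_castSucc_iff.1 (lt_of_lt_of_le ha hk)

/-- Different orderings of a basis give different flags, so no coefficients of an apartment merge.
-/
theorem IsTriangular.eq_of_comp {σ τ : Equiv.Perm (Fin (Module.finrank ℝ W))}
    (h : IsTriangular v (v ∘ τ) hv σ) : σ = τ := by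
  ext k
  have := h.2 k
  rw [Function.comp_apply, inner_dualVector_apply] at this
  have h2 : τ k = σ k := by
    by_contra hne
    exact this (if_neg hne)
  rw [h2]

theorem IsTriangular.det_eq {σ : Equiv.Perm (Fin (Module.finrank ℝ W))}
    (h : IsTriangular v e hv σ) (B : Module.Basis (Fin (Module.finrank ℝ W)) ℝ W) :
    B.det e = Equiv.Perm.sign σ * B.det v * ∏ k, inner ℝ (dualVector v hv (σ k)) (e k) := by
  set B' := (basisOf v hv).reindex σ.symm with hB'
  have hB'v : ⇑B' = v ∘ σ := by
    funext k
    simp [hB', basisOf_apply]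
  have h1 : B.det e = B.det B' * B'.det e := by
    rw [Module.Basis.det_apply, Module.Basis.det_apply, Module.Basis.det_apply, ← Matrix.det_mul,
      Module.Basis.toMatrix_mul_toMatrix]
  have h2 : B.det B' = Equiv.Perm.sign σ * B.det v := by
    rw [hB'v, AlternatingMap.map_perm, Units.smul_def, zsmul_eq_mul]
  have h3 : ∀ i j, B'.toMatrix e i j = inner ℝ (dualVector v hv (σ i)) (e j) := by
    intro i j
    rw [Module.Basis.toMatrix_apply, hB', Module.Basis.repr_reindex_apply, inner_dualVector]
    simp
  have h4 : B'.det e = ∏ k, inner ℝ (dualVector v hv (σ k)) (e k) := by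
    rw [Module.Basis.det_apply, Matrix.det_of_isUpperTriangular]
    · exact Finset.prod_congr rfl fun k _ => h3 k k
    · intro i j hij
      rw [h3]
      exact h.1 i j hij
  rw [h1, h2, h4]

theorem exists_isTriangular_of_altSum_ne_zero (b : List W)
    (h : altSum (∏ k, halfInd b (dualVector v hv k)) (List.ofFn e) ≠ 0) :
    ∃ σ, IsTriangular v e hv σ := by
  have h1 := exists_pivot_of_altSum_ne_zero b (dualVector v hv) e [] (by
    have : (∏ k, halfInd b (dualVector v hv k)) =
        fun x => ∏ k, halfInd b (dualVector v hv k) ([] ++ x) := by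
      funext x; simp
    rwa [this] at h)
  choose τ _ h2 h3 using h1
  -- A functional has only one first vector on which it is nonzero, so distinct `m` have distinct
  -- pivots and the pivots form a permutation.
  have hinj : Function.Injective τ := by
    intro m m' hmm
    by_contra hne
    rcases lt_or_gt_of_ne hne with hlt | hlt
    · exact h3 m (hmm ▸ h2 m' m hlt)
    · exact h3 m' (hmm ▸ h2 m m' hlt)
  exact ⟨Equiv.ofBijective τ (Finite.injective_iff_bijective.1 hinj), fun k j hjk => h2 k j hjk, h3⟩

theorem apartmentChain_apply_of_isTriangular {σ : Equiv.Perm (Fin (Module.finrank ℝ W))}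
    (h : IsTriangular v e hv σ) (hs : Submodule.span ℝ (range e) = ⊤)
    (hs' : Submodule.span ℝ (range v) = ⊤) :
    apartmentChain v hv hs' (basisFlag e he hs) = Equiv.Perm.sign σ := by
  classical
  rw [apartmentChain, Finsupp.finsetSum_apply, Finset.sum_eq_single σ]
  · rw [(basisFlag_eq_iff_isTriangular σ hs (basisFlag_comp_span v hs' σ)).2 h]
    simp
  · intro τ _ hne
    rw [Finsupp.smul_apply, Finsupp.single_apply, if_neg, smul_zero]
    intro heq
    rw [(basisFlag_eq_iff_isTriangular σ hs (basisFlag_comp_span v hs' σ)).2 h,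
      basisFlag_eq_iff_isTriangular (hv := hv)] at heq
    exact hne heq.eq_of_comp.symm
  · simp

theorem apartmentChain_apply_of_not_isTriangular (h : ¬ ∃ σ, IsTriangular v e hv σ)
    (hs : Submodule.span ℝ (range e) = ⊤) (hs' : Submodule.span ℝ (range v) = ⊤) :
    apartmentChain v hv hs' (basisFlag e he hs) = 0 := by
  classical
  rw [apartmentChain, Finsupp.finsetSum_apply, Finset.sum_eq_zero]
  intro τ _
  rw [Finsupp.smul_apply, Finsupp.single_apply, if_neg, smul_zero]
  intro heq
  exact h ⟨τ, (basisFlag_eq_iff_isTriangular τ hs (basisFlag_comp_span v hs' τ)).1 heq.symm⟩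

/-- Both sides vanish unless `e` is triangular with respect to some ordering `σ` of `v`. In that
case the alternating sum is the sign of the product of the diagonal entries, the apartment
coefficient is the sign of `σ`, and by `IsTriangular.det_eq` these two signs account for the ratio
of the orientations of `e` and `v`. -/
theorem sign_det_mul_altSum (b : List W) (B : Module.Basis (Fin (Module.finrank ℝ W)) ℝ W)
    (hs : Submodule.span ℝ (range e) = ⊤) (hs' : Submodule.span ℝ (range v) = ⊤) :
    (SignType.sign (B.det e) : ℤ) *
        altSum (∏ k, halfInd b (dualVector v hv k)) (List.ofFn e) =
      SignType.sign (B.det v) * apartmentChain v hv hs' (basisFlag e he hs) := by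
  by_cases h : ∃ σ, IsTriangular v e hv σ
  · obtain ⟨σ, h⟩ := h
    have h1 := altSum_prod_halfInd b (fun k => dualVector v hv (σ k)) e h.1 h.2
    have h2 : (∏ k, halfInd b (dualVector v hv k)) =
        fun x => ∏ k, halfInd b (dualVector v hv (σ k)) x := by
      rw [← Equiv.prod_comp σ]
      funext x
      simp
    have h3 : (SignType.sign (∏ k, (inner ℝ (dualVector v hv (σ k)) (e k) : ℝ)) : ℤ) =
        ∏ k, (SignType.sign (inner ℝ (dualVector v hv (σ k)) (e k) : ℝ) : ℤ) := by
      classical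
      refine Finset.induction_on Finset.univ (by simp) fun k s hk ih => ?_
      rw [Finset.prod_insert hk, Finset.prod_insert hk, sign_mul, SignType.coe_mul, ih]
    rw [apartmentChain_apply_of_isTriangular h, h2, h1, h.det_eq B, sign_mul, sign_mul, ← h3]
    have h4 : (∏ k, (inner ℝ (dualVector v hv (σ k)) (e k) : ℝ)) ≠ 0 :=
      Finset.prod_ne_zero_iff.2 fun k _ => h.2 k
    have h5 : (SignType.sign (((Equiv.Perm.sign σ : ℤˣ) : ℤ) : ℝ) : ℤ) = Equiv.Perm.sign σ := by
      rcases Int.units_eq_one_or (Equiv.Perm.sign σ) with h | h <;> rw [h] <;> simp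
    rw [SignType.coe_mul, SignType.coe_mul, h5]
    rcases h4.lt_or_gt with h6 | h6
    · rw [sign_neg h6]; simp; ring
    · rw [sign_pos h6]; simp; ring
  · rw [apartmentChain_apply_of_not_isTriangular h]
    have : altSum (∏ k, halfInd b (dualVector v hv k)) (List.ofFn e) = 0 := by
      by_contra h'
      exact h (exists_isTriangular_of_altSum_ne_zero b h')
    rw [this, mul_zero, mul_zero]

end

end Flags

/-! ### Construction of the canonical map from alternating sums. -/

section CanonicalMap

variable {W : Type*} [NormedAddCommGroup W] [InnerProductSpace ℝ W] [FiniteDimensional ℝ W]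

theorem setOf_mem_ofFn {n : ℕ} (e : Fin n → W) : {a | a ∈ List.ofFn e} = range e := by
  ext a
  exact List.mem_ofFn' _ _

theorem exists_span_list_eq (V : Submodule ℝ W) :
    ∃ c : List W, Submodule.span ℝ {a | a ∈ c} = V := by
  refine ⟨List.ofFn fun k => (stdOrthonormalBasis ℝ V k : W), ?_⟩
  rw [setOf_mem_ofFn, show (range fun k => (stdOrthonormalBasis ℝ V k : W)) =
    V.subtype '' range (stdOrthonormalBasis ℝ V) from (range_comp _ _), Submodule.span_image,
    ← (stdOrthonormalBasis ℝ V).coe_toBasis, Module.Basis.span_eq, Submodule.map_top,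
    Submodule.range_subtype]

theorem exists_ofFn_eq {n : ℕ} {e : List W} (h : e.length = n) : ∃ f : Fin n → W, List.ofFn f = e := by
  subst h
  exact ⟨e.get, List.ofFn_get e⟩

theorem isEmpty_subspaceChain : IsEmpty (SubspaceChain W (Module.finrank ℝ W + 1)) := by
  refine ⟨fun F => ?_⟩
  have h1 : ∀ j : Fin (Module.finrank ℝ W + 1 + 1), (j : ℕ) ≤ Module.finrank ℝ (F.1 j) := fun j => by
    induction j using Fin.induction with
    | zero => simp
    | succ j ih =>
      have := Submodule.finrank_lt_finrank_of_lt (F.2.1 j.castSucc_lt_succ)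
      simp only [Fin.val_castSucc, Fin.val_succ] at *
      omega
  have h2 := h1 (Fin.last _)
  have h3 := Submodule.finrank_le (F.1 (Fin.last _))
  simp at h2
  omega

-- A strict chain of subspaces cannot be longer than the dimension, so the top homology is the group
-- of cycles itself.
variable (W) in
theorem chainBoundaries_eq_bot : chainBoundaries W (Module.finrank ℝ W) = ⊥ := by
  have := isEmpty_subspaceChain (W := W)
  rw [chainBoundaries, eq_bot_iff]
  rintro _ ⟨z, rfl⟩
  rw [Subsingleton.elim z 0, map_zero]
  exact AddSubgroup.zero_mem _

theorem steinbergMk_injective : Function.Injective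
    (QuotientAddGroup.mk' ((chainBoundaries W (Module.finrank ℝ W)).addSubgroupOf
      (chainCycles W (Module.finrank ℝ W)))) := by
  rw [injective_iff_map_eq_zero]
  intro z hz
  rw [QuotientAddGroup.mk'_apply, QuotientAddGroup.eq_zero_iff, AddSubgroup.mem_addSubgroupOf,
    chainBoundaries_eq_bot, AddSubgroup.mem_bot] at hz
  exact Subtype.ext hz

variable {b : List W}

theorem polytopeGroup_hom_ext_simplex {A : Type*} [AddCommGroup A] (f g : PolytopeGroup W →+ A)
    (h : ∀ v hv, f (polytopeClass (simplexPolytope v hv)) = g (polytopeClass (simplexPolytope v hv))) :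
    f = g := by
  ext P
  have := mem_of_simplexPolytope_mem (K := (f - g).ker) (fun v hv => by
    rw [AddMonoidHom.mem_ker, AddMonoidHom.sub_apply, h, sub_self]) (polytopeClass P)
  rw [AddMonoidHom.mem_ker, AddMonoidHom.sub_apply, sub_eq_zero] at this
  exact this

/-- The coefficients of the canonical map. -/
noncomputable def flagCoeff (b : List W) (hb : Submodule.span ℝ {a | a ∈ b} = ⊤)
    (B : Module.Basis (Fin (Module.finrank ℝ W)) ℝ W) (e : Fin (Module.finrank ℝ W) → W) :
    PolytopeGroup W →+ ℤ where
  toFun y := SignType.sign (B.det e) * altSum (germFun b hb y) (List.ofFn e)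
  map_zero' := by
    rw [map_zero]
    exact (congrArg _ (altSum_zero _)).trans (mul_zero _)
  map_add' y z := by
    rw [map_add, ← mul_add]
    exact congrArg _ (altSum_add _ _ _)

/-- The canonical map on the level of chains. -/
theorem exists_canonicalChain (B : Module.Basis (Fin (Module.finrank ℝ W)) ℝ W) :
    ∃ ψ : PolytopeGroup W →+ chainCycles W (Module.finrank ℝ W),
      (∀ (v : Fin (Module.finrank ℝ W) → Metric.sphere (0 : W) 1)
        (hv : LinearIndependent ℝ fun i => (v i : W)),
        ψ (polytopeClass (simplexPolytope v hv)) =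
          (SignType.sign (B.det fun i => (v i : W)) : ℤ) •
            (⟨apartmentChain _ hv (hv.span_eq_top_of_card_eq_finrank' (by simp)),
              apartmentChain_mem_cycles _ hv _⟩ : chainCycles W (Module.finrank ℝ W))) ∧
      ∀ (b : List W) (hb : Submodule.span ℝ {a | a ∈ b} = ⊤) (e : Fin (Module.finrank ℝ W) → W)
        (he : LinearIndependent ℝ e) (y : PolytopeGroup W),
        (ψ y).1 (basisFlag e he (he.span_eq_top_of_card_eq_finrank' (by simp))) =
          SignType.sign (B.det e) * altSum (germFun b hb y) (List.ofFn e) := by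
  obtain ⟨b, hb⟩ := exists_span_list_eq (⊤ : Submodule ℝ W)
  choose e he heF using exists_basisFlag_eq (W := W)
  have hcoeff : ∀ (b : List W) (hb : Submodule.span ℝ {a | a ∈ b} = ⊤)
      (v : Fin (Module.finrank ℝ W) → Metric.sphere (0 : W) 1)
      (hv : LinearIndependent ℝ fun i => (v i : W)) (e : Fin (Module.finrank ℝ W) → W)
      (he : LinearIndependent ℝ e),
      flagCoeff b hb B e (polytopeClass (simplexPolytope v hv)) =
        SignType.sign (B.det fun i => (v i : W)) *
          apartmentChain _ hv (hv.span_eq_top_of_card_eq_finrank' (by simp))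
            (basisFlag e he (he.span_eq_top_of_card_eq_finrank' (by simp))) := by
    intro b hb v hv e he
    change (SignType.sign (B.det e) : ℤ) * altSum (germFun b hb _) (List.ofFn e) = _
    rw [germFun_simplexPolytope]
    exact sign_det_mul_altSum b B _ _
  -- The flag coefficients are additive but are at first only a bare function of the flag. On
  -- simplices they come from an apartment, hence from a finitely supported cycle, and the simplices
  -- generate.
  let Φ : PolytopeGroup W →+ (SubspaceChain W (Module.finrank ℝ W) → ℤ) :=
    AddMonoidHom.mk' (fun y F => flagCoeff b hb B (e F) y) fun y z => funext fun F => map_add _ _ _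
  let κ : chainCycles W (Module.finrank ℝ W) →+ (SubspaceChain W (Module.finrank ℝ W) → ℤ) :=
    AddMonoidHom.mk' (fun z F => z.1 F) fun y z => rfl
  have hκ : Function.Injective κ := fun y z h => Subtype.ext (Finsupp.ext fun F => congrFun h F)
  have hsimp : ∀ v hv, Φ (polytopeClass (simplexPolytope v hv)) =
      κ ((SignType.sign (B.det fun i => (v i : W)) : ℤ) •
            (⟨apartmentChain _ hv (hv.span_eq_top_of_card_eq_finrank' (by simp)),
              apartmentChain_mem_cycles _ hv _⟩ : chainCycles W (Module.finrank ℝ W))) := by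
    intro v hv
    funext F
    rw [map_zsmul]
    change flagCoeff b hb B (e F) _ =
      (SignType.sign (B.det fun i => (v i : W)) : ℤ) • apartmentChain _ hv _ F
    rw [hcoeff b hb v hv (e F) (he F), heF, smul_eq_mul]
  have hrange : ∀ y, Φ y ∈ κ.range := fun y =>
    mem_of_simplexPolytope_mem (K := κ.range.comap Φ)
      (fun v hv => ⟨_, (hsimp v hv).symm⟩) y
  choose ψ hψ using hrange
  let ψ' : PolytopeGroup W →+ chainCycles W (Module.finrank ℝ W) :=
    AddMonoidHom.mk' ψ fun y z => hκ (by rw [hψ, map_add, map_add, hψ, hψ])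
  have h1 : ∀ v hv, ψ' (polytopeClass (simplexPolytope v hv)) =
      (SignType.sign (B.det fun i => (v i : W)) : ℤ) •
            (⟨apartmentChain _ hv (hv.span_eq_top_of_card_eq_finrank' (by simp)),
              apartmentChain_mem_cycles _ hv _⟩ : chainCycles W (Module.finrank ℝ W)) :=
    fun v hv => hκ ((hψ _).trans (hsimp v hv))
  refine ⟨ψ', h1, fun b hb e he y => ?_⟩
  let ev : chainCycles W (Module.finrank ℝ W) →+ ℤ :=
    AddMonoidHom.mk' (fun z => z.1 (basisFlag e he (he.span_eq_top_of_card_eq_finrank' (by simp))))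
      fun y z => rfl
  -- Checking on simplices shows that the formula depends neither on the chosen basis of the flag
  -- nor on the completing list `b`.
  have h2 : ev.comp ψ' = flagCoeff b hb B e := polytopeGroup_hom_ext_simplex _ _ fun v hv => by
    rw [AddMonoidHom.comp_apply, h1, map_zsmul, hcoeff b hb v hv e he]
    rfl
  exact DFunLike.congr_fun h2 y

theorem IsCanonicalMap.eq {B : Module.Basis (Fin (Module.finrank ℝ W)) ℝ W}
    {π π' : PolytopeGroup W →+ SteinbergGroup W} (h : IsCanonicalMap B π)
    (h' : IsCanonicalMap B π') : π = π' :=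
  polytopeGroup_hom_ext_simplex _ _ fun v hv => by rw [h v hv, h' v hv]

end CanonicalMap

/-! ### Suspensions from a subspace form its half space ring. -/

section Suspensions

variable {W : Type*} [NormedAddCommGroup W] [InnerProductSpace ℝ W] [FiniteDimensional ℝ W]
  {b : List W} {V : Submodule ℝ W}

/-- The orthogonal projection to a subspace. -/
noncomputable abbrev proj (V : Submodule ℝ W) : W →ₗ[ℝ] V :=
  LinearMap.adjoint V.subtypeₗᵢ.toLinearMap

theorem inner_proj (u : V) (a : W) : inner ℝ u (proj V a) = (inner ℝ (u : W) a : ℝ) :=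
  LinearMap.adjoint_inner_right _ _ _

theorem lexPos_map_proj (u : V) (x : List W) : LexPos u (x.map (proj V)) ↔ LexPos (u : W) x := by
  induction x with
  | nil => rfl
  | cons a x ih => simp only [List.map_cons, LexPos, inner_proj, ih]

theorem halfInd_map_proj (u : V) (x : List W) :
    halfInd (b.map (proj V)) u (x.map (proj V)) = halfInd b (u : W) x := by
  have := lexPos_map_proj u (x ++ b)
  rw [List.map_append] at this
  unfold halfInd
  split_ifs <;> tauto

theorem germFun_suspensionHom (hb : Submodule.span ℝ {a | a ∈ b} = ⊤) (y : PolytopeGroup V)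
    (x : List W) : germFun b hb (suspensionHom V.subtypeₗᵢ y) x =
      germFun (b.map (proj V)) (span_map_adjoint _ hb) y (x.map (proj V)) := by
  rw [germFun_apply, germEval_suspensionHom, germFun_apply]
  congr 2
  exact List.map_append

theorem germFun_suspensionHom_mem (hb : Submodule.span ℝ {a | a ∈ b} = ⊤) (y : PolytopeGroup V) :
    germFun b hb (suspensionHom V.subtypeₗᵢ y) ∈ halfRing b V := by
  have h1 := germFun_mem_halfRing (hb := span_map_adjoint V.subtypeₗᵢ hb) y
  rw [show germFun b hb (suspensionHom V.subtypeₗᵢ y) = fun x =>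
    germFun (b.map (proj V)) (span_map_adjoint _ hb) y (x.map (proj V)) from
    funext (germFun_suspensionHom hb y)]
  generalize germFun (b.map (proj V)) (span_map_adjoint V.subtypeₗᵢ hb) y = F at h1
  induction h1 using Subring.closure_induction with
  | mem F h =>
    obtain ⟨u, -, rfl⟩ := h
    rw [show (fun x : List W => halfInd (b.map (proj V)) u (x.map (proj V))) = halfInd b (u : W) from
      funext (halfInd_map_proj u)]
    exact halfInd_mem_halfRing u.2
  | zero => exact zero_mem _
  | one => exact one_mem _
  | add f g _ _ hf hg => exact add_mem hf hg
  | neg f _ hf => exact neg_mem hf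
  | mul f g _ _ hf hg => exact mul_mem hf hg

theorem exists_germFun_eq_one (hb : Submodule.span ℝ {a | a ∈ b} = ⊤) :
    ∃ y, germFun b hb y = 1 := by
  classical
  obtain ⟨P, -, hP, -⟩ := exists_isTriangulation_univ W
  refine ⟨polytopeClass P, funext fun x => ?_⟩
  rw [germFun_apply, germEval_polytopeClass, if_pos]
  · rfl
  · refine Filter.Eventually.of_forall fun ε => ?_
    rw [hP]
    by_cases h : germCurve (x ++ b) ε = 0
    · exact Or.inl h
    · exact (toSphere_mem_iff h).1 trivial

/-- The sphere of `V` gives the constant `1`, and cutting polytopes of `V` by a hyperplane of `V`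
multiplies by a generator. Together with `germFun_suspensionHom_mem` this identifies the suspensions
from `V` with `halfRing b V`. -/
theorem exists_suspensionHom_eq (hb : Submodule.span ℝ {a | a ∈ b} = ⊤) {f : List W → ℤ}
    (hf : f ∈ halfRing b V) : ∃ y, germFun b hb (suspensionHom V.subtypeₗᵢ y) = f := by
  -- Stability of the image under multiplication by `f` passes to products, so it can be proved by
  -- induction over the ring.
  suffices h : ∀ y, ∃ z, germFun b hb (suspensionHom V.subtypeₗᵢ z) =
      f * germFun b hb (suspensionHom V.subtypeₗᵢ y) by
    obtain ⟨y, hy⟩ := exists_germFun_eq_one (span_map_adjoint V.subtypeₗᵢ hb)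
    obtain ⟨z, hz⟩ := h y
    refine ⟨z, hz.trans ?_⟩
    funext x
    rw [Pi.mul_apply, germFun_suspensionHom, hy, Pi.one_apply, mul_one]
  induction hf using Subring.closure_induction with
  | mem f hf =>
    obtain ⟨u, hu, rfl⟩ := hf
    intro y
    obtain ⟨z, hz⟩ := exists_germFun_eq_halfInd_mul (hb := span_map_adjoint V.subtypeₗᵢ hb)
      (⟨u, hu⟩ : V) y
    refine ⟨z, funext fun x => ?_⟩
    rw [Pi.mul_apply, germFun_suspensionHom, hz, Pi.mul_apply, germFun_suspensionHom,
      halfInd_map_proj]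
  | zero => exact fun y => ⟨0, by simp⟩
  | one => exact fun y => ⟨y, by simp⟩
  | add f g _ _ hf hg =>
    intro y
    obtain ⟨z, hz⟩ := hf y
    obtain ⟨z', hz'⟩ := hg y
    exact ⟨z + z', by rw [map_add, map_add, hz, hz', add_mul]⟩
  | neg f _ hf =>
    intro y
    obtain ⟨z, hz⟩ := hf y
    exact ⟨-z, by rw [map_neg, map_neg, hz, neg_mul]⟩
  | mul f g _ _ hf hg =>
    intro y
    obtain ⟨z, hz⟩ := hg y
    obtain ⟨z', hz'⟩ := hf z
    exact ⟨z', by rw [hz', hz, mul_assoc]⟩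

/-- If all coefficients of the image of `y` under the canonical map vanish, then `y` is a sum
of suspensions. -/
theorem mem_of_altSum_eq_zero (hb : Submodule.span ℝ {a | a ∈ b} = ⊤) {y : PolytopeGroup W}
    (h : ∀ e : Fin (Module.finrank ℝ W) → W, LinearIndependent ℝ e →
      altSum (germFun b hb y) (List.ofFn e) = 0) {K : AddSubgroup (PolytopeGroup W)}
    (hK : ∀ V : Submodule ℝ W, V < ⊤ → ∀ z, suspensionHom V.subtypeₗᵢ z ∈ K) : y ∈ K := by
  have h1 : germFun b hb y ∈ properHalfSum b ⊤ := by
    refine mem_iSup_of_altSum_eq_zero hb ⊤ (germFun_mem_halfRing y) fun e he hs => ?_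
    rw [finrank_top] at he
    obtain ⟨e, rfl⟩ := exists_ofFn_eq he
    rw [setOf_mem_ofFn] at hs
    exact h e (linearIndependent_of_top_le_span_of_card_eq_finrank hs.ge (by simp))
  obtain ⟨z, hz, hzy⟩ : ∃ z ∈ K, germFun b hb z = germFun b hb y := by
    refine properHalfSum_induction (C := fun f => ∃ z ∈ K, germFun b hb z = f)
      (fun V hV f hf => ?_) ⟨0, K.zero_mem, map_zero _⟩ (fun f g hf hg => ?_) h1
    · obtain ⟨z, hz⟩ := exists_suspensionHom_eq hb hf
      exact ⟨_, hK V hV z, hz⟩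
    · obtain ⟨z, hz, rfl⟩ := hf
      obtain ⟨z', hz', rfl⟩ := hg
      exact ⟨z + z', K.add_mem hz hz', map_add _ _ _⟩
  rwa [← germFun_injective hzy]

end Suspensions

/-! ### Opposite flags and the basis of apartments. -/

section SteinbergBasis

variable {W : Type*} [NormedAddCommGroup W] [InnerProductSpace ℝ W] [FiniteDimensional ℝ W]

theorem SubspaceChain.finrank_eq_of_finrank {n : ℕ} (hn : Module.finrank ℝ W = n)
    (F : SubspaceChain W n) (j : Fin (n + 1)) : Module.finrank ℝ (F.1 j) = j := by
  subst hn
  exact F.finrank_eq j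

/-- The missing dimension shows which member of a complete flag was removed. So different terms of
the boundary of a flag cannot cancel against each other. -/
theorem SubspaceChain.eq_of_erase_eq {k : ℕ} (hn : Module.finrank ℝ W = k + 1)
    {F G : SubspaceChain W (k + 1)} {i j : Fin k} (h : F.erase i = G.erase j) : i = j := by
  have h1 : i.succ.castSucc.succAbove = j.succ.castSucc.succAbove := by
    funext m
    have h2 := congrArg (fun U => Module.finrank ℝ (U.1 m)) h
    have e1 := F.finrank_eq_of_finrank hn (i.succ.castSucc.succAbove m)
    have e2 := G.finrank_eq_of_finrank hn (j.succ.castSucc.succAbove m)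
    exact Fin.ext (e1.symm.trans (h2.trans e2))
  exact Fin.succ_injective _ (Fin.castSucc_injective _ (Fin.succAbove_left_injective h1))

theorem SubspaceChain.apply_eq_of_erase_eq {k : ℕ} {F G : SubspaceChain W (k + 1)} {i : Fin k}
    (h : F.erase i = G.erase i) {j : Fin (k + 1 + 1)} (hj : j ≠ i.succ.castSucc) : F.1 j = G.1 j := by
  obtain ⟨m, rfl⟩ := Fin.exists_succAbove_eq hj
  exact congrArg (fun U => U.1 m) h

open Classical in
/-- The coefficients of a cycle add up to zero over all complete flags that differ only in one
place. -/
theorem sum_panel_eq_zero {k : ℕ} (hn : Module.finrank ℝ W = k + 1) {z : ChainGroup W (k + 1)}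
    (hz : chainBoundary W k z = 0) (F : SubspaceChain W (k + 1)) (i : Fin k) :
    ∑ G ∈ z.support.filter fun G => G.erase i = F.erase i, z G = 0 := by
  have h1 := congrArg (fun c : ChainGroup W k => c (F.erase i)) hz
  simp only [chainBoundary, Finsupp.liftAddHom_apply, Finsupp.sum, AddMonoidHom.finsetSum_apply,
    Finsupp.finsetSum_apply, Finsupp.coe_zero, Pi.zero_apply, AddMonoidHom.smul_apply,
    Finsupp.smul_apply, Finsupp.singleAddHom_apply, Finsupp.single_apply] at h1
  have h2 : ∀ G ∈ z.support, ∑ j : Fin k, (-1 : ℤ) ^ (j : ℕ) • (if G.erase j = F.erase i then z G else 0) =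
      (-1 : ℤ) ^ (i : ℕ) * (if G.erase i = F.erase i then z G else 0) := by
    intro G _
    rw [Finset.sum_eq_single i]
    · rfl
    · intro j _ hj
      rw [if_neg fun h => hj (SubspaceChain.eq_of_erase_eq hn h), smul_zero]
    · simp
  rw [Finset.sum_congr rfl h2, ← Finset.mul_sum] at h1
  rw [Finset.sum_filter]
  exact (mul_eq_zero.1 h1).resolve_left (pow_ne_zero _ (by norm_num))

/-- Two complete flags are opposite. -/
def IsOpposite {n : ℕ} (F₀ F : SubspaceChain W n) : Prop :=
  ∀ i j : Fin (n + 1), (i : ℕ) + j = n → F.1 i ⊓ F₀.1 j = ⊥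

/-- A cycle that vanishes on all flags opposite to a given one is zero. -/
theorem eq_zero_of_isOpposite {n : ℕ} (hn : Module.finrank ℝ W = n) (F₀ : SubspaceChain W n)
    {z : ChainGroup W n} (hz : z ∈ chainCycles W n) (h : ∀ F, IsOpposite F₀ F → z F = 0) :
    z = 0 := by
  classical
  by_contra hne
  -- The number of nonzero intersections measures how far `F` is from being opposite to `F₀`; the
  -- argument takes a flag in the support of `z` for which it is smallest.
  let t : SubspaceChain W n → Finset (Fin (n + 1) × Fin (n + 1)) := fun F =>
    Finset.univ.filter fun p => F.1 p.1 ⊓ F₀.1 p.2 ≠ ⊥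
  have memt : ∀ F i j, (i, j) ∈ t F ↔ F.1 i ⊓ F₀.1 j ≠ ⊥ := fun F i j => by simp [t]
  obtain ⟨F, hF, hmin⟩ := Finset.exists_min_image z.support (fun F => (t F).card)
    (Finsupp.support_nonempty_iff.2 hne)
  have hzF : z F ≠ 0 := Finsupp.mem_support_iff.1 hF
  have hnop : ¬ IsOpposite F₀ F := fun ho => hzF (h F ho)
  -- a pair that shows that the flags are not opposite
  have hex : ∃ j : ℕ, ∃ (i j' : Fin (n + 1)), (j' : ℕ) = j ∧ (i : ℕ) + j' = n ∧
      F.1 i ⊓ F₀.1 j' ≠ ⊥ := by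
    by_contra! hcon
    exact hnop fun i j hij => hcon j i j rfl hij
  obtain ⟨i, j, hj, hij, hFij⟩ := Nat.find_spec hex
  have hjmin : ∀ i' j' : Fin (n + 1), (i' : ℕ) + j' = n → j' < j → F.1 i' ⊓ F₀.1 j' = ⊥ := by
    intro i' j' h1 h2
    by_contra h3
    exact Nat.find_min hex (m := j') (by rw [← hj]; exact h2) ⟨i', j', rfl, h1, h3⟩
  clear hj
  -- For the smallest bad `j`, the index `k` is the first one at which `F` meets `F₀.1 j`. The
  -- contradiction comes from varying only the member `F.1 k`.
  have hexk : ∃ k : ℕ, ∃ k' : Fin (n + 1), (k' : ℕ) = k ∧ F.1 k' ⊓ F₀.1 j ≠ ⊥ := ⟨i, i, rfl, hFij⟩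
  obtain ⟨k, hk, hFkj⟩ := Nat.find_spec hexk
  have hki : k ≤ i := by
    have := Nat.find_min' hexk ⟨i, rfl, hFij⟩
    rw [← hk] at this
    exact this
  have hkmin : ∀ k' : Fin (n + 1), k' < k → F.1 k' ⊓ F₀.1 j = ⊥ := by
    intro k' h2
    by_contra h3
    exact Nat.find_min hexk (m := k') (by rw [← hk]; exact h2) ⟨k', rfl, h3⟩
  clear hk
  have hk0 : (k : ℕ) ≠ 0 := by
    intro h0
    have : k = 0 := Fin.ext h0
    rw [this, F.2.2.1, bot_inf_eq] at hFkj
    exact hFkj rfl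
  have hj0 : (j : ℕ) ≠ 0 := by
    intro h0
    have : j = 0 := Fin.ext h0
    rw [this, F₀.2.2.1, inf_bot_eq] at hFkj
    exact hFkj rfl
  have hki' : (k : ℕ) ≤ i := hki
  obtain ⟨m, rfl⟩ : ∃ m, n = m + 1 := ⟨n - 1, by omega⟩
  have hz' : chainBoundary W m z = 0 := hz
  -- `erase p` removes the member with index `p + 1`. It is an intermediate one because `0 < k ≤ i =
  -- n - j < n`.
  let p : Fin m := ⟨k - 1, by omega⟩
  have hpk : p.succ.castSucc = k := Fin.ext (by simp [p]; omega)
  let kp : Fin (m + 1 + 1) := ⟨k + 1, by omega⟩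
  let km : Fin (m + 1 + 1) := ⟨k - 1, by omega⟩
  let ip : Fin (m + 1 + 1) := ⟨i + 1, by omega⟩
  let jm : Fin (m + 1 + 1) := ⟨j - 1, by omega⟩
  have hkp : k < kp := Fin.lt_def.2 (by simp [kp])
  have hkm : km < k := Fin.lt_def.2 (by change (k : ℕ) - 1 < k; omega)
  have hdim := fun (G : SubspaceChain W (m + 1)) l => G.finrank_eq_of_finrank hn l
  -- By the minimality of `j` the space `F.1 (i + 1)`, which contains `F.1 (k + 1)`, meets `F₀.1 (j
  -- - 1)` trivially, and this has codimension one in `F₀.1 j`.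
  have hline : Module.finrank ℝ (F.1 kp ⊓ F₀.1 j : Submodule ℝ W) ≤ 1 := by
    have h1 : F.1 ip ⊓ F₀.1 jm = ⊥ := hjmin ip jm
      (by change (i : ℕ) + 1 + ((j : ℕ) - 1) = m + 1; omega)
      (Fin.lt_def.2 (by change (j : ℕ) - 1 < j; omega))
    have h2 : F.1 kp ≤ F.1 ip := F.2.1.monotone (Fin.le_def.2 (by change (k : ℕ) + 1 ≤ i + 1; omega))
    have h3 : F₀.1 jm ≤ F₀.1 j := F₀.2.1.monotone (Fin.le_def.2 (by change (j : ℕ) - 1 ≤ j; omega))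
    have h4 : (F.1 kp ⊓ F₀.1 j) ⊓ F₀.1 jm = ⊥ := by
      exact eq_bot_iff.2 ((inf_le_inf_right _ (inf_le_left.trans h2)).trans h1.le)
    have h5 := Submodule.finrank_sup_add_finrank_inf_eq (F.1 kp ⊓ F₀.1 j) (F₀.1 jm)
    have h6 := Submodule.finrank_mono (sup_le (inf_le_right : F.1 kp ⊓ F₀.1 j ≤ F₀.1 j) h3)
    have h7 : Module.finrank ℝ (F₀.1 jm) = (j : ℕ) - 1 := hdim F₀ jm
    have h8 := hdim F₀ j
    rw [h4, finrank_bot] at h5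
    omega
  have hline' : ∀ G : SubspaceChain W (m + 1), G.1 kp = F.1 kp → G.1 k ⊓ F₀.1 j ≠ ⊥ →
      G.1 k ⊓ F₀.1 j = F.1 kp ⊓ F₀.1 j := by
    intro G hG hne
    refine Submodule.eq_of_le_of_finrank_le (inf_le_inf_right _ (hG ▸ G.2.1.monotone hkp.le)) ?_
    exact hline.trans (Nat.one_le_iff_ne_zero.2 fun h0 => hne (Submodule.finrank_eq_zero.1 h0))
  -- A flag of the panel that meets `F₀.1 j` at the place `k` must contain that line, which is not
  -- in `F.1 (k - 1)`; so its `k`-th member is determined.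
  have hspan : ∀ G : SubspaceChain W (m + 1), G.1 kp = F.1 kp → G.1 km = F.1 km →
      G.1 k ⊓ F₀.1 j ≠ ⊥ → F.1 km ⊔ (F.1 kp ⊓ F₀.1 j) = G.1 k := by
    intro G hG hG' hne
    rw [← hline' G hG hne, ← hG']
    refine Submodule.eq_of_le_of_finrank_le (sup_le (G.2.1.monotone hkm.le) inf_le_left) ?_
    have h1 : G.1 km < G.1 km ⊔ (G.1 k ⊓ F₀.1 j) := by
      refine lt_of_le_of_ne le_sup_left fun heq => hne ?_
      have h2 : G.1 k ⊓ F₀.1 j ≤ G.1 km := by rw [heq]; exact le_sup_right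
      exact eq_bot_iff.2 ((le_inf (h2.trans hG'.le) inf_le_right).trans (hkmin km hkm).le)
    have h2 := Submodule.finrank_lt_finrank_of_lt h1
    rw [hdim] at h2
    rw [hdim]
    simp only [km] at h2 ⊢
    omega
  -- All other flags of the panel have strictly fewer nonzero intersections with `F₀`, so by
  -- minimality they are not in the support. The panel relation then forces `z F = 0`.
  have hpanel : ∀ G : SubspaceChain W (m + 1), G.erase p = F.erase p → G ≠ F → z G = 0 := by
    intro G hG hne
    have happ : ∀ l, l ≠ k → G.1 l = F.1 l := fun l hl =>
      SubspaceChain.apply_eq_of_erase_eq hG (by rwa [hpk])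
    have h0 : G.1 k ⊓ F₀.1 j = ⊥ := by
      by_contra h0
      refine hne (Subtype.ext (funext fun l => ?_))
      by_cases hl : l = k
      · rw [hl, ← hspan G (happ _ hkp.ne') (happ _ hkm.ne) h0, ← hspan F rfl rfl hFkj]
      · exact happ l hl
    have hlt : t G ⊂ t F := by
      rw [Finset.ssubset_iff_of_subset]
      · refine ⟨(k, j), (memt _ _ _).2 hFkj, fun hmem => (memt _ _ _).1 hmem h0⟩
      · rintro ⟨l, j'⟩ hl
        rw [memt] at hl ⊢
        by_cases hlk : l = k
        · subst hlk
          have hjj : j ≤ j' := by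
            by_contra hlt
            exact hl (eq_bot_iff.2 ((inf_le_inf_left _
              (F₀.2.1.monotone (not_le.1 hlt).le)).trans h0.le))
          intro h1
          exact hFkj (eq_bot_iff.2 ((inf_le_inf_left _ (F₀.2.1.monotone hjj)).trans h1.le))
        · rwa [← happ l hlk]
    by_contra hzG
    have h1 := hmin G (Finsupp.mem_support_iff.2 hzG)
    have h2 := Finset.card_lt_card hlt
    omega
  have hsum := sum_panel_eq_zero hn hz' F p
  rw [Finset.sum_eq_single F] at hsum
  · exact hzF hsum
  · exact fun G hG hne => hpanel G (Finset.mem_filter.1 hG).2 hne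
  · exact fun hF' => absurd (Finset.mem_filter.2 ⟨hF, rfl⟩ : F ∈ z.support.filter fun G => G.erase p = F.erase p) hF'

/-- The apartment spanned by two opposite flags. -/
theorem exists_apartment_of_isOpposite (F₀ F : SubspaceChain W (Module.finrank ℝ W))
    (h : IsOpposite F₀ F) :
    ∃ (a : Fin (Module.finrank ℝ W) → Metric.sphere (0 : W) 1)
      (ha : LinearIndependent ℝ fun i => (a i : W)),
      ∀ G, IsOpposite F₀ G → apartmentChain (fun i => (a i : W)) ha
        (ha.span_eq_top_of_card_eq_finrank' (by simp)) G = Finsupp.single F 1 G := by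
  classical
  -- The two subspaces have dimensions `i + 1` and `n - i`, with sum `n + 1`, so they meet.
  have hex : ∀ i : Fin (Module.finrank ℝ W), ∃ a : Metric.sphere (0 : W) 1,
      (a : W) ∈ F.1 i.succ ⊓ F₀.1 (Fin.rev i.castSucc) := by
    intro i
    have h1 := Submodule.finrank_sup_add_finrank_inf_eq (F.1 i.succ) (F₀.1 (Fin.rev i.castSucc))
    have h2 := Submodule.finrank_le (F.1 i.succ ⊔ F₀.1 (Fin.rev i.castSucc))
    rw [F.finrank_eq, F₀.finrank_eq] at h1
    simp only [Fin.val_succ, Fin.val_rev, Fin.val_castSucc] at h1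
    have h3 : F.1 i.succ ⊓ F₀.1 (Fin.rev i.castSucc) ≠ ⊥ := by
      intro h0
      rw [h0, finrank_bot] at h1
      have := i.2
      omega
    obtain ⟨w, hw, hw0⟩ := (Submodule.ne_bot_iff _).1 h3
    exact ⟨toSphere w hw0, Submodule.smul_mem _ _ hw⟩
  choose a ha1 using hex
  have hsub : ∀ j : Fin (Module.finrank ℝ W + 1),
      Submodule.span ℝ ((fun i => (a i : W)) '' {i | i.castSucc < j}) ≤ F.1 j := by
    intro j
    rw [Submodule.span_le]
    rintro _ ⟨i, hi, rfl⟩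
    exact F.2.1.monotone (Fin.castSucc_lt_iff_succ_le.1 hi) (ha1 i).1
  have hne0 : ∀ i, (a i : W) ≠ 0 := fun i h0 => by
    have := norm_eq_of_mem_sphere (a i)
    rw [h0, norm_zero] at this
    norm_num at this
  have ha : LinearIndependent ℝ fun i => (a i : W) := linearIndependent_of_notMem_span fun j hj => by
    have h1 : (a j : W) ∈ F.1 j.castSucc := hsub j.castSucc (by simpa using hj)
    have h2 : (a j : W) ∈ F.1 j.castSucc ⊓ F₀.1 (Fin.rev j.castSucc) := ⟨h1, (ha1 j).2⟩
    rw [h _ _ (by simp only [Fin.val_castSucc, Fin.val_rev]; omega)] at h2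
    exact hne0 j h2
  have hflag : basisFlag (fun i => (a i : W)) ha
      (ha.span_eq_top_of_card_eq_finrank' (by simp)) = F := SubspaceChain.ext_of_le hsub
  have htri : IsTriangular (fun i => (a i : W)) (fun i => (a i : W)) ha 1 := by
    refine ⟨fun k j hjk => ?_, fun k => ?_⟩
    · rw [inner_dualVector_apply (v := fun i => (a i : W))]
      exact if_neg hjk.ne
    · rw [inner_dualVector_apply (v := fun i => (a i : W))]
      simp
  refine ⟨a, ha, fun G hG => ?_⟩
  by_cases hGF : F = G
  · subst hGF
    rw [Finsupp.single_eq_same]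
    have h1 := apartmentChain_apply_of_isTriangular htri
      (ha.span_eq_top_of_card_eq_finrank' (by simp)) (ha.span_eq_top_of_card_eq_finrank' (by simp))
      (he := ha)
    rw [hflag] at h1
    simpa using h1
  · rw [Finsupp.single_apply, if_neg hGF, apartmentChain, Finsupp.finsetSum_apply]
    refine Finset.sum_eq_zero fun σ _ => ?_
    rw [Finsupp.smul_apply, Finsupp.single_apply, if_neg, smul_zero]
    rintro rfl
    -- If `σ k > k`, then `a (σ k)` lies in `F₀.1 (n - k - 1)` and in the member of dimension `k +
    -- 1` of the reordered flag, which is then not opposite to `F₀`. A permutation with `σ k ≤ k`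
    -- for all `k` is the identity.
    have hle : ∀ k, σ k ≤ k := by
      intro k
      by_contra hlt
      rw [not_le] at hlt
      have h1 : (a (σ k) : W) ∈ (basisFlag ((fun i => (a i : W)) ∘ σ) (ha.comp σ σ.injective)
          (basisFlag_comp_span _ (ha.span_eq_top_of_card_eq_finrank' (by simp)) σ)).1 k.succ :=
        Submodule.subset_span ⟨k, k.castSucc_lt_succ, rfl⟩
      have h2 : (a (σ k) : W) ∈ F₀.1 (Fin.rev k.succ) := by
        refine F₀.2.1.monotone ?_ (ha1 (σ k)).2
        rw [Fin.rev_le_rev]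
        exact Fin.castSucc_lt_iff_succ_le.1 (Fin.castSucc_lt_castSucc_iff.2 hlt)
      have h3 := Submodule.mem_inf.2 ⟨h1, h2⟩
      rw [hG _ _ (by simp only [Fin.val_succ, Fin.val_rev]; omega)] at h3
      exact hne0 _ h3
    have hσ : σ = 1 := by
      ext k
      have : ∀ n, ∀ k : Fin (Module.finrank ℝ W), (k : ℕ) = n → σ k = k := by
        intro n
        induction n using Nat.strong_induction_on with
        | _ n ih =>
          intro k hk
          by_contra hne
          have hlt : σ k < k := lt_of_le_of_ne (hle k) hne
          exact hne (σ.injective (ih (σ k) (by rw [← hk]; exact hlt) (σ k) rfl))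
      rw [this k k rfl]
      rfl
    subst hσ
    exact hGF hflag.symm

variable (W) in
theorem exists_completeFlag : Nonempty (SubspaceChain W (Module.finrank ℝ W)) :=
  ⟨basisFlag _ (Module.finBasis ℝ W).linearIndependent (Module.finBasis ℝ W).span_eq⟩

/-- A cycle is a combination of apartments. -/
theorem cycles_eq_sum_apartments (F₀ : SubspaceChain W (Module.finrank ℝ W)) :
    ∃ A : SubspaceChain W (Module.finrank ℝ W) → chainCycles W (Module.finrank ℝ W),
      (∀ F, IsOpposite F₀ F → ∃ (a : Fin (Module.finrank ℝ W) → Metric.sphere (0 : W) 1)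
        (ha : LinearIndependent ℝ fun i => (a i : W)),
        A F = ⟨apartmentChain _ ha (ha.span_eq_top_of_card_eq_finrank' (by simp)),
          apartmentChain_mem_cycles _ ha _⟩) ∧
      ∀ F, IsOpposite F₀ F → ∀ G, IsOpposite F₀ G → (A F).1 G = Finsupp.single F 1 G := by
  classical
  choose a ha h using exists_apartment_of_isOpposite (W := W) F₀
  refine ⟨fun F => if hF : IsOpposite F₀ F then
    ⟨apartmentChain _ (ha F hF) ((ha F hF).span_eq_top_of_card_eq_finrank' (by simp)),
          apartmentChain_mem_cycles _ (ha F hF) _⟩ else 0, fun F hF => ?_, fun F hF G hG => ?_⟩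
  · exact ⟨a F hF, ha F hF, dif_pos hF⟩
  · simp only [dif_pos hF]
    exact h F hF G hG

theorem cycles_ext_of_isOpposite {F₀ : SubspaceChain W (Module.finrank ℝ W)}
    {y z : chainCycles W (Module.finrank ℝ W)} (h : ∀ F, IsOpposite F₀ F → y.1 F = z.1 F) : y = z := by
  refine Subtype.ext (sub_eq_zero.1 (eq_zero_of_isOpposite rfl F₀
    (AddSubgroup.sub_mem _ y.2 z.2) fun F hF => ?_))
  rw [Finsupp.sub_apply, h F hF, sub_self]

theorem mem_of_apartment_mem {K : AddSubgroup (chainCycles W (Module.finrank ℝ W))}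
    (h : ∀ (a : Fin (Module.finrank ℝ W) → Metric.sphere (0 : W) 1)
        (ha : LinearIndependent ℝ fun i => (a i : W)),
        ⟨apartmentChain _ ha (ha.span_eq_top_of_card_eq_finrank' (by simp)),
          apartmentChain_mem_cycles _ ha _⟩ ∈ K) (z : chainCycles W (Module.finrank ℝ W)) : z ∈ K := by
  classical
  obtain ⟨F₀⟩ := exists_completeFlag W
  obtain ⟨A, hA, hA'⟩ := cycles_eq_sum_apartments F₀
  -- The apartments restrict to delta functions on the flags opposite to `F₀`, so both sides agree
  -- there, and this determines a cycle.
  have hz : z = ∑ F ∈ z.1.support.filter (IsOpposite F₀), z.1 F • A F := by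
    refine cycles_ext_of_isOpposite (F₀ := F₀) fun G hG => ?_
    rw [AddSubgroup.val_finsetSum, Finsupp.finsetSum_apply, Finset.sum_congr rfl fun F hF => by
      rw [AddSubgroup.coe_zsmul, Finsupp.smul_apply, hA' F (Finset.mem_filter.1 hF).2 G hG,
        Finsupp.single_apply, smul_eq_mul, mul_ite, mul_one, mul_zero],
      Finset.sum_ite_eq']
    by_cases hzG : z.1 G = 0
    · simp [hzG]
    · rw [if_pos (Finset.mem_filter.2 ⟨Finsupp.mem_support_iff.2 hzG, hG⟩)]
  rw [hz]
  refine AddSubgroup.sum_mem _ fun F hF => AddSubgroup.zsmul_mem _ ?_ _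
  obtain ⟨a, ha, hAF⟩ := hA F (Finset.mem_filter.1 hF).2
  rw [hAF]
  exact h a ha

-- Restriction to the flags opposite to `F₀` is an isomorphism onto the finitely supported functions
-- on them: cycles are determined there, and apartments give the delta functions.
variable (W) in
theorem free_chainCycles : Module.Free ℤ (chainCycles W (Module.finrank ℝ W)) := by
  classical
  obtain ⟨F₀⟩ := exists_completeFlag W
  obtain ⟨A, -, hA'⟩ := cycles_eq_sum_apartments F₀
  let r : chainCycles W (Module.finrank ℝ W) →+
      ({F : SubspaceChain W (Module.finrank ℝ W) // IsOpposite F₀ F} →₀ ℤ) :=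
    (Finsupp.subtypeDomainAddMonoidHom (p := IsOpposite F₀)).comp (AddSubgroup.subtype _)
  have hr : ∀ z F, r z F = z.1 F.1 := fun z F => rfl
  have hinj : Function.Injective r := fun y z h => cycles_ext_of_isOpposite (F₀ := F₀) fun F hF =>
    DFunLike.congr_fun h ⟨F, hF⟩
  have hsurj : Function.Surjective r := by
    intro g
    refine ⟨∑ F ∈ g.support, g F • A F.1, Finsupp.ext fun G => ?_⟩
    rw [hr, AddSubgroup.val_finsetSum, Finsupp.finsetSum_apply, Finset.sum_congr rfl fun F hF => by
      rw [AddSubgroup.coe_zsmul, Finsupp.smul_apply, hA' F.1 F.2 G.1 G.2,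
        Finsupp.single_apply, smul_eq_mul, mul_ite, mul_one, mul_zero]]
    simp only [Subtype.val_inj, Finset.sum_ite_eq']
    by_cases hgG : g G = 0
    · simp [hgG]
    · rw [if_pos (Finsupp.mem_support_iff.2 hgG)]
  exact Module.Free.of_equiv (AddEquiv.ofBijective r ⟨hinj, hsurj⟩).symm.toIntLinearEquiv

variable (W) in
theorem free_steinbergGroup : Module.Free ℤ (SteinbergGroup W) := by
  have := free_chainCycles W
  exact Module.Free.of_equiv (AddEquiv.ofBijective _
    ⟨steinbergMk_injective (W := W), QuotientAddGroup.mk'_surjective _⟩).toIntLinearEquiv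

end SteinbergBasis

/-! ### Exactness, the colimit as a sum of Steinberg groups, and freeness. -/

section Exactness

variable {W : Type*} [NormedAddCommGroup W] [InnerProductSpace ℝ W] [FiniteDimensional ℝ W]
  {b : List W}

/-- The canonical map on the level of chains, with respect to the orientation given by a basis. -/
noncomputable def canonicalChain (B : Module.Basis (Fin (Module.finrank ℝ W)) ℝ W) :
    PolytopeGroup W →+ chainCycles W (Module.finrank ℝ W) :=
  (exists_canonicalChain B).choose

variable (B : Module.Basis (Fin (Module.finrank ℝ W)) ℝ W)

theorem canonicalChain_simplexPolytope (v : Fin (Module.finrank ℝ W) → Metric.sphere (0 : W) 1)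
    (hv : LinearIndependent ℝ fun i => (v i : W)) :
    canonicalChain B (polytopeClass (simplexPolytope v hv)) =
      (SignType.sign (B.det fun i => (v i : W)) : ℤ) •
        (⟨apartmentChain _ hv (hv.span_eq_top_of_card_eq_finrank' (by simp)),
          apartmentChain_mem_cycles _ hv _⟩ : chainCycles W (Module.finrank ℝ W)) :=
  (exists_canonicalChain B).choose_spec.1 v hv

theorem isUnit_sign_det {e : Fin (Module.finrank ℝ W) → W} (he : LinearIndependent ℝ e) :
    (SignType.sign (B.det e) : ℤ) * SignType.sign (B.det e) = 1 := by
  have h : B.det e ≠ 0 :=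
    (B.is_basis_iff_det |>.1 ⟨he, he.span_eq_top_of_card_eq_finrank' (by simp)⟩).ne_zero
  rcases h.lt_or_gt with h | h
  · simp [sign_neg h]
  · simp [sign_pos h]

theorem canonicalChain_eq_zero_iff (hb : Submodule.span ℝ {a | a ∈ b} = ⊤) {y : PolytopeGroup W} :
    canonicalChain B y = 0 ↔ ∀ e : Fin (Module.finrank ℝ W) → W, LinearIndependent ℝ e →
      altSum (germFun b hb y) (List.ofFn e) = 0 := by
  have hval := (exists_canonicalChain B).choose_spec.2 b hb
  constructor
  · intro h e he
    have h1 := hval e he y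
    rw [show (exists_canonicalChain B).choose y = 0 from h] at h1
    have h2 := congrArg (fun m : ℤ => SignType.sign (B.det e) * m) h1
    simp only [← mul_assoc, isUnit_sign_det B he, one_mul] at h2
    rw [← h2]
    exact mul_zero _
  · intro h
    refine Subtype.ext (Finsupp.ext fun F => ?_)
    obtain ⟨e, he, rfl⟩ := exists_basisFlag_eq F
    refine (hval e he y).trans ?_
    rw [h e he, mul_zero]
    rfl

/-- A nonzero coefficient would give `⊤ ≤ V` by `le_of_altSum_ne_zero`, applied with the empty list
in front. -/
theorem canonicalChain_suspensionHom {V : Submodule ℝ W} (hV : V < ⊤) (z : PolytopeGroup V) :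
    canonicalChain B (suspensionHom V.subtypeₗᵢ z) = 0 := by
  obtain ⟨b, hb⟩ := exists_span_list_eq (⊤ : Submodule ℝ W)
  rw [canonicalChain_eq_zero_iff B hb]
  intro e he
  by_contra hne
  have := le_of_altSum_ne_zero (V := ⊤) (germFun_suspensionHom_mem hb z) (c := [])
    (e := List.ofFn e) (by simp) (by simp) (by simpa using hne)
  exact absurd (top_le_iff.1 this) hV.ne

theorem canonicalChain_surjective : Function.Surjective (canonicalChain B) := fun z =>
  mem_of_apartment_mem (K := (canonicalChain B).range) (fun a ha => by
    refine ⟨(SignType.sign (B.det fun i => (a i : W)) : ℤ) •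
      polytopeClass (simplexPolytope a ha), ?_⟩
    rw [map_zsmul, canonicalChain_simplexPolytope, smul_smul, isUnit_sign_det B ha, one_smul]) z

theorem exists_canonicalChain_section :
    ∃ s : chainCycles W (Module.finrank ℝ W) →+ PolytopeGroup W,
      ∀ z, canonicalChain B (s z) = z := by
  have := free_chainCycles W
  obtain ⟨s, hs⟩ := Module.projective_lifting_property (canonicalChain B).toIntLinearMap
    LinearMap.id (canonicalChain_surjective B)
  exact ⟨s.toAddMonoidHom, fun z => LinearMap.congr_fun hs z⟩

open Classical in
/-- The map from the polytope group of a proper subspace to the colimit. -/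
noncomputable def suspensionColimitOf (V : {V : Submodule ℝ W // V < ⊤}) :
    PolytopeGroup V.1 →+ SuspensionColimit W :=
  AddCommGroup.DirectLimit.of (fun V : {V : Submodule ℝ W // V < ⊤} => PolytopeGroup V.1)
    (fun _ _ h => suspensionHom (inclusionIsometry h)) V

theorem suspensionColimitHom_of (V : {V : Submodule ℝ W // V < ⊤}) (z : PolytopeGroup V.1) :
    suspensionColimitHom W (suspensionColimitOf V z) = suspensionHom V.1.subtypeₗᵢ z := by
  classical
  exact AddCommGroup.DirectLimit.lift_of _ _ _ _ _

theorem suspensionColimitOf_suspensionHom {U V : {V : Submodule ℝ W // V < ⊤}} (h : U ≤ V)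
    (z : PolytopeGroup U.1) : suspensionColimitOf V (suspensionHom (inclusionIsometry h) z) =
      suspensionColimitOf U z := by
  classical
  exact AddCommGroup.DirectLimit.of_f (f := fun (U V : {V : Submodule ℝ W // V < ⊤}) (h : U ≤ V) =>
    suspensionHom (inclusionIsometry h)) h z

theorem suspensionColimit_mem {K : AddSubgroup (SuspensionColimit W)}
    (h : ∀ V z, suspensionColimitOf V z ∈ K) (x : SuspensionColimit W) : x ∈ K := by
  classical
  have h1 : QuotientAddGroup.mk' K = 0 := by
    refine AddCommGroup.DirectLimit.hom_ext _ fun V => AddMonoidHom.ext fun z => ?_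
    exact (QuotientAddGroup.eq_zero_iff _).2 (h V z)
  exact (QuotientAddGroup.eq_zero_iff _).1 (DFunLike.congr_fun h1 x)

theorem canonicalChain_eq_zero_iff_mem_range {y : PolytopeGroup W} :
    canonicalChain B y = 0 ↔ y ∈ (suspensionColimitHom W).range := by
  obtain ⟨b, hb⟩ := exists_span_list_eq (⊤ : Submodule ℝ W)
  constructor
  · intro h
    exact mem_of_altSum_eq_zero hb ((canonicalChain_eq_zero_iff B hb).1 h) fun V hV z =>
      ⟨suspensionColimitOf ⟨V, hV⟩ z, suspensionColimitHom_of _ _⟩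
  · rintro ⟨x, rfl⟩
    exact suspensionColimit_mem (K := ((canonicalChain B).comp (suspensionColimitHom W)).ker)
      (fun V z => by
        rw [AddMonoidHom.mem_ker, AddMonoidHom.comp_apply, suspensionColimitHom_of,
          canonicalChain_suspensionHom B V.2]) x

theorem lexPos_replicate_zero_append {u : W} (n : ℕ) (x : List W) :
    LexPos u (List.replicate n 0 ++ x) ↔ LexPos u x := by
  induction n with
  | zero => rfl
  | succ n ih =>
    rw [List.replicate_succ, List.cons_append]
    simp [LexPos, ih]

/-- The coefficient of a suspension from `V` on a flag of `V`, seen from `W`. -/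
theorem altSum_germFun_suspensionHom (hb : Submodule.span ℝ {a | a ∈ b} = ⊤) {V : Submodule ℝ W}
    {c : List W} (hc : Submodule.span ℝ {a | a ∈ c} = Vᗮ) (y : PolytopeGroup V) (e : List V) :
    altSum (fun x => germFun b hb (suspensionHom V.subtypeₗᵢ y) (c ++ x)) (e.map V.subtype) =
      altSum (germFun (b.map (proj V)) (span_map_adjoint _ hb) y) e := by
  rw [altSum_map]
  refine altSum_congr fun x _ => ?_
  -- The list `c` spans `Vᗮ` and projects to zeros, and leading zeros do not affect the signs of
  -- functionals of `V`.
  have h1 : c.map (proj V) = List.replicate c.length 0 := by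
    rw [List.eq_replicate_iff]
    refine ⟨List.length_map _, fun d hd => ?_⟩
    obtain ⟨a, ha, rfl⟩ := List.mem_map.1 hd
    have haV : a ∈ Vᗮ := hc ▸ Submodule.subset_span ha
    refine ext_inner_left ℝ fun u => ?_
    rw [inner_proj, inner_zero_right]
    exact (Submodule.mem_orthogonal _ _).1 haV _ u.2
  have h2 : (x.map V.subtype).map (proj V) = x := by
    rw [List.map_map]
    conv_rhs => rw [← List.map_id x]
    refine List.map_congr_left fun a _ => ext_inner_left ℝ fun u => ?_
    rw [Function.comp_apply, inner_proj]
    rfl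
  rw [germFun_suspensionHom, List.map_append, h1, h2, germFun_apply, germFun_apply]
  refine DFunLike.congr_fun (germEval_congr _ _ fun u => ?_) y
  rw [List.append_assoc, lexPos_replicate_zero_append]

/-- The coefficient on a flag of the subspace `V`. -/
noncomputable def partialCoeff (hb : Submodule.span ℝ {a | a ∈ b} = ⊤) (c e : List W) :
    PolytopeGroup W →+ ℤ where
  toFun y := altSum (fun x => germFun b hb y (c ++ x)) e
  map_zero' := by
    rw [map_zero]
    exact altSum_zero _
  map_add' y z := by
    rw [map_add]
    exact altSum_add _ _ _

variable (W) in
/-- A section of the canonical map of each proper subspace. -/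
noncomputable def canonicalSection (V : {V : Submodule ℝ W // V < ⊤}) :
    chainCycles V.1 (Module.finrank ℝ V.1) →+ PolytopeGroup V.1 :=
  (exists_canonicalChain_section (Module.finBasis ℝ V.1)).choose

theorem canonicalChain_canonicalSection (V : {V : Submodule ℝ W // V < ⊤})
    (z : chainCycles V.1 (Module.finrank ℝ V.1)) :
    canonicalChain (Module.finBasis ℝ V.1) (canonicalSection W V z) = z :=
  (exists_canonicalChain_section (Module.finBasis ℝ V.1)).choose_spec z

open Classical in
variable (W) in
/-- The colimit as a sum of Steinberg groups. -/
noncomputable def colimitOfSteinberg :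
    (DirectSum {V : Submodule ℝ W // V < ⊤} fun V => chainCycles V.1 (Module.finrank ℝ V.1)) →+
      SuspensionColimit W :=
  DirectSum.toAddMonoid fun V => (suspensionColimitOf V).comp (canonicalSection W V)

/-- By induction on the dimension of `V`: an element of `Pt(V)` differs from the section of its
canonical image by a sum of suspensions from proper subspaces of `V`, and in the colimit these are
classes from smaller subspaces. -/
theorem colimitOfSteinberg_surjective : Function.Surjective (colimitOfSteinberg W) := by
  classical
  suffices h : ∀ n, ∀ V : {V : Submodule ℝ W // V < ⊤}, Module.finrank ℝ V.1 = n → ∀ z,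
      suspensionColimitOf V z ∈ (colimitOfSteinberg W).range from
    fun x => suspensionColimit_mem (K := (colimitOfSteinberg W).range) (fun V z => h _ V rfl z) x
  intro n
  induction n using Nat.strong_induction_on with
  | _ n ih =>
    intro V hV z
    obtain ⟨b, hb⟩ := exists_span_list_eq (⊤ : Submodule ℝ V.1)
    let s := canonicalSection W V (canonicalChain (Module.finBasis ℝ V.1) z)
    have h1 : suspensionColimitOf V s ∈ (colimitOfSteinberg W).range :=
      ⟨DirectSum.of _ V (canonicalChain (Module.finBasis ℝ V.1) z), DirectSum.toAddMonoid_of _ _ _⟩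
    have h2 : canonicalChain (Module.finBasis ℝ V.1) (z - s) = 0 := by
      rw [map_sub, canonicalChain_canonicalSection, sub_self]
    have h3 : z - s ∈ (colimitOfSteinberg W).range.comap (suspensionColimitOf V) := by
      refine mem_of_altSum_eq_zero hb ((canonicalChain_eq_zero_iff _ hb).1 h2) fun U hU y => ?_
      rw [AddSubgroup.mem_comap]
      have hUV : U.map V.1.subtype ≤ V.1 := Submodule.map_subtype_le _ _
      let U' : {V : Submodule ℝ W // V < ⊤} := ⟨U.map V.1.subtype, hUV.trans_lt V.2⟩
      -- The colimit is indexed by subspaces of `W`, whereas `U` is a subspace of `V`; `φ`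
      -- transports it to its image in `W`.
      let φ : U →ₗᵢ[ℝ] U'.1 := ⟨(V.1.subtype.comp U.subtype).codRestrict _ fun u =>
        Submodule.mem_map_of_mem u.2, fun _ => rfl⟩
      have hφ : (inclusionIsometry (show U' ≤ V from hUV)).comp φ = U.subtypeₗᵢ := rfl
      rw [← hφ, suspensionHom_comp, suspensionColimitOf_suspensionHom]
      refine ih _ ?_ U' rfl _
      rw [← hV]
      have h4 : Module.finrank ℝ U'.1 = Module.finrank ℝ U :=
        (Submodule.equivMapOfInjective V.1.subtype V.1.injective_subtype U).finrank_eq.symm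
      rw [h4]
      exact Submodule.finrank_lt hU.ne
    have h5 := AddSubgroup.add_mem _ (AddSubgroup.mem_comap.1 h3) h1
    rwa [← map_add, sub_add_cancel] at h5

/-- For `V` of maximal dimension in the support, germs that begin with vectors spanning `Vᗮ`
annihilate the contribution of every `U` that does not contain `V`, hence of all other `U` in the
support. What remains are the canonical coefficients of the component at `V`. -/
theorem suspensionColimitHom_comp_colimitOfSteinberg_injective :
    Function.Injective ((suspensionColimitHom W).comp (colimitOfSteinberg W)) := by
  classical
  rw [injective_iff_map_eq_zero]
  intro a ha
  by_contra hne
  have hsupp : (DFinsupp.support a).Nonempty := by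
    rw [Finset.nonempty_iff_ne_empty]
    exact fun h => hne (DFinsupp.support_eq_empty.1 h)
  obtain ⟨V, hV, hmax⟩ := Finset.exists_max_image (DFinsupp.support a)
    (fun V => Module.finrank ℝ V.1) hsupp
  obtain ⟨b, hb⟩ := exists_span_list_eq (⊤ : Submodule ℝ W)
  obtain ⟨c, hc⟩ := exists_span_list_eq V.1ᗮ
  have hsum : ∑ U ∈ DFinsupp.support a, suspensionHom U.1.subtypeₗᵢ (canonicalSection W U (a U)) = 0 := by
    rw [← ha]
    conv_rhs => rw [← DirectSum.sum_support_of a]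
    rw [map_sum]
    refine Finset.sum_congr rfl fun U _ => ?_
    rw [AddMonoidHom.comp_apply, colimitOfSteinberg, DirectSum.toAddMonoid_of,
      AddMonoidHom.comp_apply, suspensionColimitHom_of]
  have h1 : canonicalChain (Module.finBasis ℝ V.1) (canonicalSection W V (a V)) = 0 := by
    rw [canonicalChain_eq_zero_iff _ (span_map_adjoint V.1.subtypeₗᵢ hb)]
    intro e _
    have h2 := congrArg (partialCoeff hb c ((List.ofFn e).map V.1.subtype)) hsum
    rw [map_sum, map_zero, Finset.sum_eq_single V] at h2
    · rw [← h2]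
      exact (altSum_germFun_suspensionHom hb hc _ _).symm
    · intro U hU hUV
      by_contra h3
      have h4 := le_of_altSum_ne_zero (germFun_suspensionHom_mem hb _) hc (by simp) h3
      exact hUV (Subtype.ext (Submodule.eq_of_le_of_finrank_le h4 (hmax U hU)).symm)
    · exact fun h => absurd hV h
  rw [canonicalChain_canonicalSection] at h1
  exact (DFinsupp.mem_support_iff.1 hV) h1

variable (W) in
theorem suspensionColimitHom_injective : Function.Injective (suspensionColimitHom W) := by
  rw [injective_iff_map_eq_zero]
  intro x hx
  obtain ⟨a, rfl⟩ := colimitOfSteinberg_surjective x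
  have h1 : a = 0 := suspensionColimitHom_comp_colimitOfSteinberg_injective
    (hx.trans (map_zero _).symm)
  rw [h1, map_zero]

variable (W) in
theorem free_suspensionColimit : Module.Free ℤ (SuspensionColimit W) := by
  classical
  have := fun V : {V : Submodule ℝ W // V < ⊤} => free_chainCycles V.1
  exact Module.Free.of_equiv (AddEquiv.ofBijective (colimitOfSteinberg W)
    ⟨Function.Injective.of_comp (f := suspensionColimitHom W)
      suspensionColimitHom_comp_colimitOfSteinberg_injective,
      colimitOfSteinberg_surjective⟩).toIntLinearEquiv

variable (W) in
theorem free_polytopeGroup : Module.Free ℤ (PolytopeGroup W) := by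
  have := free_chainCycles W
  have := free_suspensionColimit W
  have B := Module.finBasis ℝ W
  obtain ⟨s, hs⟩ := exists_canonicalChain_section B
  refine Module.Free.of_equiv (LinearEquiv.ofBijective
    ((suspensionColimitHom W).toIntLinearMap.coprod s.toIntLinearMap) ⟨?_, ?_⟩)
  · rw [injective_iff_map_eq_zero]
    rintro ⟨x, z⟩ h
    replace h : suspensionColimitHom W x + s z = 0 := h
    have h1 := congrArg (canonicalChain B) h
    rw [map_add, hs, (canonicalChain_eq_zero_iff_mem_range B).2 ⟨x, rfl⟩, zero_add, map_zero] at h1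
    replace h1 : z = 0 := h1
    subst h1
    rw [map_zero, add_zero] at h
    rw [suspensionColimitHom_injective W (h.trans (map_zero _).symm)]
    rfl
  · intro y
    obtain ⟨x, hx⟩ := (canonicalChain_eq_zero_iff_mem_range B).1
      (show canonicalChain B (y - s (canonicalChain B y)) = 0 by rw [map_sub, hs, sub_self])
    refine ⟨(x, canonicalChain B y), ?_⟩
    change suspensionColimitHom W x + s (canonicalChain B y) = y
    rw [hx, sub_add_cancel]

/-- The canonical map. -/
noncomputable def canonicalMap : PolytopeGroup W →+ SteinbergGroup W :=
  (QuotientAddGroup.mk' _).comp (canonicalChain B)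

theorem isCanonicalMap_canonicalMap : IsCanonicalMap B (canonicalMap B) := by
  intro v hv
  rw [canonicalMap, AddMonoidHom.comp_apply, canonicalChain_simplexPolytope, map_zsmul]
  rfl

theorem canonicalMap_eq_zero_iff {y : PolytopeGroup W} :
    canonicalMap B y = 0 ↔ canonicalChain B y = 0 := by
  rw [canonicalMap, AddMonoidHom.comp_apply]
  exact map_eq_zero_iff _ steinbergMk_injective

theorem exact_canonicalMap : Function.Exact (suspensionColimitHom W) (canonicalMap B) := fun y => by
  rw [canonicalMap_eq_zero_iff, canonicalChain_eq_zero_iff_mem_range, AddMonoidHom.mem_range,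
    mem_range]

theorem canonicalMap_surjective : Function.Surjective (canonicalMap B) :=
  (QuotientAddGroup.mk'_surjective _).comp (canonicalChain_surjective B)

theorem exists_canonicalMap_section :
    ∃ s : SteinbergGroup W →+ PolytopeGroup W, (canonicalMap B).comp s = AddMonoidHom.id _ := by
  have := free_steinbergGroup W
  obtain ⟨s, hs⟩ := Module.projective_lifting_property (canonicalMap B).toIntLinearMap
    LinearMap.id (canonicalMap_surjective B)
  exact ⟨s.toAddMonoidHom, AddMonoidHom.ext fun z => LinearMap.congr_fun hs z⟩

end Exactness

/-! ### Polytopes that are suspensions from two subspaces. -/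

section Intersections

variable {W : Type*} [NormedAddCommGroup W] [InnerProductSpace ℝ W] [FiniteDimensional ℝ W]

/-- Carathéodory's theorem for cones. -/
theorem exists_linearIndepOn_nonneg {ι : Type*} [Fintype ι] (u : ι → W) (c : ι → ℝ)
    (hc : ∀ i, 0 ≤ c i) : ∃ d : ι → ℝ, (∀ i, 0 ≤ d i) ∧ ∑ i, d i • u i = ∑ i, c i • u i ∧
      LinearIndepOn ℝ u {i | d i ≠ 0} := by
  classical
  induction hn : (Finset.univ.filter fun i => c i ≠ 0).card using Nat.strong_induction_on
    generalizing c with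
  | _ n ih =>
    by_cases hli : LinearIndepOn ℝ u {i | c i ≠ 0}
    · exact ⟨c, hc, rfl, hli⟩
    -- A linear relation among the vectors in use, with its sign chosen so that some coefficient is
    -- positive. Subtracting the largest multiple that keeps `c` nonnegative, given by the minimal
    -- ratio `c i / g i`, removes a vector.
    have h1 : ∃ g : ι → ℝ, (∀ i, c i = 0 → g i = 0) ∧ ∑ i, g i • u i = 0 ∧ ∃ i, 0 < g i := by
      rw [show {i | c i ≠ 0} = ((Finset.univ.filter fun i => c i ≠ 0 : Finset ι) : Set ι) by simp,
        linearIndepOn_finset_iff] at hli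
      push Not at hli
      obtain ⟨g, hg, i, hi, hgi⟩ := hli
      rw [Finset.sum_filter] at hg
      have hg' : ∑ i, (if c i ≠ 0 then g i else 0) • u i = 0 := by
        rw [← hg]
        exact Finset.sum_congr rfl fun i _ => by split_ifs <;> simp
      have hci : c i ≠ 0 := (Finset.mem_filter.1 hi).2
      rcases hgi.lt_or_gt with h | h
      · refine ⟨fun i => -(if c i ≠ 0 then g i else 0), fun i h => by simp [h], ?_, i, ?_⟩
        · simp only [neg_smul, Finset.sum_neg_distrib, hg', neg_zero]
        · simp only [if_pos hci]
          linarith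
      · exact ⟨fun i => if c i ≠ 0 then g i else 0, fun i h => by simp [h], hg', i, by
          simpa only [if_pos hci] using h⟩
    obtain ⟨g, hgc, hg, i₁, hi₁⟩ := h1
    obtain ⟨i₀, hi₀, hmin⟩ := Finset.exists_min_image (Finset.univ.filter fun i => 0 < g i)
      (fun i => c i / g i) ⟨i₁, by simpa using hi₁⟩
    have hi₀ : 0 < g i₀ := (Finset.mem_filter.1 hi₀).2
    have ht : 0 ≤ c i₀ / g i₀ := div_nonneg (hc _) hi₀.le
    have hci₀ : c i₀ ≠ 0 := fun h => hi₀.ne' (hgc _ h)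
    obtain ⟨d, hd, hdc, hdl⟩ := ih _ (by
      rw [← hn]
      refine Finset.card_lt_card (Finset.ssubset_iff_of_subset (fun i hi => ?_) |>.2 ⟨i₀, ?_, ?_⟩)
      · refine Finset.mem_filter.2 ⟨Finset.mem_univ _, fun h => (Finset.mem_filter.1 hi).2 ?_⟩
        rw [h, hgc i h, mul_zero, sub_zero]
      · exact Finset.mem_filter.2 ⟨Finset.mem_univ _, hci₀⟩
      · intro h
        refine (Finset.mem_filter.1 h).2 ?_
        rw [div_mul_cancel₀ _ hi₀.ne', sub_self]) (fun i => c i - c i₀ / g i₀ * g i) (fun i => by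
      by_cases hgi : 0 < g i
      · have h2 := hmin i (Finset.mem_filter.2 ⟨Finset.mem_univ _, hgi⟩)
        rw [le_div_iff₀ hgi] at h2
        linarith
      · have := mul_nonneg ht (neg_nonneg.2 (not_lt.1 hgi))
        have := hc i
        linarith) rfl
    refine ⟨d, hd, hdc.trans ?_, hdl⟩
    simp only [sub_smul, Finset.sum_sub_distrib, mul_smul, ← Finset.smul_sum, hg, smul_zero,
      sub_zero]

/-- A cone that spans the space is the union of the simplicial cones on the bases among its
generators. -/
theorem exists_basis_nonneg {ι : Type*} [Fintype ι] {u : ι → W}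
    (hu : Submodule.span ℝ (range u) = ⊤) (c : ι → ℝ) (hc : ∀ i, 0 ≤ c i) :
    ∃ f : Fin (Module.finrank ℝ W) → ι, LinearIndependent ℝ (fun k => u (f k)) ∧
      ∃ d : Fin (Module.finrank ℝ W) → ℝ, (∀ k, 0 ≤ d k) ∧
        ∑ i, c i • u i = ∑ k, d k • u (f k) := by
  classical
  obtain ⟨d, hd, hdc, hdl⟩ := exists_linearIndepOn_nonneg u c hc
  obtain ⟨s, -, hs, hsp, hsl⟩ := exists_linearIndepOn_extension hdl (subset_univ _)
  have hcard : Fintype.card s = Module.finrank ℝ W := by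
    rw [← finrank_span_eq_card hsl]
    have h1 : range (fun i : s => u i) = u '' s := (image_eq_range _ _).symm
    have h2 : Submodule.span ℝ (u '' s) = ⊤ := by
      rw [eq_top_iff, ← hu, Submodule.span_le]
      rwa [image_univ] at hsp
    rw [h1, h2, finrank_top]
  let E : Fin (Module.finrank ℝ W) ≃ s := (Fintype.equivFinOfCardEq hcard).symm
  refine ⟨fun k => E k, hsl.comp E E.injective, fun k => d (E k), fun k => hd _, ?_⟩
  rw [← hdc, E.sum_comp fun i : s => d i • u i, ← Finset.sum_subset (Finset.subset_univ s.toFinset) fun i _ hi => ?_]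
  · exact (Finset.sum_subtype s.toFinset (by simp) fun i => d i • u i)
  · have : d i = 0 := by
      by_contra h
      exact hi (mem_toFinset.2 (hs h))
    rw [this, zero_smul]

theorem proj_coe {V : Submodule ℝ W} (p : V) : proj V (p : W) = p :=
  ext_inner_left ℝ fun u => by rw [inner_proj]; rfl

theorem sub_proj_mem_orthogonal (V : Submodule ℝ W) (w : W) : w - (proj V w : W) ∈ Vᗮ :=
  (Submodule.mem_orthogonal _ _).2 fun u hu => by
    rw [inner_sub_right, sub_eq_zero]
    exact (inner_proj (⟨u, hu⟩ : V) w).symm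

/-- The intersection of a polytope with a subspace whose orthogonal complement leaves it
invariant. -/
theorem isPolytope_inter {D : Submodule ℝ W} {Q : Set (Metric.sphere (0 : W) 1)} (hQ : IsPolytope Q)
    (h : ∀ w ∈ coneOf Q, (proj D w : W) ∈ coneOf Q) :
    IsPolytope {p : Metric.sphere (0 : D) 1 | ((p : D) : W) ∈ coneOf Q} := by
  classical
  obtain ⟨F, hF, ⟨v₀, hv₀⟩, hli, rfl⟩ := hQ
  have hspan : ∀ v ∈ F, Submodule.span ℝ (range fun i => proj D (v i : W)) = ⊤ := by
    intro v hv
    rw [show (range fun i => proj D (v i : W)) = proj D '' range (fun i => (v i : W)) from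
      range_comp _ _, Submodule.span_image, (hli v hv).span_eq_top_of_card_eq_finrank' (by simp),
      Submodule.map_top, LinearMap.range_eq_top]
    exact fun p => ⟨p, proj_coe p⟩
  -- By the invariance hypothesis the intersection with `D` is also the projection to `D`. The
  -- projection of a simplicial cone is generated by the projected vertices, and by
  -- `exists_basis_nonneg` it is the union of the cones on the bases among them; `X` enumerates
  -- these.
  let X := {x : F × (Fin (Module.finrank ℝ D) → Fin (Module.finrank ℝ W)) //
    LinearIndependent ℝ fun k => proj D (x.1.1 (x.2 k) : W)}
  let ξ : X → Fin (Module.finrank ℝ D) → Metric.sphere (0 : D) 1 := fun x k =>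
    toSphere (proj D (x.1.1.1 (x.1.2 k) : W)) (x.2.ne_zero k)
  have hξ : ∀ x k, ‖proj D (x.1.1.1 (x.1.2 k) : W)‖ • (ξ x k : D) =
      proj D (x.1.1.1 (x.1.2 k) : W) := fun x k => norm_smul_toSphere _ _
  have hξ0 : ∀ (x : X) k, 0 < ‖proj D (x.1.1.1 (x.1.2 k) : W)‖ := fun x k =>
    norm_pos_iff.2 (x.2.ne_zero k)
  have : Finite F := hF
  refine ⟨range ξ, finite_range ξ, ?_, ?_, ?_⟩
  -- Zero coefficients suffice here: only the existence of a basis among the projected vertices is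
  -- used.
  · obtain ⟨f, hf, -⟩ := exists_basis_nonneg (hspan v₀ hv₀) 0 fun _ => le_rfl
    exact ⟨_, ⟨(⟨v₀, hv₀⟩, f), hf⟩, rfl⟩
  · rintro _ ⟨x, rfl⟩
    have h1 := x.2.units_smul fun k => Units.mk0 _ (inv_ne_zero (hξ0 x k).ne')
    convert! h1 using 2 with k
  · ext p
    rw [biUnion_range]
    simp only [mem_iUnion, mem_ofPred_eq, mem_sphericalHull_iff]
    constructor
    · intro hp
      let q : Metric.sphere (0 : W) 1 := ⟨p, mem_sphere_zero_iff_norm.2 (norm_eq_of_mem_sphere p)⟩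
      have hq : q ∈ ⋃ v ∈ F, sphericalHull v := coe_mem_coneOf.1 hp
      simp only [mem_iUnion, mem_sphericalHull_iff] at hq
      obtain ⟨v, hv, c, hc, hqc⟩ := hq
      obtain ⟨f, hf, d, hd, hcd⟩ := exists_basis_nonneg (hspan v hv) c hc
      refine ⟨⟨(⟨v, hv⟩, f), hf⟩, fun k => d k * ‖proj D (v (f k) : W)‖,
        fun k => mul_nonneg (hd k) (norm_nonneg _), ?_⟩
      calc (p : D) = proj D (q : W) := (proj_coe _).symm
        _ = ∑ k, d k • proj D (v (f k) : W) := by rw [hqc, map_sum, ← hcd]; simp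
        _ = _ := Finset.sum_congr rfl fun k _ => by
          rw [mul_smul]
          exact congrArg _ (hξ ⟨(⟨v, hv⟩, f), hf⟩ k).symm
    · rintro ⟨x, d, hd, hp⟩
      -- A lift of `p` to the original simplicial cone; the inverse norms undo the normalization of
      -- the projected vertices. The hypothesis `h` brings `proj D w = p` back into the cone over
      -- the polytope.
      let w : W := ∑ k, (d k * ‖proj D (x.1.1.1 (x.1.2 k) : W)‖⁻¹) • (x.1.1.1 (x.1.2 k) : W)
      have hw : proj D w = p := by
        rw [hp, map_sum]
        refine Finset.sum_congr rfl fun k _ => ?_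
        rw [map_smul, ← hξ x k, smul_smul, mul_assoc, norm_smul, norm_norm,
          norm_eq_of_mem_sphere, mul_one, inv_mul_cancel₀ (hξ0 x k).ne', mul_one]
      have hw0 : w ≠ 0 := by
        intro h0
        have := norm_eq_of_mem_sphere p
        rw [← hw, h0, map_zero, norm_zero] at this
        norm_num at this
      rw [← hw]
      refine h w ((toSphere_mem_iff hw0).1 ?_)
      refine mem_biUnion x.1.1.2 ((mem_sphericalHull_iff _ _).2 ⟨fun i => ‖w‖⁻¹ *
        ∑ k, if x.1.2 k = i then d k * ‖proj D (x.1.1.1 (x.1.2 k) : W)‖⁻¹ else 0,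
        fun i => ?_, ?_⟩)
      · refine mul_nonneg (by positivity) (Finset.sum_nonneg fun k _ => ?_)
        split_ifs
        · exact mul_nonneg (hd k) (by positivity)
        · exact le_rfl
      · change ‖w‖⁻¹ • w = _
        simp only [mul_smul, ← Finset.smul_sum, Finset.sum_smul, ite_smul, zero_smul]
        rw [Finset.sum_comm]
        simp [w, mul_smul]

theorem IsSuspensionFrom.add_mem {V : Submodule ℝ W} {Q : Polytope W} (h : IsSuspensionFrom V Q)
    {w u : W} (hw : w ∈ coneOf Q.1) (hu : u ∈ Vᗮ) : w + u ∈ coneOf Q.1 := by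
  obtain ⟨P, rfl⟩ := h
  have h1 : proj V u = 0 := ext_inner_left ℝ fun a => by
    rw [inner_proj, inner_zero_right]
    exact (Submodule.mem_orthogonal _ _).1 hu _ a.2
  change w ∈ coneOf (suspensionSet _ _) at hw
  change w + u ∈ coneOf (suspensionSet _ _)
  rw [coneOf_suspensionSet, mem_preimage] at hw ⊢
  rw [map_add, h1, add_zero]
  exact hw

/-- The cone over `Q` is invariant under translation by `Uᗮ` and by `Vᗮ`, hence by `Uᗮ ⊔ Vᗮ = (U ⊓
V)ᗮ`. So it is the preimage, under the projection, of its intersection with `U ⊓ V`, which is a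
polytope by `isPolytope_inter`. -/
theorem IsSuspensionFrom.inf {U V : Submodule ℝ W} {Q : Polytope W} (hU : IsSuspensionFrom U Q)
    (hV : IsSuspensionFrom V Q) : IsSuspensionFrom (U ⊓ V) Q := by
  have hinv : ∀ w ∈ coneOf Q.1, ∀ u ∈ (U ⊓ V)ᗮ, w + u ∈ coneOf Q.1 := by
    intro w hw u hu
    have h1 : (U ⊓ V)ᗮ = Uᗮ ⊔ Vᗮ := by
      rw [← Submodule.orthogonal_orthogonal (Uᗮ ⊔ Vᗮ), ← Submodule.inf_orthogonal,
        Submodule.orthogonal_orthogonal, Submodule.orthogonal_orthogonal]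
    rw [h1] at hu
    obtain ⟨a, ha, c, hc, rfl⟩ := Submodule.mem_sup.1 hu
    rw [← add_assoc]
    exact hV.add_mem (hU.add_mem hw ha) hc
  have h1 : ∀ w, (proj (U ⊓ V) w : W) ∈ coneOf Q.1 ↔ w ∈ coneOf Q.1 := by
    intro w
    have h2 := sub_proj_mem_orthogonal (U ⊓ V) w
    constructor
    · intro h
      simpa using hinv _ h _ h2
    · intro h
      simpa using hinv _ h _ (Submodule.neg_mem _ h2)
  refine ⟨⟨_, isPolytope_inter Q.2 fun w hw => (h1 w).2 hw⟩, Subtype.ext ?_⟩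
  ext x
  change x ∈ suspensionSet _ _ ↔ _
  rw [← coe_mem_coneOf, coneOf_suspensionSet, mem_preimage, ← coe_mem_coneOf (P := Q.1), ← h1]
  by_cases h0 : proj (U ⊓ V) (x : W) = 0
  · rw [show LinearMap.adjoint (U ⊓ V).subtypeₗᵢ.toLinearMap (x : W) = 0 from h0]
    exact ⟨fun _ => Or.inl rfl, fun _ => Or.inl rfl⟩
  · refine (toSphere_mem_iff h0).symm.trans ?_
    change ((‖_‖⁻¹ • proj (U ⊓ V) (x : W) : (U ⊓ V : Submodule ℝ W)) : W) ∈ coneOf Q.1 ↔ _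
    rw [Submodule.coe_smul]
    have hn := norm_pos_iff.2 h0
    refine ⟨fun h => ?_, fun h => smul_mem_coneOf h (inv_pos.2 hn)⟩
    have h3 := smul_mem_coneOf h hn
    rwa [smul_smul, mul_inv_cancel₀ hn.ne', one_smul] at h3

end Intersections
theorem mainTheorem9 (W : Type*) [NormedAddCommGroup W] [InnerProductSpace ℝ W]
    [FiniteDimensional ℝ W] :
    -- the three groups are free abelian
    (Module.Free ℤ (SuspensionColimit W) ∧ Module.Free ℤ (PolytopeGroup W) ∧
      Module.Free ℤ (SteinbergGroup W)) ∧
    -- the canonical maps exist and form a split short exact sequence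
    (∀ e : Module.Basis (Fin (Module.finrank ℝ W)) ℝ W,
      (∃! π : PolytopeGroup W →+ SteinbergGroup W, IsCanonicalMap e π) ∧
      ∀ π : PolytopeGroup W →+ SteinbergGroup W, IsCanonicalMap e π →
        Function.Injective (suspensionColimitHom W) ∧
        Function.Exact (suspensionColimitHom W) π ∧
        Function.Surjective π ∧
        ∃ s : SteinbergGroup W →+ PolytopeGroup W, π.comp s = AddMonoidHom.id _) ∧
    -- suspensions from two subspaces are suspensions from the intersection
    (∀ (U V : Submodule ℝ W) (Q : Polytope W),
      IsSuspensionFrom U Q → IsSuspensionFrom V Q → IsSuspensionFrom (U ⊓ V) Q) := by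
  refine ⟨⟨free_suspensionColimit W, free_polytopeGroup W, free_steinbergGroup W⟩, fun e => ?_,
    fun U V Q hU hV => hU.inf hV⟩
  refine ⟨⟨canonicalMap e, isCanonicalMap_canonicalMap e,
    fun π hπ => hπ.eq (isCanonicalMap_canonicalMap e)⟩, fun π hπ => ?_⟩
  obtain rfl := hπ.eq (isCanonicalMap_canonicalMap e)
  exact ⟨suspensionColimitHom_injective W, exact_canonicalMap e, canonicalMap_surjective e,
    exists_canonicalMap_section e⟩
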